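/- Let $\Gamma$ be a finite connected graph (a finite simplicial complex of dimension at most one, identified with its geometric realization) which is not homeomorphic to the circle. All homology is singular homology with integral coefficients. Let $F(\Gamma,2)=\{(x,y)\in\Gamma\times\Gamma : x\neq y\}$. For $x\in\Gamma$ let $\mathrm{supp}\{x\}$ be the closure of the simplex containing $x$ in its interior (so it is $x$ itself if $x$ is a vertex, and the closed edge $e$ if $x$ lies in the interior of $e$), and put $$D(\Gamma,2)=\{(x,y)\in\Gamma\times\Gamma : \mathrm{supp}\{x\}\cap\mathrm{supp}\{y\}=\emptyset\},\qquad N=\overline{\Gamma\times\Gamma-D(\Gamma,2)},\qquad \partial N=N\cap D(\Gamma,2).$$ Then the homology cross product $H_1(\Gamma)\otimes H_1(\Gamma)\to H_2(\Gamma\times\Gamma)$ and the homomorphism $H_2(N,\partial N)\to H_2(\Gamma\times\Gamma,D(\Gamma,2))$ induced by inclusion are isomorphisms. Let the intersection form $$I_\Gamma: H_1(\Gamma)\otimes H_1(\Gamma)\to H_2(N,\partial N)$$ be the composition of the cross product $H_1(\Gamma)\otimes H_1(\Gamma)\to H_2(\Gamma\times\Gamma)$, the homomorphism $j_*:H_2(\Gamma\times\Gamma)\to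 H_2(\Gamma\times\Gamma,D(\Gamma,2))$, and the inverse of the isomorphism $H_2(N,\partial N)\to H_2(\Gamma\times\Gamma,D(\Gamma,2))$. Then (i) $H_2(F(\Gamma,2))\cong \mathrm{Ker}(I_\Gamma)$; (ii) $H_1(F(\Gamma,2))\cong \mathrm{coker}(I_\Gamma)\oplus H_1(\Gamma)\oplus H_1(\Gamma)$. -/

import Mathlib

namespace GraphConf

open CategoryTheory Simplicial
open scoped TensorProduct

/-- Singular chains with integral coefficients. -/
noncomputable abbrev singChainsFunctor : TopCat.{0} ⥤ ChainComplex AddCommGrpCat.{0} ℕ :=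
  (AlgebraicTopology.singularChainComplexFunctor AddCommGrpCat.{0}).obj (AddCommGrpCat.of ℤ)

/-- Singular homology with integral coefficients. -/
noncomputable abbrev singHomologyFunctor (n : ℕ) : TopCat.{0} ⥤ AddCommGrpCat.{0} :=
  (AlgebraicTopology.singularHomologyFunctor AddCommGrpCat.{0} n).obj (AddCommGrpCat.of ℤ)

/-- `H_n(X)`, the integral singular homology group. -/
noncomputable abbrev singHomology (n : ℕ) (X : Type) [TopologicalSpace X] : AddCommGrpCat.{0} :=
  (singHomologyFunctor n).obj (TopCat.of X)

/-- Relative singular chains `C(X, A) = C(X) / C(A)` of a pair. -/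
noncomputable def relChainsFunctor : TopPair.{0} ⥤ ChainComplex AddCommGrpCat.{0} ℕ :=
  MorphismProperty.Arrow.forget _ _ _ ⋙ singChainsFunctor.mapArrow ⋙ Limits.coker _

/-- Relative singular homology `H_n(X, A)`. -/
noncomputable def relHomologyFunctor (n : ℕ) : TopPair.{0} ⥤ AddCommGrpCat.{0} :=
  relChainsFunctor ⋙ HomologicalComplex.homologyFunctor _ _ n

/-- The map `j_* : H_n(X) → H_n(X, A)`. -/
noncomputable def toRelHomology (n : ℕ) (P : TopPair.{0}) :
    (singHomologyFunctor n).obj P.fst ⟶ (relHomologyFunctor n).obj P :=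
  (HomologicalComplex.homologyFunctor AddCommGrpCat.{0} _ n).map
    ((Limits.coker.π _).app (singChainsFunctor.mapArrow.obj P.toComma))

section CrossProduct

variable {X Y : Type} [TopologicalSpace X] [TopologicalSpace Y]

/-- The singular simplicial set of a space. -/
noncomputable abbrev singSet (X : Type) [TopologicalSpace X] : SSet.{0} :=
  TopCat.toSSet.obj (TopCat.of X)

/-- The integral singular chain complex of a space. -/
noncomputable abbrev singChains (X : Type) [TopologicalSpace X] :
    ChainComplex AddCommGrpCat.{0} ℕ :=
  singChainsFunctor.obj (TopCat.of X)

/-- The singular simplex `(a, b)` of `X × Y` with components `a` and `b`. -/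
noncomputable def pair {n : ℕ} (a : singSet X _⦋n⦌) (b : singSet Y _⦋n⦌) :
    singSet (X × Y) _⦋n⦌ :=
  ((TopCat.of (X × Y)).toSSetObjEquiv _).symm
    (((TopCat.of X).toSSetObjEquiv _ a).prodMk ((TopCat.of Y).toSSetObjEquiv _ b))

theorem pair_δ {n : ℕ} (a : singSet X _⦋n + 1⦌) (b : singSet Y _⦋n + 1⦌) (i : Fin (n + 2)) :
    (singSet (X × Y)).δ i (pair a b) = pair ((singSet X).δ i a) ((singSet Y).δ i b) := rfl

/-- A singular simplex regarded as a singular chain (a free generator). -/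
noncomputable def simplexChain {n : ℕ} (a : singSet X _⦋n⦌) : (singChains X).X n :=
  ((singSet X).ιChainComplex (R := AddCommGrpCat.of ℤ) a).hom (1 : ℤ)

/-- The additive map on singular chains with prescribed values on singular simplices. -/
noncomputable def liftChain {n : ℕ} {A : Type} [AddCommGroup A] (f : singSet X _⦋n⦌ → A) :
    (singChains X).X n →+ A :=
  (Limits.Sigma.desc (f := fun _ : singSet X _⦋n⦌ => AddCommGrpCat.of ℤ)
    (P := AddCommGrpCat.of A)
    (fun a => AddCommGrpCat.ofHom (zmultiplesHom A (f a)))).hom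

theorem liftChain_simplexChain {n : ℕ} {A : Type} [AddCommGroup A] (f : singSet X _⦋n⦌ → A)
    (a : singSet X _⦋n⦌) : liftChain f (simplexChain a) = f a := by
  have h := congrArg (fun g => g.hom (1 : ℤ))
    (Limits.Sigma.ι_desc (f := fun _ : singSet X _⦋n⦌ => AddCommGrpCat.of ℤ)
      (P := AddCommGrpCat.of A) (fun a => AddCommGrpCat.ofHom (zmultiplesHom A (f a))) a)
  exact h.trans (one_zsmul (f a))

theorem chain_hom_ext {n : ℕ} {A : Type} [AddCommGroup A] {f g : (singChains X).X n →+ A}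
    (h : ∀ a, f (simplexChain a) = g (simplexChain a)) : f = g := by
  have : AddCommGrpCat.ofHom f = AddCommGrpCat.ofHom g := by
    refine SSet.chainComplex_hom_ext (X := singSet X) (fun a => ?_)
    ext
    exact h a
  exact congrArg AddCommGrpCat.Hom.hom this

theorem d_simplexChain {n : ℕ} (a : singSet X _⦋n + 1⦌) :
    ((singChains X).d (n + 1) n).hom (simplexChain a) =
      ∑ i : Fin (n + 2), (-1 : ℤ) ^ (i : ℕ) • simplexChain ((singSet X).δ i a) := by
  have h := congrArg (fun g => g.hom (1 : ℤ))
    ((singSet X).ιChainComplex_d (R := AddCommGrpCat.of ℤ) a)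
  refine h.trans ?_
  let ev := (AddMonoidHom.eval (1 : ℤ)).comp
    (AddCommGrpCat.homAddEquiv (M := AddCommGrpCat.of ℤ) (N := (singChains X).X n)).toAddMonoidHom
  exact (map_sum ev _ _).trans (Finset.sum_congr rfl fun i _ => map_zsmul ev _ _)

theorem faces1 (S : SSet.{0}) (x : S _⦋1⦌) :
    S.δ 0 (S.σ 0 x) = x ∧
    S.δ 1 (S.σ 0 x) = x ∧
    S.δ 2 (S.σ 0 x) = S.σ 0 (S.δ 1 x) ∧
    S.δ 0 (S.σ 1 x) = S.σ 0 (S.δ 0 x) ∧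
    S.δ 1 (S.σ 1 x) = x ∧
    S.δ 2 (S.σ 1 x) = x :=
  ⟨SSet.δ_comp_σ_self'_apply (j := 0) (i := 0) (by decide) x,
   SSet.δ_comp_σ_succ'_apply (j := 1) (i := 0) (by decide) x,
   SSet.δ_comp_σ_of_gt_apply (i := 1) (j := 0) (by decide) x,
   SSet.δ_comp_σ_of_le_apply (i := 0) (j := 0) (by decide) x,
   SSet.δ_comp_σ_self'_apply (j := 1) (i := 1) (by decide) x,
   SSet.δ_comp_σ_succ'_apply (j := 2) (i := 1) (by decide) x⟩

theorem faces2 (S : SSet.{0}) (x : S _⦋2⦌) :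
    S.δ 0 (S.σ 0 x) = x ∧
    S.δ 1 (S.σ 0 x) = x ∧
    S.δ 2 (S.σ 0 x) = S.σ 0 (S.δ 1 x) ∧
    S.δ 3 (S.σ 0 x) = S.σ 0 (S.δ 2 x) ∧
    S.δ 0 (S.σ 1 x) = S.σ 0 (S.δ 0 x) ∧
    S.δ 1 (S.σ 1 x) = x ∧
    S.δ 2 (S.σ 1 x) = x ∧
    S.δ 3 (S.σ 1 x) = S.σ 1 (S.δ 2 x) ∧
    S.δ 0 (S.σ 2 x) = S.σ 1 (S.δ 0 x) ∧
    S.δ 1 (S.σ 2 x) = S.σ 1 (S.δ 1 x) ∧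
    S.δ 2 (S.σ 2 x) = x ∧
    S.δ 3 (S.σ 2 x) = x :=
  ⟨SSet.δ_comp_σ_self'_apply (j := 0) (i := 0) (by decide) x,
   SSet.δ_comp_σ_succ'_apply (j := 1) (i := 0) (by decide) x,
   SSet.δ_comp_σ_of_gt_apply (i := 1) (j := 0) (by decide) x,
   SSet.δ_comp_σ_of_gt_apply (i := 2) (j := 0) (by decide) x,
   SSet.δ_comp_σ_of_le_apply (i := 0) (j := 0) (by decide) x,
   SSet.δ_comp_σ_self'_apply (j := 1) (i := 1) (by decide) x,
   SSet.δ_comp_σ_succ'_apply (j := 2) (i := 1) (by decide) x,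
   SSet.δ_comp_σ_of_gt_apply (i := 2) (j := 1) (by decide) x,
   SSet.δ_comp_σ_of_le_apply (i := 0) (j := 1) (by decide) x,
   SSet.δ_comp_σ_of_le_apply (i := 1) (j := 1) (by decide) x,
   SSet.δ_comp_σ_self'_apply (j := 2) (i := 2) (by decide) x,
   SSet.δ_comp_σ_succ'_apply (j := 3) (i := 2) (by decide) x⟩


/-- The biadditive map on singular chains with prescribed values on pairs of simplices. -/
noncomputable def liftChain₂ {p q r : ℕ}
    (f : singSet X _⦋p⦌ → singSet Y _⦋q⦌ → (singChains (X × Y)).X r) :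
    (singChains X).X p →+ (singChains Y).X q →+ (singChains (X × Y)).X r :=
  liftChain fun a => liftChain fun b => f a b

theorem liftChain₂_simplexChain {p q r : ℕ}
    (f : singSet X _⦋p⦌ → singSet Y _⦋q⦌ → (singChains (X × Y)).X r) (a b) :
    liftChain₂ f (simplexChain a) (simplexChain b) = f a b := by
  simp [liftChain₂, liftChain_simplexChain]

/-- The Eilenberg-Zilber shuffle product `C_0(X) × C_1(Y) → C_1(X × Y)`. -/
noncomputable def cross01 : (singChains X).X 0 →+ (singChains Y).X 1 →+
    (singChains (X × Y)).X 1 :=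
  liftChain₂ fun a b => simplexChain (pair ((singSet X).σ 0 a) b)

/-- The Eilenberg-Zilber shuffle product `C_1(X) × C_0(Y) → C_1(X × Y)`. -/
noncomputable def cross10 : (singChains X).X 1 →+ (singChains Y).X 0 →+
    (singChains (X × Y)).X 1 :=
  liftChain₂ fun a b => simplexChain (pair a ((singSet Y).σ 0 b))

/-- The Eilenberg-Zilber shuffle product `C_1(X) × C_1(Y) → C_2(X × Y)`. -/
noncomputable def cross11 : (singChains X).X 1 →+ (singChains Y).X 1 →+
    (singChains (X × Y)).X 2 :=
  liftChain₂ fun a b =>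
    simplexChain (pair ((singSet X).σ 1 a) ((singSet Y).σ 0 b)) -
      simplexChain (pair ((singSet X).σ 0 a) ((singSet Y).σ 1 b))

/-- The Eilenberg-Zilber shuffle product `C_2(X) × C_0(Y) → C_2(X × Y)`. -/
noncomputable def cross20 : (singChains X).X 2 →+ (singChains Y).X 0 →+
    (singChains (X × Y)).X 2 :=
  liftChain₂ fun a b => simplexChain (pair a ((singSet Y).σ 1 ((singSet Y).σ 0 b)))

/-- The Eilenberg-Zilber shuffle product `C_0(X) × C_2(Y) → C_2(X × Y)`. -/
noncomputable def cross02 : (singChains X).X 0 →+ (singChains Y).X 2 →+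
    (singChains (X × Y)).X 2 :=
  liftChain₂ fun a b => simplexChain (pair ((singSet X).σ 1 ((singSet X).σ 0 a)) b)

/-- The Eilenberg-Zilber shuffle product `C_2(X) × C_1(Y) → C_3(X × Y)`. -/
noncomputable def cross21 : (singChains X).X 2 →+ (singChains Y).X 1 →+
    (singChains (X × Y)).X 3 :=
  liftChain₂ fun a b =>
    simplexChain (pair ((singSet X).σ 2 a) ((singSet Y).σ 1 ((singSet Y).σ 0 b))) -
    simplexChain (pair ((singSet X).σ 1 a) ((singSet Y).σ 2 ((singSet Y).σ 0 b))) +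
    simplexChain (pair ((singSet X).σ 0 a) ((singSet Y).σ 2 ((singSet Y).σ 1 b)))

/-- The Eilenberg-Zilber shuffle product `C_1(X) × C_2(Y) → C_3(X × Y)`. -/
noncomputable def cross12 : (singChains X).X 1 →+ (singChains Y).X 2 →+
    (singChains (X × Y)).X 3 :=
  liftChain₂ fun a b =>
    simplexChain (pair ((singSet X).σ 2 ((singSet X).σ 1 a)) ((singSet Y).σ 0 b)) -
    simplexChain (pair ((singSet X).σ 2 ((singSet X).σ 0 a)) ((singSet Y).σ 1 b)) +
    simplexChain (pair ((singSet X).σ 1 ((singSet X).σ 0 a)) ((singSet Y).σ 2 b))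


theorem d_cross11 (x : (singChains X).X 1) (y : (singChains Y).X 1) :
    ((singChains (X × Y)).d 2 1).hom (cross11 x y) = 
      cross01 (((singChains X).d 1 0).hom x) y -
        cross10 x (((singChains Y).d 1 0).hom y) := by
  let f : (singChains X).X 1 →+ (singChains Y).X 1 →+ (singChains (X × Y)).X 1 :=
    (AddMonoidHom.compHom ((singChains (X × Y)).d 2 1).hom).comp cross11
  let g : (singChains X).X 1 →+ (singChains Y).X 1 →+ (singChains (X × Y)).X 1 :=
    cross01.comp ((singChains X).d 1 0).hom -
      (AddMonoidHom.compHom.flip ((singChains Y).d 1 0).hom).comp cross10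
  suffices h : f = g from congrArg (fun k => k x y) h
  refine chain_hom_ext fun a => chain_hom_ext fun b => ?_
  change ((singChains (X × Y)).d 2 1).hom (cross11 (simplexChain a) (simplexChain b)) = 
      cross01 (((singChains X).d 1 0).hom (simplexChain a)) (simplexChain b) -
        cross10 (simplexChain a) (((singChains Y).d 1 0).hom (simplexChain b))
  simp only [cross11, cross01, cross10, d_simplexChain, Fin.sum_univ_succ, map_add, map_sub,
    map_zsmul, liftChain₂_simplexChain, AddMonoidHom.add_apply, AddMonoidHom.zsmul_apply, pair_δ]
  simp [faces1]
  abel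

theorem d_cross21 (x : (singChains X).X 2) (y : (singChains Y).X 1) :
    ((singChains (X × Y)).d 3 2).hom (cross21 x y) = 
      cross11 (((singChains X).d 2 1).hom x) y +
        cross20 x (((singChains Y).d 1 0).hom y) := by
  let f : (singChains X).X 2 →+ (singChains Y).X 1 →+ (singChains (X × Y)).X 2 :=
    (AddMonoidHom.compHom ((singChains (X × Y)).d 3 2).hom).comp cross21
  let g : (singChains X).X 2 →+ (singChains Y).X 1 →+ (singChains (X × Y)).X 2 :=
    cross11.comp ((singChains X).d 2 1).hom +
      (AddMonoidHom.compHom.flip ((singChains Y).d 1 0).hom).comp cross20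
  suffices h : f = g from congrArg (fun k => k x y) h
  refine chain_hom_ext fun a => chain_hom_ext fun b => ?_
  change ((singChains (X × Y)).d 3 2).hom (cross21 (simplexChain a) (simplexChain b)) = 
      cross11 (((singChains X).d 2 1).hom (simplexChain a)) (simplexChain b) +
        cross20 (simplexChain a) (((singChains Y).d 1 0).hom (simplexChain b))
  simp only [cross21, cross11, cross20, d_simplexChain, Fin.sum_univ_succ, map_add, map_sub,
    map_zsmul, liftChain₂_simplexChain, AddMonoidHom.add_apply, AddMonoidHom.zsmul_apply, pair_δ]
  simp [faces1, faces2]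
  abel

theorem d_cross12 (x : (singChains X).X 1) (y : (singChains Y).X 2) :
    ((singChains (X × Y)).d 3 2).hom (cross12 x y) = 
      cross02 (((singChains X).d 1 0).hom x) y -
        cross11 x (((singChains Y).d 2 1).hom y) := by
  let f : (singChains X).X 1 →+ (singChains Y).X 2 →+ (singChains (X × Y)).X 2 :=
    (AddMonoidHom.compHom ((singChains (X × Y)).d 3 2).hom).comp cross12
  let g : (singChains X).X 1 →+ (singChains Y).X 2 →+ (singChains (X × Y)).X 2 :=
    cross02.comp ((singChains X).d 1 0).hom -
      (AddMonoidHom.compHom.flip ((singChains Y).d 2 1).hom).comp cross11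
  suffices h : f = g from congrArg (fun k => k x y) h
  refine chain_hom_ext fun a => chain_hom_ext fun b => ?_
  change ((singChains (X × Y)).d 3 2).hom (cross12 (simplexChain a) (simplexChain b)) = 
      cross02 (((singChains X).d 1 0).hom (simplexChain a)) (simplexChain b) -
        cross11 (simplexChain a) (((singChains Y).d 2 1).hom (simplexChain b))
  simp only [cross12, cross02, cross11, d_simplexChain, Fin.sum_univ_succ, map_add, map_sub,
    map_zsmul, liftChain₂_simplexChain, AddMonoidHom.add_apply, AddMonoidHom.zsmul_apply, pair_δ]
  simp [faces1, faces2]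
  abel

theorem iCycles_injective (K : ChainComplex AddCommGrpCat.{0} ℕ) (n : ℕ) :
    Function.Injective (K.iCycles n).hom :=
  (AddCommGrpCat.mono_iff_injective _).1 inferInstance

theorem homologyπ_eq_zero (K : ChainComplex AddCommGrpCat.{0} ℕ) (n : ℕ) (z : K.cycles n)
    (e : K.X (n + 1)) (h : (K.iCycles n).hom z = (K.d (n + 1) n).hom e) :
    (K.homologyπ n).hom z = 0 := by
  have hz : z = (K.toCycles (n + 1) n).hom e := by
    apply iCycles_injective
    rw [h]
    exact (congrArg (fun g => g.hom e) (K.toCycles_i (n + 1) n)).symm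
  rw [hz]
  exact congrArg (fun g => g.hom e) (K.toCycles_comp_homologyπ (n + 1) n)

theorem d_iCycles (K : ChainComplex AddCommGrpCat.{0} ℕ) (m n : ℕ) (z : K.cycles m) :
    (K.d m n).hom ((K.iCycles m).hom z) = 0 :=
  congrArg (fun g => g.hom z) (K.iCycles_d m n)

/-- The cycle `z × w`, as a function of the cycle `z`. -/
noncomputable def crossCycles (w : (singChains Y).cycles 1) :
    (singChains X).cycles 1 ⟶ (singChains (X × Y)).cycles 2 :=
  (singChains (X × Y)).liftCycles
    ((singChains X).iCycles 1 ≫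
      AddCommGrpCat.ofHom (cross11.flip (((singChains Y).iCycles 1).hom w)))
    1 (by simp) (by
      ext z
      refine (d_cross11 _ _).trans ?_
      erw [d_iCycles (singChains X) 1 0 z, d_iCycles (singChains Y) 1 0 w]
      simp)

theorem crossCycles_iCycles (w : (singChains Y).cycles 1) :
    crossCycles w ≫ (singChains (X × Y)).iCycles 2 = (singChains X).iCycles 1 ≫
      AddCommGrpCat.ofHom (cross11.flip (((singChains Y).iCycles 1).hom w)) :=
  HomologicalComplex.liftCycles_i _ _ _ _ _

theorem iCycles_crossCycles (z : (singChains X).cycles 1) (w : (singChains Y).cycles 1) :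
    ((singChains (X × Y)).iCycles 2).hom ((crossCycles w).hom z) =
      cross11 (((singChains X).iCycles 1).hom z) (((singChains Y).iCycles 1).hom w) :=
  congrArg (fun g => g.hom z) (crossCycles_iCycles w)

/-- The homology class of `z × w`, as a function of the cycle `z`. -/
noncomputable def crossCycle (w : (singChains Y).cycles 1) :
    (singChains X).cycles 1 ⟶ (singChains (X × Y)).homology 2 :=
  crossCycles w ≫ (singChains (X × Y)).homologyπ 2

theorem crossCycle_boundary_left (a : (singChains X).X 2) (w : (singChains Y).cycles 1) :
    (crossCycle w).hom (((singChains X).toCycles 2 1).hom a) = 0 := by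
  refine homologyπ_eq_zero _ _ _ (cross21 a (((singChains Y).iCycles 1).hom w)) ?_
  rw [d_cross21, d_iCycles, map_zero, add_zero]
  refine (iCycles_crossCycles _ _).trans ?_
  exact congrArg (fun u => cross11 u _)
    (congrArg (fun g => g.hom a) ((singChains X).toCycles_i 2 1))

theorem crossCycle_boundary_right (z : (singChains X).cycles 1) (b : (singChains Y).X 2) :
    (crossCycle (((singChains Y).toCycles 2 1).hom b)).hom z = 0 := by
  refine homologyπ_eq_zero _ _ _ (- cross12 (((singChains X).iCycles 1).hom z) b) ?_
  rw [map_neg, d_cross12, d_iCycles, map_zero, AddMonoidHom.zero_apply, zero_sub, neg_neg]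
  refine (iCycles_crossCycles _ _).trans ?_
  exact congrArg (fun u => cross11 _ u)
    (congrArg (fun g => g.hom b) ((singChains Y).toCycles_i 2 1))

theorem crossCycle_add (w w' : (singChains Y).cycles 1) :
    crossCycle (X := X) (w + w') = crossCycle w + crossCycle w' := by
  rw [crossCycle, crossCycle, crossCycle, ← Preadditive.add_comp]
  congr 1
  rw [← cancel_mono ((singChains (X × Y)).iCycles 2), Preadditive.add_comp]
  simp only [crossCycles_iCycles, map_add]
  rfl

/-- The class of `z × w`, as a function of the homology class of `z`. -/
noncomputable def crossRight (w : (singChains Y).cycles 1) :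
    (singChains X).homology 1 ⟶ (singChains (X × Y)).homology 2 :=
  ((singChains X).homologyIsCokernel 2 1 (by simp)).desc
    (Limits.CokernelCofork.ofπ (crossCycle (X := X) w) (by
      ext a
      exact crossCycle_boundary_left a w))

theorem π_crossRight (w : (singChains Y).cycles 1) :
    (singChains X).homologyπ 1 ≫ crossRight w = crossCycle w :=
  Limits.Cofork.IsColimit.π_desc ((singChains X).homologyIsCokernel 2 1 (by simp))

theorem crossRight_add (w w' : (singChains Y).cycles 1) :
    crossRight (X := X) (w + w') = crossRight w + crossRight w' := by
  rw [← cancel_epi ((singChains X).homologyπ 1), Preadditive.comp_add, π_crossRight,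
    π_crossRight, π_crossRight, crossCycle_add]

theorem crossRight_boundary (b : (singChains Y).X 2) :
    crossRight (X := X) (((singChains Y).toCycles 2 1).hom b) = 0 := by
  rw [← cancel_epi ((singChains X).homologyπ 1), Limits.comp_zero, π_crossRight]
  ext z
  exact crossCycle_boundary_right (X := X) z b

/-- The class of `z × w`, as a function of the homology classes of `w` and `z`. -/
noncomputable def crossFlip : (singChains Y).homology 1 ⟶
    AddCommGrpCat.of ((singChains X).homology 1 →+ (singChains (X × Y)).homology 2) :=
  ((singChains Y).homologyIsCokernel 2 1 (by simp)).desc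
    (Limits.CokernelCofork.ofπ
      (AddCommGrpCat.ofHom (AddMonoidHom.mk' (fun w : (singChains Y).cycles 1 =>
        (crossRight (X := X) w).hom)
        fun w w' => congrArg AddCommGrpCat.Hom.hom (crossRight_add w w')))
      (by
        ext b x
        exact congrArg (fun g => g.hom x) (crossRight_boundary (X := X) b)))

theorem crossFlip_apply (w : (singChains Y).cycles 1) (z : (singChains X).cycles 1) :
    ((crossFlip (X := X)).hom (((singChains Y).homologyπ 1).hom w))
      (((singChains X).homologyπ 1).hom z) = (crossCycle w).hom z := by
  have h : (singChains Y).homologyπ 1 ≫ crossFlip (X := X) = _ :=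
    Limits.Cofork.IsColimit.π_desc ((singChains Y).homologyIsCokernel 2 1 (by simp))
  have h1 := congrArg (fun g => g.hom w) h
  have h2 := congrArg (fun g => g.hom z) (π_crossRight (X := X) w)
  exact (congrArg (fun g : (singChains X).homology 1 →+ (singChains (X × Y)).homology 2 =>
    g (((singChains X).homologyπ 1).hom z)) h1).trans h2

/-- The homology cross product `H₁(X) ⊗ H₁(Y) → H₂(X × Y)`. -/
noncomputable def crossProduct (X Y : Type) [TopologicalSpace X] [TopologicalSpace Y] :
    singHomology 1 X ⊗[ℤ] singHomology 1 Y →+ singHomology 2 (X × Y) :=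
  TensorProduct.liftAddHom (AddMonoidHom.flip crossFlip.hom) fun r x y => by
    rw [map_zsmul, map_zsmul]; rfl

/-- On classes of cycles the cross product is represented by the chain `cross11 z w`. -/
theorem crossProduct_tmul (z : (singChains X).cycles 1) (w : (singChains Y).cycles 1)
    (c : (singChains (X × Y)).cycles 2)
    (hc : ((singChains (X × Y)).iCycles 2).hom c =
      cross11 (((singChains X).iCycles 1).hom z) (((singChains Y).iCycles 1).hom w)) :
    crossProduct X Y ((((singChains X).homologyπ 1).hom z) ⊗ₜ[ℤ]
      (((singChains Y).homologyπ 1).hom w)) = ((singChains (X × Y)).homologyπ 2).hom c := by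
  refine (crossFlip_apply w z).trans ?_
  refine congrArg ((singChains (X × Y)).homologyπ 2).hom (iCycles_injective _ _ ?_)
  rw [hc]
  exact iCycles_crossCycles z w

end CrossProduct

section Graphs

variable {V : Type} [Fintype V]

/-- The geometric realization of a finite graph, regarded as a one-dimensional simplicial
complex: points of the standard simplex on the vertex set (with barycentric coordinates) whose
set of nonzero coordinates is contained in a vertex or in an edge. -/
def Realization (G : SimpleGraph V) : Type :=
  {x : V → ℝ // x ∈ stdSimplex ℝ V ∧
    ((∃ v, Function.support x ⊆ {v}) ∨ ∃ u v, G.Adj u v ∧ Function.support x ⊆ {u, v})}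

instance (G : SimpleGraph V) : TopologicalSpace (Realization G) :=
  inferInstanceAs (TopologicalSpace (Subtype _))

/-- The support of a point `x`: the closed simplex (vertex or edge) whose interior contains `x`. -/
def supp {G : SimpleGraph V} (x : Realization G) : Set (Realization G) :=
  {y | Function.support y.1 ⊆ Function.support x.1}

/-- The configuration space `F(Γ, 2)` of ordered pairs of distinct points. -/
def confSpace (G : SimpleGraph V) : Set (Realization G × Realization G) :=
  {p | p.1 ≠ p.2}

/-- The discrete configuration space `D(Γ, 2)` of pairs of points with disjoint supports. -/
def discConf (G : SimpleGraph V) : Set (Realization G × Realization G) :=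
  {p | Disjoint (supp p.1) (supp p.2)}

/-- `N`, the closure of the complement of `D(Γ, 2)` in `Γ × Γ`. -/
def nbhd (G : SimpleGraph V) : Set (Realization G × Realization G) :=
  closure (discConf G)ᶜ

/-- `∂N = N ∩ D(Γ, 2)`. -/
def nbhdBoundary (G : SimpleGraph V) : Set (Realization G × Realization G) :=
  nbhd G ∩ discConf G

/-- The pair `(Γ × Γ, D(Γ, 2))`. -/
abbrev discPair (G : SimpleGraph V) : TopPair.{0} :=
  TopPair.ofSubset (X := TopCat.of (Realization G × Realization G)) (discConf G)

/-- The pair `(N, ∂N)`. -/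
abbrev nbhdPair (G : SimpleGraph V) : TopPair.{0} :=
  TopPair.ofSubset (X := TopCat.of (nbhd G)) (Subtype.val ⁻¹' nbhdBoundary G)

/-- The inclusion of pairs `(N, ∂N) → (Γ × Γ, D(Γ, 2))`. -/
def nbhdInclusion (G : SimpleGraph V) : nbhdPair G ⟶ discPair G :=
  TopPair.ofHom (X := nbhdPair G) (Y := discPair G)
    (TopCat.ofHom ⟨fun p => p.1, continuous_subtype_val⟩)
    (TopCat.ofHom ⟨fun p => ⟨p.1.1, p.2.2⟩, by fun_prop⟩) rfl

/-- `H_n(N, ∂N)`. -/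
noncomputable abbrev nbhdHomology (n : ℕ) (G : SimpleGraph V) : AddCommGrpCat.{0} :=
  (relHomologyFunctor n).obj (nbhdPair G)

/-- The excision homomorphism `H₂(N, ∂N) → H₂(Γ × Γ, D(Γ, 2))` induced by inclusion. -/
noncomputable def excisionMap (G : SimpleGraph V) :
    nbhdHomology 2 G →+ (relHomologyFunctor 2).obj (discPair G) :=
  ((relHomologyFunctor 2).map (nbhdInclusion G)).hom

/-- The intersection form `H₁(Γ) ⊗ H₁(Γ) → H₂(N, ∂N)`: the composition
`H₁(Γ) ⊗ H₁(Γ) → H₂(Γ × Γ) → H₂(Γ × Γ, D(Γ, 2)) ≅ H₂(N, ∂N)` of the cross product, the map of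
the pair, and the inverse of the excision isomorphism. -/
noncomputable def intersectionForm (G : SimpleGraph V)
    (hexc : Function.Bijective (excisionMap G)) :
    singHomology 1 (Realization G) ⊗[ℤ] singHomology 1 (Realization G) →+ nbhdHomology 2 G :=
  (AddEquiv.ofBijective (excisionMap G) hexc).symm.toAddMonoidHom.comp
    ((toRelHomology 2 (discPair G)).hom.comp (crossProduct (Realization G) (Realization G)))

end Graphs

end GraphConf

namespace GraphConf
open CategoryTheory Simplicial
open scoped TensorProduct unitInterval

/-! ### Homology classes of cycles -/

section Classes

variable {K L : ChainComplex AddCommGrpCat.{0} ℕ}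

/-! Write D, F, N for the subspaces of Γ × Γ in the statement. For x ≠ y, subtract from the
barycentric coordinates of both points t times their minimum and renormalise (`shrink`). This
deforms F onto D, fixes D pointwise and keeps N ∩ F inside N. Hence D has the homology of F. Since
the interiors of N and F cover Γ × Γ, the same deformation gives H_2(N, ∂N) ≅ H_2(Γ × Γ, D)
(`excision_bijective`). The theorem is then read off the exact sequence H_2(D) → H_2(Γ × Γ) → H_2(Γ
× Γ, D) → H_1(D) → H_1(Γ × Γ), once the first arrow is injective and the last one surjective
(`homology_conf_of_exact`). The extension at H_1(D) splits because H_1(Γ × Γ) ≅ H_1(Γ) ⊕ H_1(Γ) is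
free.

The computations rest on one Mayer–Vietoris argument. Let E map to the complete graph by p and to a
space Y by q. Cover E by the parts over open stars of vertices and over open edges; these meet in
half edges. A cycle z is a + b up to a boundary, with a over the stars and b over the edges. The
part of ∂a over a half edge d, pushed to Y, is a class `flow p q d` in H_n(Y). Flows are
antisymmetric and conserved at each vertex, and they detect H_{n+1}(E) if the homology of the fibres
is suitable (`Fibred.eq_zero_of_flow`). For Y a point this identifies H_1(Γ) with the integral flows
on Γ, so it is free; it shows that H_1 of a subcomplex injects and that homology in degrees at least
two vanishes. For E = Γ × Γ with q the second projection, the flow of x × y is the flow of x times y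
(`flow_crossProduct`), whence the cross product is bijective. For E = D the fibres are subcomplexes
of Γ, so flows with values in H_1(Γ) still detect H_2(D). They factor through H_2(Γ × Γ), so H_2(D)
→ H_2(Γ × Γ) is injective.

That Γ is not a circle matters only for surjectivity in degree one. A cycle through a given edge
misses another edge, since otherwise Γ would be that cycle. So H_1(Γ) is generated by classes
without flow through some edge (`mem_of_flowZ_eq_zero_mem`). Such a class can be carried by one
point while the other rests inside the missed edge, hence comes from H_1(F). -/

theorem down_next (n : ℕ) : (ComplexShape.down ℕ).next n = n - 1 := by
  cases n with
  | zero => simp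
  | succ n => simp

/-- The subgroup of cycles of degree `n` (every chain of degree zero is a cycle). -/
def cyc (K : ChainComplex AddCommGrpCat.{0} ℕ) (n : ℕ) : AddSubgroup (K.X n) :=
  (K.d n (n - 1)).hom.ker

theorem mem_cyc_succ {n : ℕ} {c : K.X (n + 1)} : c ∈ cyc K (n + 1) ↔ (K.d (n + 1) n).hom c = 0 :=
  Iff.rfl

theorem mem_cyc_zero (c : K.X 0) : c ∈ cyc K 0 := by
  change (K.d 0 0).hom c = 0
  rw [K.shape 0 0 (by simp)]
  rfl

theorem d_d (i j k : ℕ) (c : K.X i) : (K.d j k).hom ((K.d i j).hom c) = 0 :=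
  congrArg (fun g => g.hom c) (K.d_comp_d i j k)

theorem d_mem_cyc (n : ℕ) (e : K.X (n + 1)) : (K.d (n + 1) n).hom e ∈ cyc K n :=
  d_d _ _ _ e

theorem hom_d (φ : K ⟶ L) (i j : ℕ) (c : K.X i) :
    (φ.f j).hom ((K.d i j).hom c) = (L.d i j).hom ((φ.f i).hom c) :=
  congrArg (fun g => g.hom c) (φ.comm i j).symm

theorem hom_mem_cyc (φ : K ⟶ L) {n : ℕ} {c : K.X n} (hc : c ∈ cyc K n) :
    (φ.f n).hom c ∈ cyc L n := by
  change (L.d _ _).hom _ = 0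
  rw [← hom_d, show (K.d n (n - 1)).hom c = 0 from hc, map_zero]

/-- Cycles as elements of the categorical object of cycles. -/
noncomputable def toCycles (K : ChainComplex AddCommGrpCat.{0} ℕ) (n : ℕ) :
    AddCommGrpCat.of (cyc K n) ⟶ K.cycles n :=
  K.liftCycles (AddCommGrpCat.ofHom (cyc K n).subtype) (n - 1) (down_next n) (by
    ext c
    exact c.2)

theorem iCycles_toCycles (n : ℕ) (c : cyc K n) :
    (K.iCycles n).hom ((toCycles K n).hom c) = c.1 :=
  congrArg (fun g : AddCommGrpCat.of (cyc K n) ⟶ K.X n => g.hom c) (K.liftCycles_i _ _ _ _)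

/-- The homology class of a cycle. -/
noncomputable def hcls (K : ChainComplex AddCommGrpCat.{0} ℕ) (n : ℕ) : cyc K n →+ K.homology n :=
  (toCycles K n ≫ K.homologyπ n).hom

theorem toCycles_surjective (n : ℕ) (z : K.cycles n) : ∃ c, (toCycles K n).hom c = z := by
  refine ⟨⟨(K.iCycles n).hom z, d_iCycles K n (n - 1) z⟩, iCycles_injective _ _ ?_⟩
  rw [iCycles_toCycles]

theorem hcls_surjective (n : ℕ) : Function.Surjective (hcls K n) := by
  intro x
  obtain ⟨z, rfl⟩ := (AddCommGrpCat.epi_iff_surjective (K.homologyπ n)).1 inferInstance x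
  obtain ⟨c, rfl⟩ := toCycles_surjective n z
  exact ⟨c, rfl⟩

/-- Homology is the cokernel of the map from (n + 1)-chains to n-cycles, and exactness in abelian
groups is a statement about elements. From here on homology classes are handled through representing
chains. -/
theorem hcls_eq_zero_iff {n : ℕ} (c : cyc K n) :
    hcls K n c = 0 ↔ ∃ e, (K.d (n + 1) n).hom e = c.1 := by
  constructor
  · intro h
    have hex := (ShortComplex.ab_exact_iff _).1
      (ShortComplex.exact_of_g_is_cokernel
        (ShortComplex.mk (K.toCycles (n + 1) n) (K.homologyπ n) (K.toCycles_comp_homologyπ _ _))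
        (K.homologyIsCokernel (n + 1) n (by simp))) ((toCycles K n).hom c) h
    obtain ⟨e, he⟩ := hex
    refine ⟨e, ?_⟩
    rw [← iCycles_toCycles n c, ← show _ = (toCycles K n).hom c from he]
    exact (congrArg (fun g => g.hom e) (K.toCycles_i (n + 1) n)).symm
  · rintro ⟨e, he⟩
    exact homologyπ_eq_zero K n ((toCycles K n).hom c) e (by rw [iCycles_toCycles, he])

theorem hcls_eq_iff {n : ℕ} (c c' : cyc K n) :
    hcls K n c = hcls K n c' ↔ ∃ e, (K.d (n + 1) n).hom e = c.1 - c'.1 := by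
  rw [← sub_eq_zero, ← map_sub, hcls_eq_zero_iff]
  rfl

theorem homologyMap_hcls (φ : K ⟶ L) {n : ℕ} (c : cyc K n) :
    (HomologicalComplex.homologyMap φ n).hom (hcls K n c) =
      hcls L n ⟨(φ.f n).hom c.1, hom_mem_cyc φ c.2⟩ := by
  have h1 := congrArg (fun g => g.hom ((toCycles K n).hom c))
    (HomologicalComplex.homologyπ_naturality φ n)
  refine h1.trans ?_
  refine congrArg (L.homologyπ n).hom (iCycles_injective _ _ ?_)
  refine Eq.trans ?_ (iCycles_toCycles (K := L) n _).symm
  refine (congrArg (fun g => g.hom ((toCycles K n).hom c))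
    (HomologicalComplex.cyclesMap_i φ n)).trans ?_
  exact congrArg (φ.f n).hom (iCycles_toCycles n c)

end Classes

/-! ### Singular chains -/

section Chains

variable {X Y Z : Type} [TopologicalSpace X] [TopologicalSpace Y] [TopologicalSpace Z]

/-- The point of `X` that the singular simplex `a` assigns to `t`. -/
noncomputable def ev {n : ℕ} (a : singSet X _⦋n⦌) (t : stdSimplex ℝ (Fin (n + 1))) : X :=
  (TopCat.of X).toSSetObjEquiv _ a t

theorem ev_continuous {n : ℕ} (a : singSet X _⦋n⦌) : Continuous (ev a) :=
  ((TopCat.of X).toSSetObjEquiv _ a).continuous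

theorem ev_ext {n : ℕ} {a b : singSet X _⦋n⦌} (h : ∀ t, ev a t = ev b t) : a = b :=
  ((TopCat.of X).toSSetObjEquiv _).injective (ContinuousMap.ext h)

/-- The singular simplex defined by a continuous map. -/
noncomputable def mkS {n : ℕ} (f : C(stdSimplex ℝ (Fin (n + 1)), X)) : singSet X _⦋n⦌ :=
  ((TopCat.of X).toSSetObjEquiv _).symm f

theorem ev_mkS {n : ℕ} (f : C(stdSimplex ℝ (Fin (n + 1)), X)) (t) : ev (mkS f) t = f t := rfl

theorem ev_δ {n : ℕ} (a : singSet X _⦋n + 1⦌) (i : Fin (n + 2)) (t) :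
    ev ((singSet X).δ i a) t = ev a (stdSimplex.map (Fin.succAbove i) t) := rfl

/-- The image of a singular simplex under a continuous map. -/
noncomputable def mapS (f : C(X, Y)) {n : ℕ} (a : singSet X _⦋n⦌) : singSet Y _⦋n⦌ :=
  (TopCat.toSSet.map (TopCat.ofHom f)).app _ a

theorem ev_mapS (f : C(X, Y)) {n : ℕ} (a : singSet X _⦋n⦌) (t) : ev (mapS f a) t = f (ev a t) :=
  rfl

/-- The chain map induced by a continuous map. -/
noncomputable abbrev pushHom (f : C(X, Y)) : singChains X ⟶ singChains Y :=
  singChainsFunctor.map (TopCat.ofHom f)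

/-- The homomorphism on chains induced by a continuous map. -/
noncomputable def push (f : C(X, Y)) {n : ℕ} : (singChains X).X n →+ (singChains Y).X n :=
  ((pushHom f).f n).hom

theorem push_simplexChain (f : C(X, Y)) {n : ℕ} (a : singSet X _⦋n⦌) :
    push f (simplexChain a) = simplexChain (mapS f a) :=
  congrArg (fun g => g.hom (1 : ℤ))
    (SSet.ι_chainComplexMap_f (X := singSet X) (Y := singSet Y)
      (f := TopCat.toSSet.map (TopCat.ofHom f)) (R := AddCommGrpCat.of ℤ) a)

/-- The boundary operator on singular chains. -/
noncomputable def dd {n : ℕ} : (singChains X).X (n + 1) →+ (singChains X).X n :=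
  ((singChains X).d (n + 1) n).hom

theorem dd_simplexChain {n : ℕ} (a : singSet X _⦋n + 1⦌) :
    dd (simplexChain a) =
      ∑ i : Fin (n + 2), (-1 : ℤ) ^ (i : ℕ) • simplexChain ((singSet X).δ i a) :=
  d_simplexChain a

theorem dd_dd {n : ℕ} (c : (singChains X).X (n + 2)) : dd (dd c) = 0 :=
  d_d _ _ _ c

theorem push_dd (f : C(X, Y)) {n : ℕ} (c : (singChains X).X (n + 1)) :
    push f (dd c) = dd (push f c) :=
  hom_d _ _ _ c

theorem push_mem_cyc (f : C(X, Y)) {n : ℕ} {c : (singChains X).X n}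
    (hc : c ∈ cyc (singChains X) n) : push f c ∈ cyc (singChains Y) n :=
  hom_mem_cyc _ hc

theorem push_push (g : C(Y, Z)) (f : C(X, Y)) {n : ℕ} (c : (singChains X).X n) :
    push g (push f c) = push (g.comp f) c := by
  have : (push g).comp (push f) = push (n := n) (g.comp f) :=
    chain_hom_ext fun a => by
      simp only [AddMonoidHom.comp_apply, push_simplexChain]
      rfl
  exact DFunLike.congr_fun this c

theorem push_id {n : ℕ} (c : (singChains X).X n) : push (ContinuousMap.id X) c = c := by
  have : push (n := n) (ContinuousMap.id X) = AddMonoidHom.id _ :=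
    chain_hom_ext fun a => by
      rw [push_simplexChain]
      rfl
  exact DFunLike.congr_fun this c

/-- The quotient map by the subgroup generated by the simplices agrees with the zero map on every
simplex, so it is zero by `chain_hom_ext` and that subgroup is everything. -/
theorem chain_induction {n : ℕ} {P : (singChains X).X n → Prop} (h0 : P 0)
    (hs : ∀ a, P (simplexChain a)) (hneg : ∀ c, P c → P (-c))
    (hadd : ∀ c c', P c → P c' → P (c + c')) (c : (singChains X).X n) : P c := by
  have htop : AddSubgroup.closure (Set.range fun a : singSet X _⦋n⦌ => simplexChain a) = ⊤ := by
    set S := AddSubgroup.closure (Set.range fun a : singSet X _⦋n⦌ => simplexChain a)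
    have h : QuotientAddGroup.mk' S = 0 := chain_hom_ext (A := (singChains X).X n ⧸ S) fun a =>
      (QuotientAddGroup.eq_zero_iff _).2 (AddSubgroup.subset_closure ⟨a, rfl⟩)
    rw [← QuotientAddGroup.ker_mk' S, h]
    ext; simp
  have hc : c ∈ AddSubgroup.closure (Set.range fun a : singSet X _⦋n⦌ => simplexChain a) := by
    rw [htop]; trivial
  induction hc using AddSubgroup.closure_induction with
  | mem x hx => obtain ⟨a, rfl⟩ := hx; exact hs a
  | zero => exact h0
  | add x y _ _ hx hy => exact hadd x y hx hy
  | neg x _ hx => exact hneg x hx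

/-- The chain homotopy identity for homotopic maps, on cycles. -/
theorem exists_dd_eq_push_sub_push {f g : C(X, Y)} (h : f.Homotopic g) {n : ℕ}
    {c : (singChains X).X n} (hc : c ∈ cyc (singChains X) n) :
    ∃ e : (singChains Y).X (n + 1), dd e = push f c - push g c := by
  obtain ⟨H⟩ := h
  -- Homotopy invariance enters only as an equality of maps on homology; the bounding chain is
  -- extracted from the equality of two classes, not from a prism operator.
  have := TopCat.Homotopy.congr_homologyMap_singularChainComplexFunctor
    (f := TopCat.ofHom f) (g := TopCat.ofHom g) H (AddCommGrpCat.of ℤ) n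
  have h2 : hcls (singChains Y) n ⟨push f c, push_mem_cyc f hc⟩ =
      hcls (singChains Y) n ⟨push g c, push_mem_cyc g hc⟩ :=
    ((homologyMap_hcls (pushHom f) ⟨c, hc⟩).symm.trans
      (congrArg (fun k => k.hom (hcls (singChains X) n ⟨c, hc⟩)) this)).trans
      (homologyMap_hcls (pushHom g) ⟨c, hc⟩)
  exact (hcls_eq_iff _ _).1 h2

end Chains

/-! ### Chains supported in a subset -/

section Support

variable {X Y : Type} [TopologicalSpace X] [TopologicalSpace Y]

/-- The singular simplex `a` has image in `A`. -/
def InSet (A : Set X) {n : ℕ} (a : singSet X _⦋n⦌) : Prop := ∀ t, ev a t ∈ A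

/-- The chains of `X` supported in the subset `A`. -/
noncomputable def chainsIn (A : Set X) (n : ℕ) : AddSubgroup ((singChains X).X n) :=
  AddSubgroup.closure {c | ∃ a, InSet A a ∧ simplexChain a = c}

theorem simplexChain_mem {A : Set X} {n : ℕ} {a : singSet X _⦋n⦌} (h : InSet A a) :
    simplexChain a ∈ chainsIn A n :=
  AddSubgroup.subset_closure ⟨a, h, rfl⟩

/-- To check that additive maps send chains in `A` into a subgroup, it suffices to consider
simplices. -/
theorem chainsIn_le_comap {A : Set X} {n : ℕ} {B : Type} [AddCommGroup B]
    (f : (singChains X).X n →+ B) (S : AddSubgroup B)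
    (h : ∀ a, InSet A a → f (simplexChain a) ∈ S) {c : (singChains X).X n}
    (hc : c ∈ chainsIn A n) : f c ∈ S := by
  have : chainsIn A n ≤ S.comap f := by
    rw [chainsIn, AddSubgroup.closure_le]
    rintro _ ⟨a, ha, rfl⟩
    exact h a ha
  exact this hc

theorem eq_on_chainsIn {A : Set X} {n : ℕ} {B : Type} [AddCommGroup B]
    (f g : (singChains X).X n →+ B)
    (h : ∀ a, InSet A a → f (simplexChain a) = g (simplexChain a)) {c : (singChains X).X n}
    (hc : c ∈ chainsIn A n) : f c = g c := by
  have := chainsIn_le_comap (f - g) ⊥ (fun a ha => by simp [h a ha]) hc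
  simpa [sub_eq_zero] using this

theorem chainsIn_mono {A B : Set X} (h : A ⊆ B) (n : ℕ) : chainsIn A n ≤ chainsIn B n :=
  fun _ hc => chainsIn_le_comap (AddMonoidHom.id _) _ (fun _ ha => simplexChain_mem
    fun t => h (ha t)) hc

theorem dd_mem_chainsIn {A : Set X} {n : ℕ} {c : (singChains X).X (n + 1)}
    (hc : c ∈ chainsIn A (n + 1)) : dd c ∈ chainsIn A n :=
  chainsIn_le_comap dd _ (fun a ha => by
    rw [dd_simplexChain]
    exact sum_mem fun i _ => zsmul_mem
      (simplexChain_mem (a := (singSet X).δ i a) fun t => ha (stdSimplex.map (Fin.succAbove i) t)) _) hc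

theorem push_mem_chainsIn (f : C(X, Y)) {A : Set X} {B : Set Y} (h : Set.MapsTo f A B) {n : ℕ}
    {c : (singChains X).X n} (hc : c ∈ chainsIn A n) : push f c ∈ chainsIn B n :=
  chainsIn_le_comap (push f) _ (fun a ha => by
    rw [push_simplexChain]
    exact simplexChain_mem fun t => h (ha t)) hc

theorem chainsIn_univ (n : ℕ) (c : (singChains X).X n) : c ∈ chainsIn Set.univ n := by
  induction c using chain_induction with
  | h0 => exact zero_mem _
  | hs a => exact simplexChain_mem fun _ => trivial
  | hneg c h => exact neg_mem h
  | hadd c c' h h' => exact add_mem h h'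

open Classical in
/-- The part of a chain consisting of the simplices contained in `A`. -/
noncomputable def restr (A : Set X) {n : ℕ} : (singChains X).X n →+ (singChains X).X n :=
  liftChain fun a => if InSet A a then simplexChain a else 0

theorem restr_of_inSet {A : Set X} {n : ℕ} {a : singSet X _⦋n⦌} (h : InSet A a) :
    restr A (simplexChain a) = simplexChain a := by
  rw [restr, liftChain_simplexChain, if_pos h]

theorem restr_of_not_inSet {A : Set X} {n : ℕ} {a : singSet X _⦋n⦌} (h : ¬ InSet A a) :
    restr A (simplexChain a) = 0 := by
  rw [restr, liftChain_simplexChain, if_neg h]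

theorem restr_mem {A : Set X} {n : ℕ} (c : (singChains X).X n) : restr A c ∈ chainsIn A n :=
  chainsIn_le_comap (A := Set.univ) (restr A) _ (fun a _ => by
    by_cases h : InSet A a
    · rw [restr_of_inSet h]; exact simplexChain_mem h
    · rw [restr_of_not_inSet h]; exact zero_mem _) (chainsIn_univ n c)

theorem restr_eq_self {A : Set X} {n : ℕ} {c : (singChains X).X n} (hc : c ∈ chainsIn A n) :
    restr A c = c :=
  eq_on_chainsIn (restr A) (AddMonoidHom.id _) (fun _ ha => restr_of_inSet ha) hc

theorem restr_mem_of_mem {A B : Set X} {n : ℕ} {c : (singChains X).X n} (hc : c ∈ chainsIn B n) :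
    restr A c ∈ chainsIn (A ∩ B) n :=
  chainsIn_le_comap (restr A) _ (fun a ha => by
    by_cases h : InSet A a
    · rw [restr_of_inSet h]; exact simplexChain_mem fun t => ⟨h t, ha t⟩
    · rw [restr_of_not_inSet h]; exact zero_mem _) hc

/-- Simplices form a basis: `restr A` fixes a chain in A, and it turns a chain in B into one in A ∩
B. -/
theorem mem_chainsIn_inter {A B : Set X} {n : ℕ} {c : (singChains X).X n}
    (hA : c ∈ chainsIn A n) (hB : c ∈ chainsIn B n) : c ∈ chainsIn (A ∩ B) n := by
  rw [← restr_eq_self hA]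
  exact restr_mem_of_mem hB

/-- The inclusion of a subset. -/
def incl (A : Set X) : C(A, X) := ⟨Subtype.val, continuous_subtype_val⟩

open Classical in
/-- The retraction of `C(X)` onto `C(A)` that kills the simplices not contained in `A`. -/
noncomputable def corestr (A : Set X) {n : ℕ} : (singChains X).X n →+ (singChains A).X n :=
  liftChain fun a => if h : InSet A a then
    simplexChain (mkS ⟨fun t => ⟨ev a t, h t⟩, (ev_continuous a).subtype_mk h⟩) else 0

theorem corestr_push {A : Set X} {n : ℕ} (c : (singChains A).X n) :
    corestr A (push (incl A) c) = c := by
  have : (corestr A).comp (push (n := n) (incl A)) = AddMonoidHom.id _ :=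
    chain_hom_ext fun a => by
      have h : InSet A (mapS (incl A) a) := fun t => (ev a t).2
      rw [AddMonoidHom.comp_apply, push_simplexChain, corestr, liftChain_simplexChain, dif_pos h]
      exact congrArg simplexChain (ev_ext fun t => ev_mkS _ _)
  exact DFunLike.congr_fun this c

/-- `corestr` is a left inverse in each degree, though not a chain map: a face may lie in A when its
simplex does not. -/
theorem push_incl_injective (A : Set X) {n : ℕ} : Function.Injective (push (n := n) (incl A)) :=
  Function.LeftInverse.injective (g := corestr A) corestr_push

theorem push_corestr {A : Set X} {n : ℕ} {c : (singChains X).X n} (hc : c ∈ chainsIn A n) :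
    push (incl A) (corestr A c) = c :=
  eq_on_chainsIn ((push (incl A)).comp (corestr A)) (AddMonoidHom.id _) (fun a h => by
    rw [AddMonoidHom.comp_apply, corestr, liftChain_simplexChain, dif_pos h, push_simplexChain]
    exact congrArg simplexChain (ev_ext fun t => rfl)) hc

theorem push_incl_mem {A : Set X} {n : ℕ} (c : (singChains A).X n) :
    push (incl A) c ∈ chainsIn A n :=
  push_mem_chainsIn (incl A) (A := Set.univ) (fun x _ => x.2) (chainsIn_univ n c)

theorem mem_chainsIn_iff {A : Set X} {n : ℕ} {c : (singChains X).X n} :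
    c ∈ chainsIn A n ↔ ∃ c', push (incl A) c' = c :=
  ⟨fun h => ⟨_, push_corestr h⟩, by rintro ⟨c', rfl⟩; exact push_incl_mem c'⟩

theorem mem_cyc_of_push_incl {A : Set X} {n : ℕ} {c : (singChains A).X n}
    (h : push (incl A) c ∈ cyc (singChains X) n) : c ∈ cyc (singChains A) n := by
  cases n with
  | zero => exact mem_cyc_zero c
  | succ n =>
    apply push_incl_injective A
    rw [map_zero]
    exact (push_dd (incl A) c).trans h

theorem chainsIn_empty (n : ℕ) {c : (singChains X).X n} (hc : c ∈ chainsIn (∅ : Set X) n) :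
    c = 0 :=
  eq_on_chainsIn (AddMonoidHom.id _) 0 (fun _ ha => (ha (Classical.arbitrary _)).elim) hc

/-- Simplices contained in a disjoint union of open sets are contained in one of them. -/
theorem exists_inSet_of_iUnion {ι : Type} {U : ι → Set X} (hU : ∀ i, IsOpen (U i))
    (hd : Pairwise fun i j => Disjoint (U i) (U j)) {n : ℕ} {a : singSet X _⦋n⦌}
    (ha : InSet (⋃ i, U i) a) : ∃ i, InSet (U i) a := by
  have t0 : stdSimplex ℝ (Fin (n + 1)) := Classical.arbitrary _
  obtain ⟨i, hi⟩ := Set.mem_iUnion.1 (ha t0)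
  refine ⟨i, ?_⟩
  have hp : IsPreconnected (Set.range (ev a)) := isPreconnected_range (ev_continuous a)
  have hsub : Set.range (ev a) ⊆ U i :=
    hp.subset_left_of_subset_union (v := ⋃ j ∈ {j | j ≠ i}, U j) (hU i)
      (isOpen_biUnion fun j _ => hU j)
      (by
        rw [Set.disjoint_iUnion₂_right]
        exact fun j hj => hd (Ne.symm hj))
      (by
        rintro _ ⟨t, rfl⟩
        obtain ⟨j, hj⟩ := Set.mem_iUnion.1 (ha t)
        by_cases hji : j = i
        · left; rwa [← hji]
        · right; exact Set.mem_biUnion hji hj)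
      ⟨_, ⟨t0, rfl⟩, hi⟩
  exact fun t => hsub ⟨t, rfl⟩

theorem not_inSet_of_disjoint {A B : Set X} (h : Disjoint A B) {n : ℕ} {a : singSet X _⦋n⦌}
    (ha : InSet A a) : ¬ InSet B a := fun hb =>
  Set.disjoint_left.1 h (ha (Classical.arbitrary _)) (hb (Classical.arbitrary _))

theorem restr_eq_zero_of_disjoint {A B : Set X} (h : Disjoint A B) {n : ℕ}
    {c : (singChains X).X n} (hc : c ∈ chainsIn A n) : restr B c = 0 :=
  eq_on_chainsIn (restr B) 0 (fun _ ha => restr_of_not_inSet (not_inSet_of_disjoint h ha)) hc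

theorem sum_restr {ι : Type} [Fintype ι] {U : ι → Set X} (hU : ∀ i, IsOpen (U i))
    (hd : Pairwise fun i j => Disjoint (U i) (U j)) {n : ℕ} {c : (singChains X).X n}
    (hc : c ∈ chainsIn (⋃ i, U i) n) : ∑ i, restr (U i) c = c := by
  classical
  have := eq_on_chainsIn (∑ i, restr (U i)) (AddMonoidHom.id ((singChains X).X n)) (fun a ha => by
    obtain ⟨i, hi⟩ := exists_inSet_of_iUnion hU hd ha
    rw [AddMonoidHom.finsetSum_apply, Finset.sum_eq_single i]
    · exact restr_of_inSet hi
    · exact fun j _ hj => restr_of_not_inSet (not_inSet_of_disjoint (hd hj.symm) hi)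
    · simp) hc
  simpa using this

/-- Restriction to a subset does not commute with the boundary in general. It does here because a
simplex is connected: it lies in a single piece of the disjoint open union, together with all its
faces. -/
theorem dd_restr {ι : Type} {U : ι → Set X} (hU : ∀ i, IsOpen (U i))
    (hd : Pairwise fun i j => Disjoint (U i) (U j)) {n : ℕ} {c : (singChains X).X (n + 1)}
    (hc : c ∈ chainsIn (⋃ i, U i) (n + 1)) (i : ι) : dd (restr (U i) c) = restr (U i) (dd c) :=
  eq_on_chainsIn (dd.comp (restr (U i))) ((restr (U i)).comp dd) (fun a ha => by
    obtain ⟨j, hj⟩ := exists_inSet_of_iUnion hU hd ha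
    have hdd := dd_mem_chainsIn (simplexChain_mem hj)
    rw [AddMonoidHom.comp_apply, AddMonoidHom.comp_apply]
    by_cases hij : j = i
    · subst hij
      rw [restr_of_inSet hj, restr_eq_self hdd]
    · rw [restr_of_not_inSet (not_inSet_of_disjoint (hd hij) hj), map_zero,
        restr_eq_zero_of_disjoint (hd hij) hdd]) hc

end Support

/-! ### Affine simplices -/

section Affine

/-- The standard topological simplex of dimension `n`. -/
abbrev Del (n : ℕ) : Type := stdSimplex ℝ (Fin (n + 1))

/-- The affine map between standard simplices with prescribed values at the vertices. -/
noncomputable def aff {n N : ℕ} (v : Fin (n + 1) → Del N) : C(Del n, Del N) where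
  toFun t := ⟨fun j => ∑ k, t k * v k j,
    fun j => Finset.sum_nonneg fun k _ => mul_nonneg (t.2.1 k) ((v k).2.1 j), by
      rw [Finset.sum_comm]
      simp only [← Finset.mul_sum, stdSimplex.sum_eq_one, mul_one]⟩
  continuous_toFun := by
    refine Continuous.subtype_mk (continuous_pi fun j => continuous_finsetSum _ fun k _ => ?_) _
    exact ((continuous_apply k).comp continuous_subtype_val).mul continuous_const

theorem aff_apply {n N : ℕ} (v : Fin (n + 1) → Del N) (t : Del n) (j) :
    aff v t j = ∑ k, t k * v k j := rfl

/-- The vertices of the standard simplex. -/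
noncomputable def vtx {n : ℕ} (i : Fin (n + 1)) : Del n := stdSimplex.vertex i

theorem vtx_apply {n : ℕ} (i j : Fin (n + 1)) : vtx i j = if j = i then 1 else 0 := by
  change (Pi.single i 1 : Fin (n + 1) → ℝ) j = _
  rw [Pi.single_apply]

theorem del_ext {n : ℕ} {x y : Del n} (h : ∀ j, x j = y j) : x = y :=
  stdSimplex.ext (funext h)

theorem aff_vtx {n N : ℕ} (v : Fin (n + 1) → Del N) (i) : aff v (vtx i) = v i :=
  del_ext fun j => by simp [aff_apply, vtx_apply]

theorem aff_comp {n m N : ℕ} (v : Fin (n + 1) → Del N) (w : Fin (m + 1) → Del n) :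
    (aff v).comp (aff w) = aff fun i => aff v (w i) := by
  ext1 t
  refine del_ext fun j => ?_
  simp only [ContinuousMap.comp_apply, aff_apply, Finset.sum_mul, Finset.mul_sum]
  rw [Finset.sum_comm]
  simp only [mul_assoc]

theorem aff_id {n : ℕ} : aff (vtx (n := n)) = ContinuousMap.id _ := by
  ext1 t
  exact del_ext fun j => by simp [aff_apply, vtx_apply]

theorem map_eq_aff {n N : ℕ} (f : Fin (n + 1) → Fin (N + 1)) (t : Del n) :
    stdSimplex.map f t = aff (fun k => vtx (f k)) t := by
  refine del_ext fun j => ?_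
  rw [aff_apply]
  change FunOnFinite.linearMap ℝ ℝ f t j = _
  rw [FunOnFinite.linearMap_apply_apply, Finset.sum_filter]
  simp [vtx_apply, eq_comm]

/-- The affine singular simplex with prescribed vertices. -/
noncomputable def affS {n N : ℕ} (v : Fin (n + 1) → Del N) : singSet (Del N) _⦋n⦌ := mkS (aff v)

theorem ev_affS {n N : ℕ} (v : Fin (n + 1) → Del N) (t) : ev (affS v) t = aff v t := rfl

theorem δ_affS {n N : ℕ} (v : Fin (n + 2) → Del N) (i : Fin (n + 2)) :
    (singSet (Del N)).δ i (affS v) = affS fun k => v (i.succAbove k) := by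
  refine ev_ext fun t => ?_
  rw [ev_δ, ev_affS, ev_affS, map_eq_aff, ← ContinuousMap.comp_apply, aff_comp]
  simp only [aff_vtx]

theorem mapS_affS {n m N : ℕ} (v : Fin (n + 1) → Del N) (w : Fin (m + 1) → Del n) :
    mapS (aff v) (affS w) = affS fun i => aff v (w i) := by
  refine ev_ext fun t => ?_
  rw [ev_mapS, ev_affS, ev_affS, ← aff_comp]
  rfl

/-- The identity singular simplex of the standard simplex. -/
noncomputable def idS (n : ℕ) : singSet (Del n) _⦋n⦌ := affS vtx

theorem ev_idS {n : ℕ} (t : Del n) : ev (idS n) t = t := by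
  rw [idS, ev_affS, aff_id]
  rfl

/-- A singular simplex as a continuous map. -/
noncomputable def evC {X : Type} [TopologicalSpace X] {n : ℕ} (a : singSet X _⦋n⦌) : C(Del n, X) :=
  ⟨ev a, ev_continuous a⟩

theorem mapS_evC_idS {X : Type} [TopologicalSpace X] {n : ℕ} (a : singSet X _⦋n⦌) :
    mapS (evC a) (idS n) = a :=
  ev_ext fun t => by
    rw [ev_mapS, ev_idS]
    rfl

theorem evC_affS {n N : ℕ} (v : Fin (n + 1) → Del N) : evC (affS v) = aff v := rfl

theorem evC_mapS {X Y : Type} [TopologicalSpace X] [TopologicalSpace Y] (f : C(X, Y)) {n : ℕ}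
    (a : singSet X _⦋n⦌) : evC (mapS f a) = f.comp (evC a) := rfl

/-- The cone with apex `b` over a chain, computed by replacing simplices by affine ones. -/
noncomputable def cone {n N : ℕ} (b : Del N) :
    (singChains (Del N)).X n →+ (singChains (Del N)).X (n + 1) :=
  liftChain fun a => simplexChain (affS (Fin.cons b fun i => ev a (vtx i)))

theorem cone_affS {n N : ℕ} (b : Del N) (v : Fin (n + 1) → Del N) :
    cone b (simplexChain (affS v)) = simplexChain (affS (Fin.cons b v)) := by
  rw [cone, liftChain_simplexChain]
  simp only [ev_affS, aff_vtx]

/-- The augmentation of singular chains. -/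
noncomputable def aug {X : Type} [TopologicalSpace X] : (singChains X).X 0 →+ ℤ :=
  liftChain fun _ => 1

theorem aug_simplexChain {X : Type} [TopologicalSpace X] (a : singSet X _⦋0⦌) :
    aug (simplexChain a) = 1 := liftChain_simplexChain _ a

theorem aug_dd {X : Type} [TopologicalSpace X] (c : (singChains X).X 1) : aug (dd c) = 0 := by
  have : (aug (X := X)).comp dd = 0 := chain_hom_ext fun a => by
    rw [AddMonoidHom.comp_apply, dd_simplexChain]
    simp [Fin.sum_univ_succ, aug_simplexChain]
  exact DFunLike.congr_fun this c

theorem aug_push {X Y : Type} [TopologicalSpace X] [TopologicalSpace Y] (f : C(X, Y))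
    (c : (singChains X).X 0) : aug (push f c) = aug c := by
  have : (aug (X := Y)).comp (push f) = aug := chain_hom_ext fun a => by
    rw [AddMonoidHom.comp_apply, push_simplexChain, aug_simplexChain, aug_simplexChain]
  exact DFunLike.congr_fun this c

/-- Chains generated by the affine simplices whose vertices satisfy a condition. -/
noncomputable def affCh {n N : ℕ} (P : (Fin (n + 1) → Del N) → Prop) :
    AddSubgroup ((singChains (Del N)).X n) :=
  AddSubgroup.closure {c | ∃ v, P v ∧ simplexChain (affS v) = c}

theorem affS_mem {n N : ℕ} {P : (Fin (n + 1) → Del N) → Prop} {v} (h : P v) :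
    simplexChain (affS v) ∈ affCh P := AddSubgroup.subset_closure ⟨v, h, rfl⟩

theorem affCh_le_comap {n N : ℕ} {P : (Fin (n + 1) → Del N) → Prop} {B : Type} [AddCommGroup B]
    (f : (singChains (Del N)).X n →+ B) (S : AddSubgroup B)
    (h : ∀ v, P v → f (simplexChain (affS v)) ∈ S) {c} (hc : c ∈ affCh P) : f c ∈ S := by
  have : affCh P ≤ S.comap f := by
    rw [affCh, AddSubgroup.closure_le]
    rintro _ ⟨a, ha, rfl⟩
    exact h a ha
  exact this hc

theorem eq_on_affCh {n N : ℕ} {P : (Fin (n + 1) → Del N) → Prop} {B : Type} [AddCommGroup B]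
    (f g : (singChains (Del N)).X n →+ B)
    (h : ∀ v, f (simplexChain (affS v)) = g (simplexChain (affS v))) {c} (hc : c ∈ affCh P) :
    f c = g c := by
  have := affCh_le_comap (f - g) ⊥ (fun v _ => by simp [h v]) hc
  simpa [sub_eq_zero] using this

theorem cons_succAbove_succ {n N : ℕ} (b : Del N) (v : Fin (n + 2) → Del N) (i : Fin (n + 2)) :
    (fun k => (Fin.cons b v : Fin (n + 3) → Del N) (i.succ.succAbove k)) =
      Fin.cons b fun k => v (i.succAbove k) := by
  funext k
  refine Fin.cases ?_ (fun k => ?_) k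
  · simp
  · simp

/-- Face 0 of a cone is its base and face i + 1 is the cone over face i, with the opposite sign.
Affine chains are needed since `cone` only remembers the vertices of a simplex. -/
theorem dd_cone {n N : ℕ} (b : Del N) {P} {c : (singChains (Del N)).X (n + 1)}
    (hc : c ∈ affCh P) : dd (cone b c) = c - cone b (dd c) :=
  eq_on_affCh (dd.comp (cone b)) (AddMonoidHom.id _ - (cone b).comp dd) (fun v => by
    simp only [AddMonoidHom.comp_apply, AddMonoidHom.sub_apply, AddMonoidHom.id_apply, cone_affS,
      dd_simplexChain, δ_affS, map_sum, map_zsmul]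
    rw [Fin.sum_univ_succ, sub_eq_add_neg, ← Finset.sum_neg_distrib]
    simp only [Fin.val_zero, pow_zero, one_smul, Fin.succAbove_zero, Fin.cons_succ,
      cons_succAbove_succ, Fin.val_succ, pow_succ, mul_neg, mul_one, neg_smul]) hc

/-- The cone over a point is a segment whose other end is the apex, so the apex appears with total
weight `aug c`. -/
theorem dd_cone_zero {N : ℕ} (b : Del N) {P} {c : (singChains (Del N)).X 0}
    (hc : c ∈ affCh P) : dd (cone b c) = c - aug c • simplexChain (affS fun _ => b) :=
  eq_on_affCh (dd.comp (cone b)) (AddMonoidHom.id _ -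
    ((zmultiplesHom _) (simplexChain (affS fun _ => b))).comp aug) (fun v => by
    simp only [AddMonoidHom.comp_apply, AddMonoidHom.sub_apply, AddMonoidHom.id_apply, cone_affS,
      dd_simplexChain, δ_affS, aug_simplexChain, zmultiplesHom_apply]
    rw [Fin.sum_univ_two]
    have h1 : (fun k => (Fin.cons b v : Fin 2 → Del N) ((0 : Fin 2).succAbove k)) = v := by
      funext k; simp
    have h2 : (fun k => (Fin.cons b v : Fin 2 → Del N) ((1 : Fin 2).succAbove k)) =
        fun _ => b := by
      funext k; fin_cases k; simp
    rw [h1, h2]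
    simp [sub_eq_add_neg]) hc

end Affine

/-! ### Barycentric subdivision -/

section Subdivision

variable {X Y : Type} [TopologicalSpace X] [TopologicalSpace Y]

/-- The natural operation on chains determined by a chain of the standard simplex. -/
noncomputable def natOp {n m : ℕ} (c : (singChains (Del n)).X m) :
    (singChains X).X n →+ (singChains X).X m :=
  liftChain fun a => push (evC a) c

theorem natOp_simplexChain {n m : ℕ} (c : (singChains (Del n)).X m) (a : singSet X _⦋n⦌) :
    natOp c (simplexChain a) = push (evC a) c := liftChain_simplexChain _ a

theorem push_natOp (f : C(X, Y)) {n m : ℕ} (c : (singChains (Del n)).X m)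
    (x : (singChains X).X n) : push f (natOp c x) = natOp c (push f x) := by
  have : (push f).comp (natOp c) = (natOp c).comp (push f) := chain_hom_ext fun a => by
    simp only [AddMonoidHom.comp_apply, natOp_simplexChain, push_simplexChain, push_push,
      evC_mapS]
  exact DFunLike.congr_fun this x

theorem natOp_mem {A : Set X} {n m : ℕ} (c : (singChains (Del n)).X m) {x : (singChains X).X n}
    (hx : x ∈ chainsIn A n) : natOp c x ∈ chainsIn A m :=
  chainsIn_le_comap (natOp c) _ (fun a ha => by
    rw [natOp_simplexChain]
    exact push_mem_chainsIn (A := Set.univ) (evC a) (fun t _ => ha t) (chainsIn_univ _ _)) hx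

/-- Every simplex is the image of the identity simplex of Δⁿ under itself, so natural operations are
determined by their value on that universal simplex. -/
theorem natOp_ext {n m : ℕ} (φ ψ : ∀ (X : Type) [TopologicalSpace X],
      (singChains X).X n →+ (singChains X).X m)
    (hφ : ∀ (X Y : Type) [TopologicalSpace X] [TopologicalSpace Y] (f : C(X, Y)) x,
      push f (φ X x) = φ Y (push f x))
    (hψ : ∀ (X Y : Type) [TopologicalSpace X] [TopologicalSpace Y] (f : C(X, Y)) x,
      push f (ψ X x) = ψ Y (push f x))
    (h : φ (Del n) (simplexChain (idS n)) = ψ (Del n) (simplexChain (idS n)))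
    (x : (singChains X).X n) : φ X x = ψ X x := by
  have : φ X = ψ X := chain_hom_ext fun a => by
    rw [← mapS_evC_idS a, ← push_simplexChain, ← hφ, ← hψ, h]
  exact DFunLike.congr_fun this x

/-- The barycenter of the standard simplex. -/
noncomputable def bary (n : ℕ) : Del n := stdSimplex.barycenter

/-- The barycentric subdivision of the standard simplex. -/
noncomputable def sdElt (n : ℕ) : (singChains (Del n)).X n :=
  Nat.rec (motive := fun n => (singChains (Del n)).X n) (simplexChain (idS 0))
    (fun n c => cone (bary (n + 1)) (natOp c (dd (simplexChain (idS (n + 1)))))) n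

theorem sdElt_succ (n : ℕ) : sdElt (n + 1) =
    cone (bary (n + 1)) (natOp (sdElt n) (dd (simplexChain (idS (n + 1))))) := rfl

/-- The subdivision operator. -/
noncomputable def sd {n : ℕ} : (singChains X).X n →+ (singChains X).X n := natOp (sdElt n)

/-- The chain of the standard simplex defining the homotopy between the identity and the
subdivision operator. -/
noncomputable def sdHtpyElt (n : ℕ) : (singChains (Del n)).X (n + 1) :=
  Nat.rec (motive := fun n => (singChains (Del n)).X (n + 1)) 0
    (fun n c => cone (bary (n + 1)) (simplexChain (idS (n + 1)) -
      natOp c (dd (simplexChain (idS (n + 1)))))) n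

theorem sdHtpyElt_succ (n : ℕ) : sdHtpyElt (n + 1) =
    cone (bary (n + 1)) (simplexChain (idS (n + 1)) -
      natOp (sdHtpyElt n) (dd (simplexChain (idS (n + 1))))) := rfl

/-- The homotopy between the identity and the subdivision operator. -/
noncomputable def sdHtpy {n : ℕ} : (singChains X).X n →+ (singChains X).X (n + 1) :=
  natOp (sdHtpyElt n)

theorem natOp_idS {n m : ℕ} (c : (singChains (Del n)).X m) :
    natOp c (simplexChain (idS n)) = c := by
  rw [natOp_simplexChain]
  have : evC (idS n) = ContinuousMap.id _ := ContinuousMap.ext ev_idS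
  rw [this, push_id]

theorem dd_idS_mem (n : ℕ) : dd (simplexChain (idS (n + 1))) ∈
    affCh (n := n) (N := n + 1) fun v => ∃ i : Fin (n + 2), v = fun k => vtx (i.succAbove k) := by
  rw [dd_simplexChain]
  refine sum_mem fun i _ => zsmul_mem ?_ _
  rw [idS, δ_affS]
  exact affS_mem ⟨i, rfl⟩

/-- Substituting affine simplices into affine simplices gives affine simplices whose vertices are
the images of the inner vertices, so a vertex condition needs checking only on such composites. -/
theorem natOp_mem_affCh {n m N : ℕ} {P : (Fin (m + 1) → Del n) → Prop}
    {c : (singChains (Del n)).X m} (hc : c ∈ affCh P) (Q : (Fin (n + 1) → Del N) → Prop)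
    (R : (Fin (m + 1) → Del N) → Prop) (h : ∀ v w, Q v → P w → R fun i => aff v (w i))
    {x : (singChains (Del N)).X n} (hx : x ∈ affCh Q) : natOp c x ∈ affCh R :=
  affCh_le_comap (natOp c) _ (fun v hv => by
    rw [natOp_simplexChain, evC_affS]
    exact affCh_le_comap (push (aff v)) _ (fun w hw => by
      rw [push_simplexChain, mapS_affS]
      exact affS_mem (h v w hv hw)) hc) hx

theorem cone_mem_affCh {n N : ℕ} (b : Del N) {P : (Fin (n + 1) → Del N) → Prop}
    {Q : (Fin (n + 2) → Del N) → Prop} (h : ∀ v, P v → Q (Fin.cons b v)) {c} (hc : c ∈ affCh P) :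
    cone b c ∈ affCh Q :=
  affCh_le_comap (cone b) _ (fun v hv => by
    rw [cone_affS]
    exact affS_mem (h v hv)) hc

theorem sdElt_mem (n : ℕ) : sdElt n ∈ affCh fun _ => True := by
  induction n with
  | zero => exact affS_mem trivial
  | succ n ih =>
    exact cone_mem_affCh _ (P := fun _ => True) (fun _ _ => trivial)
      (natOp_mem_affCh ih _ _ (fun _ _ _ _ => trivial) (dd_idS_mem n))

theorem sdHtpyElt_mem (n : ℕ) : sdHtpyElt n ∈ affCh fun _ => True := by
  induction n with
  | zero => exact zero_mem _
  | succ n ih =>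
    exact cone_mem_affCh _ (P := fun _ => True) (fun _ _ => trivial)
      (sub_mem (affS_mem trivial)
        (natOp_mem_affCh ih _ _ (fun _ _ _ _ => trivial) (dd_idS_mem n)))

theorem sd_idS (n : ℕ) : sd (simplexChain (idS n)) = sdElt n := natOp_idS _

theorem sdHtpy_idS (n : ℕ) : sdHtpy (simplexChain (idS n)) = sdHtpyElt n := natOp_idS _

theorem push_sd (f : C(X, Y)) {n : ℕ} (x : (singChains X).X n) : push f (sd x) = sd (push f x) :=
  push_natOp f _ x

theorem push_sdHtpy (f : C(X, Y)) {n : ℕ} (x : (singChains X).X n) :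
    push f (sdHtpy x) = sdHtpy (push f x) :=
  push_natOp f _ x

theorem sd_zero (c : (singChains X).X 0) : sd c = c :=
  natOp_ext (fun _ _ => sd) (fun _ _ => AddMonoidHom.id _) (fun _ _ _ _ f x => push_sd f x)
    (fun _ _ _ _ _ _ => rfl) (sd_idS 0) c

/-- By naturality it suffices to treat the identity simplex. There `dd_cone` leaves the subdivided
boundary minus a cone over its boundary, and the latter vanishes by induction and ∂∂ = 0. In degree
one the correction is an augmentation, which kills boundaries. -/
theorem dd_sd {n : ℕ} (c : (singChains X).X (n + 1)) : dd (sd c) = sd (dd c) := by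
  induction n generalizing X with
  | zero =>
    refine natOp_ext (fun _ _ => dd.comp sd) (fun _ _ => sd.comp dd) ?_ ?_ ?_ c
    · intro X Y _ _ f x
      simp only [AddMonoidHom.comp_apply, push_dd, push_sd]
    · intro X Y _ _ f x
      simp only [AddMonoidHom.comp_apply, push_dd, push_sd]
    · simp only [AddMonoidHom.comp_apply]
      rw [sd_idS, sdElt_succ, dd_cone_zero (P := fun _ => True)]
      · rw [← sd, sd_zero, aug_dd, zero_smul, sub_zero]
      · exact natOp_mem_affCh (sdElt_mem _) _ _ (fun _ _ _ _ => trivial) (dd_idS_mem _)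
  | succ n ih =>
    refine natOp_ext (fun _ _ => dd.comp sd) (fun _ _ => sd.comp dd) ?_ ?_ ?_ c
    · intro X Y _ _ f x
      simp only [AddMonoidHom.comp_apply, push_dd, push_sd]
    · intro X Y _ _ f x
      simp only [AddMonoidHom.comp_apply, push_dd, push_sd]
    · simp only [AddMonoidHom.comp_apply]
      rw [sd_idS, sdElt_succ, dd_cone (P := fun _ => True)]
      · rw [← sd, ih, dd_dd, map_zero, map_zero, sub_zero]
      · exact natOp_mem_affCh (sdElt_mem _) _ _ (fun _ _ _ _ => trivial) (dd_idS_mem _)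

theorem dd_sdHtpy_zero (c : (singChains X).X 0) : dd (sdHtpy c) = c - sd c := by
  rw [sd_zero, sub_self]
  have : sdHtpy c = 0 :=
    natOp_ext (fun _ _ => sdHtpy) (fun _ _ => 0) (fun _ _ _ _ f x => push_sdHtpy f x)
      (fun _ _ _ _ _ _ => map_zero _) (sdHtpy_idS 0) c
  rw [this, map_zero]

theorem dd_sdHtpy {n : ℕ} (c : (singChains X).X (n + 1)) :
    dd (sdHtpy c) = c - sd c - sdHtpy (dd c) := by
  -- The inductive input is isolated: the formula is needed only for the boundary of the identity
  -- simplex, where the term coming from its own boundary is zero.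
  have key : ∀ (n : ℕ), (dd (sdHtpy (dd (simplexChain (idS (n + 1))))) =
      dd (simplexChain (idS (n + 1))) - sd (dd (simplexChain (idS (n + 1))))) →
      ∀ (X : Type) [TopologicalSpace X] (c : (singChains X).X (n + 1)),
        dd (sdHtpy c) = c - sd c - sdHtpy (dd c) := by
    intro n h X _ c
    refine natOp_ext (fun _ _ => dd.comp sdHtpy)
      (fun _ _ => AddMonoidHom.id _ - sd - sdHtpy.comp dd) ?_ ?_ ?_ c
    · intro X Y _ _ f x
      simp only [AddMonoidHom.comp_apply, push_dd, push_sdHtpy]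
    · intro X Y _ _ f x
      simp only [AddMonoidHom.comp_apply, AddMonoidHom.sub_apply, map_sub, AddMonoidHom.id_apply,
        push_sd, push_sdHtpy, push_dd]
    · simp only [AddMonoidHom.comp_apply, AddMonoidHom.sub_apply, AddMonoidHom.id_apply]
      rw [sdHtpy_idS, sdHtpyElt_succ, dd_cone (P := fun _ => True)]
      · rw [← sdHtpy, map_sub dd, h, sub_sub_cancel]
        rw [sd_idS, sdElt_succ, ← sd]
        abel
      · exact sub_mem (affS_mem trivial)
          (natOp_mem_affCh (sdHtpyElt_mem _) _ _ (fun _ _ _ _ => trivial) (dd_idS_mem _))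
  induction n generalizing X with
  | zero => exact key 0 (dd_sdHtpy_zero _) X c
  | succ n ih => exact key (n + 1) (by rw [ih, dd_dd, map_zero, sub_zero]) X c

end Subdivision

/-! ### Small chains -/

section Small

/-- The total variation distance of two points of a standard simplex. -/
noncomputable def tv {n : ℕ} (x y : Del n) : ℝ := 1 - ∑ k, min (x k) (y k)

theorem tv_comm {n : ℕ} (x y : Del n) : tv x y = tv y x := by
  simp only [tv, min_comm]

theorem tv_nonneg {n : ℕ} (x y : Del n) : 0 ≤ tv x y := by
  have : ∑ k, min (x k) (y k) ≤ ∑ k, x k := Finset.sum_le_sum fun k _ => min_le_left _ _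
  rw [stdSimplex.sum_eq_one] at this
  rw [tv]
  linarith

theorem tv_self {n : ℕ} (x : Del n) : tv x x = 0 := by
  simp [tv]

/-- Some coordinate of x is at least the mean 1 / (n + 1), which is the barycentric value, so the
two points share at least that much mass. This is the source of the contraction factor n / (n + 1).
-/
theorem tv_bary {n : ℕ} (x : Del n) : tv (bary n) x ≤ n / (n + 1) := by
  have hb : ∀ k, bary n k = ((n : ℝ) + 1)⁻¹ := fun k => by
    change (stdSimplex.barycenter (𝕜 := ℝ) (X := Fin (n + 1))).1 k = _
    rw [stdSimplex.barycenter_apply]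
    simp
  have hpos : (0 : ℝ) < (n : ℝ) + 1 := by positivity
  obtain ⟨k, -, hk⟩ : ∃ k ∈ Finset.univ, ((n : ℝ) + 1)⁻¹ ≤ x k := by
    refine Finset.exists_le_of_sum_le Finset.univ_nonempty ?_
    rw [stdSimplex.sum_eq_one]
    simp [hpos.ne']
  have h1 : min (bary n k) (x k) ≤ ∑ k, min (bary n k) (x k) :=
    Finset.single_le_sum (f := fun k => min (bary n k) (x k))
      (fun j _ => le_min ((bary n).2.1 j) (x.2.1 j)) (Finset.mem_univ k)
  rw [hb, min_eq_left hk] at h1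
  have : (n : ℝ) / (n + 1) = 1 - ((n : ℝ) + 1)⁻¹ := by field_simp; ring
  rw [tv, this]
  linarith

theorem tv_face {n : ℕ} (i : Fin (n + 2)) (x y : Del n) :
    tv (aff (fun k => vtx (i.succAbove k)) x) (aff (fun k => vtx (i.succAbove k)) y) = tv x y := by
  have h : ∀ x : Del n, aff (fun k => vtx (i.succAbove k)) x i = 0 ∧
      ∀ k, aff (fun k => vtx (i.succAbove k)) x (i.succAbove k) = x k := fun x => by
    refine ⟨?_, fun k => ?_⟩
    · simp [aff_apply, vtx_apply]
    · simp [aff_apply, vtx_apply]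
  rw [tv, tv, Fin.sum_univ_succAbove _ i, (h x).1, (h y).1]
  simp only [(h x).2, (h y).2, min_self, zero_add]

/-- The points x and y share mass 1 - t, and the excesses a and b both have mass t. Transporting a
to b moves mass t over distances at most D. -/
theorem norm_aff_sub_le {n N : ℕ} (v : Fin (n + 1) → Del N) {D : ℝ}
    (hv : ∀ k l, dist (v k) (v l) ≤ D) (x y : Del n) :
    dist (aff v x) (aff v y) ≤ tv x y * D := by
  set t := tv x y with ht
  set a : Fin (n + 1) → ℝ := fun k => x k - min (x k) (y k) with ha
  set b : Fin (n + 1) → ℝ := fun k => y k - min (x k) (y k) with hb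
  have ha0 : ∀ k, 0 ≤ a k := fun k => sub_nonneg.2 (min_le_left _ _)
  have hb0 : ∀ k, 0 ≤ b k := fun k => sub_nonneg.2 (min_le_right _ _)
  have hat : ∑ k, a k = t := by
    rw [ha, Finset.sum_sub_distrib, stdSimplex.sum_eq_one, ht, tv]
  have hbt : ∑ k, b k = t := by
    rw [hb, Finset.sum_sub_distrib, stdSimplex.sum_eq_one, ht, tv]
  have htn : 0 ≤ t := tv_nonneg x y
  rw [Subtype.dist_eq, dist_eq_norm]
  have hdiff : (aff v x).1 - (aff v y).1 = ∑ k, a k • (v k).1 - ∑ k, b k • (v k).1 := by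
    rw [← Finset.sum_sub_distrib]
    funext j
    change ∑ k, x k * v k j - ∑ k, y k * v k j = _
    rw [← Finset.sum_sub_distrib, Finset.sum_apply]
    refine Finset.sum_congr rfl fun k _ => ?_
    simp only [ha, hb, Pi.sub_apply, Pi.smul_apply, smul_eq_mul]
    change _ = _ * v k j - _ * v k j
    ring
  rw [hdiff]
  rcases htn.eq_or_lt with h0 | hpos
  · have ha' : ∀ k, a k = 0 := fun k =>
      (Finset.sum_eq_zero_iff_of_nonneg fun k _ => ha0 k).1 (hat.trans h0.symm) k (Finset.mem_univ k)
    have hb' : ∀ k, b k = 0 := fun k =>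
      (Finset.sum_eq_zero_iff_of_nonneg fun k _ => hb0 k).1 (hbt.trans h0.symm) k (Finset.mem_univ k)
    simp [ha', hb', ← h0]
  -- Multiplying by t makes the difference a double sum of (a k * b l) • (v k - v l), because both
  -- excesses have total mass t; the factor is cancelled at the end.
  · have hD : ‖t • (∑ k, a k • (v k).1 - ∑ k, b k • (v k).1)‖ ≤ t * (t * D) := by
      have h1 : t • (∑ k, a k • (v k).1 - ∑ k, b k • (v k).1) =
          ∑ k, ∑ l, (a k * b l) • ((v k).1 - (v l).1) := by
        simp only [smul_sub, Finset.sum_sub_distrib]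
        congr 1
        · rw [Finset.smul_sum]
          refine Finset.sum_congr rfl fun k _ => ?_
          rw [← Finset.sum_smul, ← Finset.mul_sum, hbt, mul_comm, mul_smul]
        · rw [Finset.sum_comm]
          rw [Finset.smul_sum]
          refine Finset.sum_congr rfl fun k _ => ?_
          rw [← Finset.sum_smul, ← Finset.sum_mul, hat, mul_smul]
      rw [h1]
      calc ‖∑ k, ∑ l, (a k * b l) • ((v k).1 - (v l).1)‖
          ≤ ∑ k, ∑ l, (a k * b l) * D := by
            refine norm_sum_le_of_le _ fun k _ => norm_sum_le_of_le _ fun l _ => ?_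
            rw [norm_smul, Real.norm_of_nonneg (mul_nonneg (ha0 k) (hb0 l)), ← dist_eq_norm]
            exact mul_le_mul_of_nonneg_left (hv k l) (mul_nonneg (ha0 k) (hb0 l))
        _ = t * (t * D) := by
            simp only [← Finset.sum_mul, ← Finset.mul_sum, hat, hbt, mul_assoc]
    rw [norm_smul, Real.norm_of_nonneg htn] at hD
    exact le_of_mul_le_mul_left hD hpos

/-- The vertices of an affine simplex have pairwise total variation distance at most `r`. -/
def TvSmall (r : ℝ) {n N : ℕ} (w : Fin (n + 1) → Del N) : Prop := ∀ i j, tv (w i) (w j) ≤ r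

/-- The vertices of an affine simplex have pairwise distance at most `D`. -/
def DistSmall (D : ℝ) {n N : ℕ} (w : Fin (n + 1) → Del N) : Prop := ∀ i j, dist (w i) (w j) ≤ D

/-- Two vertices of a simplex of the subdivision either lie in a common subdivided face, where
induction applies and n / (n + 1) increases with n, or one of them is the barycenter. -/
theorem sdElt_tvSmall (n : ℕ) : sdElt n ∈ affCh (TvSmall ((n : ℝ) / (n + 1))) := by
  induction n with
  | zero =>
    refine affS_mem fun i j => ?_
    rw [Subsingleton.elim (α := Fin 1) i j, tv_self]
    simp
  | succ n ih =>
    refine cone_mem_affCh (P := TvSmall (n / (n + 1))) _ (fun v hv => ?_)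
      (natOp_mem_affCh ih _ _ ?_ (dd_idS_mem n))
    · have hle : (n : ℝ) / (n + 1) ≤ ((n + 1 : ℕ) : ℝ) / ((n + 1 : ℕ) + 1) := by
        push_cast
        rw [div_le_div_iff₀ (by positivity) (by positivity)]
        nlinarith
      have h0 : (0 : ℝ) ≤ ((n + 1 : ℕ) : ℝ) / ((n + 1 : ℕ) + 1) := by positivity
      intro i j
      refine Fin.cases ?_ (fun i => ?_) i <;> refine Fin.cases ?_ (fun j => ?_) j
      · rw [tv_self]; exact h0
      · simp only [Fin.cons_zero, Fin.cons_succ]; exact tv_bary _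
      · simp only [Fin.cons_zero, Fin.cons_succ]; rw [tv_comm]; exact tv_bary _
      · simp only [Fin.cons_succ]; exact (hv i j).trans hle
    · rintro _ _ ⟨i, rfl⟩ hw k l
      rw [tv_face]
      exact hw k l

theorem sd_distSmall {n N : ℕ} {D : ℝ} (hD : 0 ≤ D) {c : (singChains (Del N)).X n}
    (hc : c ∈ affCh (DistSmall D)) : sd c ∈ affCh (DistSmall ((n : ℝ) / (n + 1) * D)) :=
  natOp_mem_affCh (sdElt_tvSmall n) _ _ (fun v _ hv hw i j =>
    (norm_aff_sub_le v hv _ _).trans (mul_le_mul_of_nonneg_right (hw i j) hD)) hc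

theorem iterate_sd_distSmall (n m : ℕ) :
    sd^[m] (simplexChain (idS n)) ∈ affCh (DistSmall (((n : ℝ) / (n + 1)) ^ m)) := by
  induction m with
  | zero =>
    refine affS_mem fun i j => ?_
    rw [pow_zero, Subtype.dist_eq, dist_pi_le_iff zero_le_one]
    intro k
    rw [Real.dist_eq, abs_le]
    have h := fun i : Fin (n + 1) => stdSimplex.zero_le (vtx i) k
    have h' := fun i : Fin (n + 1) => stdSimplex.le_one (vtx i) k
    constructor
    · have := h i; have := h' j; change _ ≤ vtx i k - vtx j k; linarith
    · have := h' i; have := h j; change vtx i k - vtx j k ≤ _; linarith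
  | succ m ih =>
    rw [Function.iterate_succ_apply', pow_succ']
    exact sd_distSmall (by positivity) ih

variable {X : Type} [TopologicalSpace X]

theorem push_iterate_sd {Y : Type} [TopologicalSpace Y] (f : C(X, Y)) {n : ℕ} (m : ℕ)
    (c : (singChains X).X n) : push f (sd^[m] c) = sd^[m] (push f c) := by
  induction m with
  | zero => rfl
  | succ m ih => rw [Function.iterate_succ_apply', Function.iterate_succ_apply', push_sd, ih]

theorem iterate_sd_add {n : ℕ} (m : ℕ) (c c' : (singChains X).X n) :
    sd^[m] (c + c') = sd^[m] c + sd^[m] c' := by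
  induction m with
  | zero => rfl
  | succ m ih => simp only [Function.iterate_succ_apply', ih, map_add]

theorem iterate_sd_neg {n : ℕ} (m : ℕ) (c : (singChains X).X n) :
    sd^[m] (-c) = -sd^[m] c := by
  induction m with
  | zero => rfl
  | succ m ih => simp only [Function.iterate_succ_apply', ih, map_neg]

/-- For one simplex, a Lebesgue number of the cover pulled back to Δⁿ bounds the number of
subdivisions needed. The conclusion for all large m lets finitely many simplices be treated
together. -/
theorem exists_iterate_sd_mem {A B : Set X} (hAB : interior A ∪ interior B = Set.univ) {n : ℕ}
    (c : (singChains X).X n) :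
    ∃ m₀, ∀ m ≥ m₀, sd^[m] c ∈ chainsIn A n ⊔ chainsIn B n := by
  induction c using chain_induction with
  | h0 =>
    refine ⟨0, fun m _ => ?_⟩
    have h : sd^[m] (0 : (singChains X).X n) = 0 := by
      induction m with
      | zero => rfl
      | succ m ih => rw [Function.iterate_succ_apply', ih (Nat.zero_le m), map_zero]
    rw [h]
    exact zero_mem _
  | hneg c h =>
    obtain ⟨m₀, h⟩ := h
    exact ⟨m₀, fun m hm => by rw [iterate_sd_neg]; exact neg_mem (h m hm)⟩
  | hadd c c' h h' =>
    obtain ⟨m₀, h⟩ := h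
    obtain ⟨m₁, h'⟩ := h'
    exact ⟨max m₀ m₁, fun m hm => by
      rw [iterate_sd_add]
      exact add_mem (h m (le_trans (le_max_left _ _) hm)) (h' m (le_trans (le_max_right _ _) hm))⟩
  | hs a =>
    let cov : Bool → Set (Del n) := fun i =>
      ev a ⁻¹' (bif i then interior A else interior B)
    obtain ⟨ε, hε, hcov⟩ := lebesgue_number_lemma_of_metric (s := (Set.univ : Set (Del n)))
      (c := cov) isCompact_univ
      (fun i => by
        refine IsOpen.preimage (ev_continuous a) ?_
        cases i
        · exact isOpen_interior
        · exact isOpen_interior)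
      (fun t _ => by
        have : ev a t ∈ interior A ∪ interior B := by rw [hAB]; trivial
        rcases this with h | h
        · exact Set.mem_iUnion.2 ⟨true, h⟩
        · exact Set.mem_iUnion.2 ⟨false, h⟩)
    have hr : (n : ℝ) / (n + 1) < 1 := (div_lt_one (by positivity)).2 (by linarith)
    obtain ⟨m₀, hm₀⟩ := exists_pow_lt_of_lt_one hε hr
    refine ⟨m₀, fun m hm => ?_⟩
    have hlt : ((n : ℝ) / (n + 1)) ^ m < ε :=
      (pow_le_pow_of_le_one (by positivity) hr.le hm).trans_lt hm₀
    rw [← mapS_evC_idS a, ← push_simplexChain, ← push_iterate_sd]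
    refine affCh_le_comap (push (evC a)) _ (fun v hv => ?_) (iterate_sd_distSmall n m)
    rw [push_simplexChain]
    obtain ⟨i, hi⟩ := hcov (v 0) trivial
    -- Any two points of the standard simplex have total variation distance at most 1, so an affine
    -- simplex is no wider than its set of vertices.
    have hball : ∀ t, aff v t ∈ cov i := fun t => hi (by
      rw [Metric.mem_ball, ← aff_vtx v 0]
      have htv : tv t (vtx 0) ≤ 1 := by
        rw [tv]
        have : 0 ≤ ∑ k, min (t k) (vtx 0 k) :=
          Finset.sum_nonneg fun k _ => le_min (t.2.1 k) ((vtx 0).2.1 k)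
        linarith
      calc dist (aff v t) (aff v (vtx 0)) ≤ tv t (vtx 0) * ((n : ℝ) / (n + 1)) ^ m :=
            norm_aff_sub_le v hv _ _
        _ ≤ 1 * ((n : ℝ) / (n + 1)) ^ m := mul_le_mul_of_nonneg_right htv (by positivity)
        _ < ε := by rwa [one_mul])
    cases i
    · exact AddSubgroup.mem_sup_right (simplexChain_mem fun t => interior_subset (hball t))
    · exact AddSubgroup.mem_sup_left (simplexChain_mem fun t => interior_subset (hball t))

theorem natOp_mem_sup {A B : Set X} {n m : ℕ} (x : (singChains (Del n)).X m)
    {c : (singChains X).X n} (hc : c ∈ chainsIn A n ⊔ chainsIn B n) :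
    natOp x c ∈ chainsIn A m ⊔ chainsIn B m := by
  obtain ⟨a, ha, b, hb, rfl⟩ := AddSubgroup.mem_sup.1 hc
  rw [map_add]
  exact AddSubgroup.mem_sup.2 ⟨_, natOp_mem x ha, _, natOp_mem x hb, rfl⟩

/-- The theorem of small chains for a cover by the interiors of two subsets, in its relative
form. -/
theorem exists_small {A B : Set X} (hAB : interior A ∪ interior B = Set.univ) {n : ℕ}
    (c : (singChains X).X (n + 1)) (hc : dd c ∈ chainsIn A n ⊔ chainsIn B n) :
    ∃ a ∈ chainsIn A (n + 1), ∃ b ∈ chainsIn B (n + 1), ∃ e, c = a + b + dd e := by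
  -- In c - sd c = ∂Tc + T∂c, with T the subdivision homotopy, the term T∂c is small because ∂c is
  -- and T preserves images. Hence each subdivision changes c only by a boundary and a small chain.
  have key : ∀ m, ∃ e, c - sd^[m] c - dd e ∈ chainsIn A (n + 1) ⊔ chainsIn B (n + 1) ∧
      dd (sd^[m] c) ∈ chainsIn A n ⊔ chainsIn B n := by
    intro m
    induction m with
    | zero => exact ⟨0, by simp, hc⟩
    | succ m ih =>
      obtain ⟨e, he, hm⟩ := ih
      refine ⟨e + sdHtpy (sd^[m] c), ?_, ?_⟩
      · have h := add_mem he (natOp_mem_sup (sdHtpyElt n) hm)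
        convert h using 1
        rw [← sdHtpy, map_add, dd_sdHtpy, Function.iterate_succ_apply']
        abel
      · rw [Function.iterate_succ_apply', dd_sd]
        exact natOp_mem_sup _ hm
  obtain ⟨m, hm⟩ := exists_iterate_sd_mem hAB c
  obtain ⟨e, he, -⟩ := key m
  obtain ⟨a, ha, b, hb, hab⟩ := AddSubgroup.mem_sup.1 (add_mem he (hm m le_rfl))
  exact ⟨a, ha, b, hb, e, by rw [hab]; abel⟩

end Small

/-! ### Relative homology -/

section Relative

variable {X : Type} [TopologicalSpace X]

/-- The relative chain complex `C(X, A)`. -/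
noncomputable abbrev relCh (A : Set X) : ChainComplex AddCommGrpCat.{0} ℕ :=
  relChainsFunctor.obj (TopPair.ofSubset (X := TopCat.of X) A)

/-- The projection `C(X) → C(X, A)`. -/
noncomputable def relProjHom (A : Set X) : singChains X ⟶ relCh A :=
  (Limits.coker.π _).app
    (singChainsFunctor.mapArrow.obj (TopPair.ofSubset (X := TopCat.of X) A).toComma)

/-- The short complex `C(A) → C(X) → C(X, A)`. -/
noncomputable def relSC (A : Set X) : ShortComplex (ChainComplex AddCommGrpCat.{0} ℕ) :=
  ShortComplex.mk (pushHom (incl A)) (relProjHom A) (Limits.cokernel.condition _)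

theorem relSC_shortExact (A : Set X) : (relSC A).ShortExact where
  exact := ShortComplex.exact_of_g_is_cokernel _ (Limits.cokernelIsCokernel (pushHom (incl A)))
  mono_f := HomologicalComplex.mono_of_mono_f _ fun _ =>
    (AddCommGrpCat.mono_iff_injective _).2 (push_incl_injective A)
  epi_g := inferInstanceAs (Epi (Limits.cokernel.π (pushHom (incl A))))

/-- The projection of chains to relative chains. -/
noncomputable def relProj (A : Set X) (n : ℕ) : (singChains X).X n →+ (relCh A).X n :=
  ((relProjHom A).f n).hom

theorem relSC_eval (A : Set X) (n : ℕ) :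
    ((relSC A).map (HomologicalComplex.eval _ _ n)).ShortExact :=
  (HomologicalComplex.shortExact_iff_degreewise_shortExact _).1 (relSC_shortExact A) n

theorem relProj_surjective (A : Set X) (n : ℕ) : Function.Surjective (relProj A n) :=
  (AddCommGrpCat.epi_iff_surjective _).1 (relSC_eval A n).epi_g

theorem relProj_eq_zero_iff {A : Set X} {n : ℕ} {c : (singChains X).X n} :
    relProj A n c = 0 ↔ c ∈ chainsIn A n := by
  rw [mem_chainsIn_iff]
  constructor
  · exact fun h => (ShortComplex.ab_exact_iff _).1 (relSC_eval A n).exact c h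
  · rintro ⟨c', rfl⟩
    exact congrArg (fun g => g.hom c') ((relSC A).map (HomologicalComplex.eval _ _ n)).zero

theorem relProj_d {A : Set X} {n : ℕ} (c : (singChains X).X (n + 1)) :
    relProj A n (dd c) = ((relCh A).d (n + 1) n).hom (relProj A (n + 1) c) :=
  hom_d (relProjHom A) _ _ c

theorem relProj_mem_cyc {A : Set X} {n : ℕ} {c : (singChains X).X (n + 1)}
    (hc : dd c ∈ chainsIn A n) : relProj A (n + 1) c ∈ cyc (relCh A) (n + 1) := by
  rw [mem_cyc_succ, ← relProj_d, relProj_eq_zero_iff]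
  exact hc

/-- The relative homology class of a relative cycle. -/
noncomputable def relCls (A : Set X) {n : ℕ} (c : (singChains X).X (n + 1))
    (hc : dd c ∈ chainsIn A n) : (relCh A).homology (n + 1) :=
  hcls _ _ ⟨relProj A (n + 1) c, relProj_mem_cyc hc⟩

theorem relCls_surjective {A : Set X} {n : ℕ} (x : (relCh A).homology (n + 1)) :
    ∃ c hc, relCls A (n := n) c hc = x := by
  obtain ⟨⟨y, hy⟩, rfl⟩ := hcls_surjective _ x
  obtain ⟨c, rfl⟩ := relProj_surjective A _ y
  exact ⟨c, relProj_eq_zero_iff.1 ((relProj_d c).trans (mem_cyc_succ.1 hy)), rfl⟩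

theorem relCls_eq_iff {A : Set X} {n : ℕ} {c c' : (singChains X).X (n + 1)}
    {hc : dd c ∈ chainsIn A n} {hc' : dd c' ∈ chainsIn A n} :
    relCls A c hc = relCls A c' hc' ↔ ∃ e, c - c' - dd e ∈ chainsIn A (n + 1) := by
  rw [relCls, relCls, hcls_eq_iff]
  constructor
  · rintro ⟨y, hy⟩
    obtain ⟨e, rfl⟩ := relProj_surjective A _ y
    refine ⟨e, ?_⟩
    rw [← relProj_eq_zero_iff, map_sub, map_sub, relProj_d, hy, sub_self]
  · rintro ⟨e, he⟩
    refine ⟨relProj A _ e, ?_⟩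
    rw [← relProj_eq_zero_iff, map_sub, map_sub, sub_eq_zero, relProj_d] at he
    exact he.symm

theorem relCls_eq_zero_iff {A : Set X} {n : ℕ} {c : (singChains X).X (n + 1)}
    {hc : dd c ∈ chainsIn A n} :
    relCls A c hc = 0 ↔ ∃ e, c - dd e ∈ chainsIn A (n + 1) := by
  have h0 : relCls A (n := n) 0 (by rw [map_zero]; exact zero_mem _) = 0 := by
    have : relProj A (n + 1) 0 = 0 := map_zero _
    simp only [relCls, this]
    exact map_zero (hcls _ _)
  rw [← h0, relCls_eq_iff]
  simp only [sub_zero]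

/-- The relative homology of `(F, D)` vanishes, for subsets `D` and `F` of a space. -/
def RelAcyclic (F D : Set X) : Prop :=
  ∀ (n : ℕ), ∀ c ∈ chainsIn F (n + 1), dd c ∈ chainsIn D n →
    ∃ w ∈ chainsIn D (n + 1), ∃ v ∈ chainsIn F (n + 2), c = w + dd v

/-- Since ρ fixes the boundary of c, the difference z of c and ρ(c) is an absolute cycle in F, hence
homologous to its image in D. The homotopy need not be relative to D. -/
theorem relAcyclic_of_retraction {F D : Set X} (h : D ⊆ F) (ρ : C(F, D))
    (hρ : ∀ x (hx : x ∈ D), ρ ⟨x, h hx⟩ = ⟨x, hx⟩)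
    (hH : (ContinuousMap.id F).Homotopic ((ContinuousMap.inclusion h).comp ρ)) :
    RelAcyclic F D := by
  intro n c hc hdc
  obtain ⟨c', rfl⟩ := mem_chainsIn_iff.1 hc
  obtain ⟨u, hu⟩ := mem_chainsIn_iff.1 hdc
  have hincl : ∀ {m} (x : (singChains D).X m),
      push (incl F) (push (ContinuousMap.inclusion h) x) = push (incl D) x := fun x => by
    rw [push_push]
    rfl
  have hρi : ρ.comp (ContinuousMap.inclusion h) = ContinuousMap.id D :=
    ContinuousMap.ext fun x => hρ x.1 x.2
  -- the boundary of `c` already bounds in `D`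
  have hu' : u = dd (push ρ c') := by
    rw [← push_dd, show dd c' = push (ContinuousMap.inclusion h) u from
      push_incl_injective F (by rw [push_dd, hincl, hu]), push_push, hρi, push_id]
  set z := c' - push (ContinuousMap.inclusion h) (push ρ c') with hz
  have hzc : z ∈ cyc (singChains F) (n + 1) := by
    rw [mem_cyc_succ]
    apply push_incl_injective F
    change push (incl F) (dd z) = _
    rw [hz, map_sub, map_sub, ← push_dd (ContinuousMap.inclusion h), hincl, ← hu', hu, push_dd,
      sub_self, map_zero]
  obtain ⟨e, he⟩ := exists_dd_eq_push_sub_push hH hzc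
  rw [push_id, ← push_push] at he
  refine ⟨push (incl D) (push ρ c' + push ρ z), push_incl_mem _, push (incl F) e,
    push_incl_mem _, ?_⟩
  rw [← push_dd, he, ← hincl, ← map_add (push (incl F)), map_add (push (ContinuousMap.inclusion h))]
  congr 1
  rw [hz]
  abel

theorem corestr_mem {N S : Set X} {n : ℕ} {c : (singChains X).X n} (hc : c ∈ chainsIn S n) :
    corestr N c ∈ chainsIn (Subtype.val ⁻¹' S : Set N) n :=
  chainsIn_le_comap (corestr N) _ (fun a ha => by
    rw [corestr, liftChain_simplexChain]
    split_ifs with h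
    · refine simplexChain_mem fun t => ?_
      rw [Set.mem_preimage, ev_mkS]
      exact ha t
    · exact zero_mem _) hc

theorem push_incl_mem_iff {N S : Set X} {n : ℕ} {c : (singChains N).X n} :
    push (incl N) c ∈ chainsIn S n ↔ c ∈ chainsIn (Subtype.val ⁻¹' S : Set N) n := by
  constructor
  · intro h
    rw [← corestr_push c]
    exact corestr_mem h
  · intro h
    have hm : Set.MapsTo (incl N) (Subtype.val ⁻¹' S) S := fun x hx => hx
    exact push_mem_chainsIn (incl N) hm h

variable {N D : Set X} {S : Set N}

theorem relProjHom_naturality (φ : TopPair.ofSubset (X := TopCat.of N) S ⟶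
      TopPair.ofSubset (X := TopCat.of X) D) :
    relProjHom S ≫ relChainsFunctor.map φ =
      singChainsFunctor.map (TopPair.Hom.fst φ) ≫ relProjHom D :=
  Limits.cokernel.π_desc _ _ _

theorem relMap_relCls (φ : TopPair.ofSubset (X := TopCat.of N) S ⟶
      TopPair.ofSubset (X := TopCat.of X) D)
    (hφ : TopPair.Hom.fst φ = TopCat.ofHom (incl N)) {n : ℕ} (c : (singChains N).X (n + 1))
    (hc : dd c ∈ chainsIn S n) (hc' : dd (push (incl N) c) ∈ chainsIn D n) :
    ((relHomologyFunctor (n + 1)).map φ).hom (relCls S c hc) =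
      relCls D (push (incl N) c) hc' := by
  refine (homologyMap_hcls (relChainsFunctor.map φ) _).trans ?_
  refine congrArg (hcls (relCh D) (n + 1)) (Subtype.ext ?_)
  have h2 := congrArg (fun g : singChains N ⟶ relCh D => (g.f (n + 1)).hom c)
    (relProjHom_naturality φ)
  refine h2.trans ?_
  change relProj D (n + 1) (((singChainsFunctor.map (TopPair.Hom.fst φ)).f (n + 1)).hom c) = _
  rw [hφ]
  rfl

/-- Excision, for a subset `D` which is a deformation retract of a set `F` such that the
interiors of `N` and `F` cover. -/
theorem excision_bijective {F : Set X} (hcov : interior N ∪ interior F = Set.univ) (hDF : D ⊆ F)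
    (hS : S = Subtype.val ⁻¹' D)
    (hR : RelAcyclic F D) (hR' : RelAcyclic (N ∩ F) (N ∩ D))
    (φ : TopPair.ofSubset (X := TopCat.of N) S ⟶ TopPair.ofSubset (X := TopCat.of X) D)
    (hφ : TopPair.Hom.fst φ = TopCat.ofHom (incl N)) (n : ℕ) :
    Function.Bijective ((relHomologyFunctor (n + 2)).map φ).hom := by
  subst hS
  constructor
  · rw [injective_iff_map_eq_zero]
    intro x hx
    obtain ⟨c, hc, rfl⟩ := relCls_surjective (n := n + 1) x
    have hc' : dd (push (incl N) c) ∈ chainsIn D (n + 1) := by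
      rw [← push_dd]; exact push_incl_mem_iff.2 hc
    rw [relMap_relCls φ hφ c hc hc'] at hx
    obtain ⟨e, he⟩ := relCls_eq_zero_iff.1 hx
    set a := push (incl N) c with ha
    have haN : a ∈ chainsIn N (n + 2) := push_incl_mem c
    -- The chain e, which bounds a modulo D, is split into e₁ in N and e₂ in F; then a - ∂e₁ lies in
    -- N ∩ F with boundary in N ∩ D, and `hR'` moves it into D without leaving N.
    obtain ⟨e₁, he₁, e₂, he₂, y, rfl⟩ := exists_small hcov e
      (AddSubgroup.mem_sup.2 ⟨a, haN, -(a - dd e), chainsIn_mono hDF _ (neg_mem he), by abel⟩)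
    simp only [map_add, dd_dd, add_zero] at he
    obtain ⟨w, hw, v, hv, hwv⟩ := hR' (n + 1) (a - dd e₁)
      (mem_chainsIn_inter (sub_mem haN (dd_mem_chainsIn he₁)) (by
        have := add_mem (chainsIn_mono hDF _ he) (dd_mem_chainsIn he₂)
        convert this using 1
        abel))
      (by
        rw [map_sub, dd_dd, sub_zero]
        exact mem_chainsIn_inter (dd_mem_chainsIn haN) hc')
    have hex : ∃ e, c - dd e ∈ chainsIn (Subtype.val ⁻¹' D : Set N) (n + 2) := by
      obtain ⟨x, hx⟩ := mem_chainsIn_iff.1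
        (add_mem he₁ (chainsIn_mono Set.inter_subset_left _ hv))
      refine ⟨x, push_incl_mem_iff.1 ?_⟩
      rw [map_sub, push_dd, hx, ← ha, map_add]
      rw [sub_eq_iff_eq_add] at hwv
      rw [hwv, show w + dd v + dd e₁ - (dd e₁ + dd v) = w by abel]
      exact chainsIn_mono Set.inter_subset_right _ hw
    exact relCls_eq_zero_iff.2 hex
  · intro x
    obtain ⟨c, hc, rfl⟩ := relCls_surjective (n := n + 1) x
    -- The part a in N is the candidate preimage, but its boundary lies only in N ∩ F. A correction
    -- v in N ∩ F pushes this boundary into D, and `hR` then absorbs the remainder b + v.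
    obtain ⟨a, ha, b, hb, e, rfl⟩ := exists_small hcov c
      (AddSubgroup.mem_sup_right (chainsIn_mono hDF _ hc))
    simp only [map_add, dd_dd, add_zero] at hc
    obtain ⟨u, hu, v, hv, huv⟩ := hR' n (dd a)
      (mem_chainsIn_inter (dd_mem_chainsIn ha) (by
        have := sub_mem (chainsIn_mono hDF _ hc) (dd_mem_chainsIn hb)
        simpa using this)) (by rw [dd_dd]; exact zero_mem _)
    have hav : a - v ∈ chainsIn N (n + 2) :=
      sub_mem ha (chainsIn_mono Set.inter_subset_left _ hv)
    have hdav : dd (a - v) ∈ chainsIn D (n + 1) := by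
      rw [map_sub, huv, add_sub_cancel_right]
      exact chainsIn_mono Set.inter_subset_right _ hu
    obtain ⟨x, hx⟩ := mem_chainsIn_iff.1 hav
    obtain ⟨w, hw, y, -, hwy⟩ := hR (n + 1) (b + v)
      (add_mem hb (chainsIn_mono Set.inter_subset_right _ hv)) (by
        have := sub_mem hc hdav
        convert this using 1
        simp only [map_add, map_sub]
        abel)
    have hdx : dd x ∈ chainsIn (Subtype.val ⁻¹' D : Set N) (n + 1) := by
      rw [← push_incl_mem_iff, push_dd, hx]
      exact hdav
    refine ⟨relCls _ x hdx, (relMap_relCls φ hφ x hdx (by rw [hx]; exact hdav)).trans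
      (relCls_eq_iff.2 ⟨-(y + e), ?_⟩)⟩
    rw [hx]
    have : a - v - (a + b + dd e) - dd (-(y + e)) = -w := by
      have h2 : b = w + dd y - v := eq_sub_of_add_eq hwy
      rw [h2, map_neg, map_add]
      abel
    rw [this]
    exact neg_mem hw

end Relative

/-! ### The deformation of the configuration space onto the discrete configuration space -/

section Deformation

variable {V : Type} [Fintype V] {G : SimpleGraph V}

theorem coord_nonneg (x : Realization G) (v : V) : 0 ≤ x.1 v := x.2.1.1 v

theorem sum_coord (x : Realization G) : ∑ v, x.1 v = 1 := x.2.1.2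

theorem coord_le_one (x : Realization G) (v : V) : x.1 v ≤ 1 := by
  rw [← sum_coord x]
  exact Finset.single_le_sum (fun v _ => coord_nonneg x v) (Finset.mem_univ v)

theorem realization_ext {x y : Realization G} (h : ∀ v, x.1 v = y.1 v) : x = y :=
  Subtype.ext (funext h)

theorem continuous_coord (v : V) : Continuous fun x : Realization G => x.1 v :=
  (continuous_apply v).comp continuous_subtype_val

open Classical in
/-- The vertices of the realization of a graph. -/
noncomputable def vertexPt (G : SimpleGraph V) (v : V) : Realization G :=
  ⟨Pi.single v 1, single_mem_stdSimplex ℝ v, Or.inl ⟨v, by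
    intro w hw
    by_contra h
    exact hw (Pi.single_eq_of_ne h _)⟩⟩

open Classical in
theorem vertexPt_apply (v w : V) : (vertexPt G v).1 w = if w = v then 1 else 0 :=
  Pi.single_apply v (1 : ℝ) w

/-- Supports are closed simplices, so they meet exactly when they share a vertex. This turns D into
a set of equations on coordinates. -/
theorem mem_discConf {x y : Realization G} :
    (x, y) ∈ discConf G ↔ ∀ v, x.1 v = 0 ∨ y.1 v = 0 := by
  constructor
  · intro h v
    by_contra! hv
    have hs : ∀ z : Realization G, z.1 v ≠ 0 → vertexPt G v ∈ supp z := by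
      intro z hz w hw
      rw [Function.mem_support, vertexPt_apply] at hw
      have hwv : w = v := by
        by_contra hne
        exact hw (if_neg hne)
      rwa [hwv]
    exact Set.disjoint_left.1 (show Disjoint (supp x) (supp y) from h) (hs x hv.1) (hs y hv.2)
  · intro h
    refine Set.disjoint_left.2 fun z hx hy => ?_
    have hz : ∀ v, z.1 v = 0 := fun v => by
      by_contra hv
      rcases h v with h | h
      · exact hx hv h
      · exact hy hv h
    have := sum_coord z
    simp [hz] at this

theorem isClosed_discConf : IsClosed (discConf G) := by
  have : discConf G = ⋂ v, {p | p.1.1 v * p.2.1 v = 0} := by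
    ext ⟨x, y⟩
    simp [mem_discConf]
  rw [this]
  exact isClosed_iInter fun v => isClosed_eq
    (((continuous_coord v).comp continuous_fst).mul ((continuous_coord v).comp continuous_snd))
    continuous_const

instance : T2Space (Realization G) := inferInstanceAs (T2Space (Subtype _))

theorem isOpen_confSpace : IsOpen (confSpace G) :=
  isOpen_ne_fun continuous_fst continuous_snd

theorem discConf_subset_confSpace : discConf G ⊆ confSpace G := by
  rintro ⟨x, y⟩ h (rfl : x = y)
  rw [mem_discConf] at h
  have h0 : ∀ v, x.1 v = 0 := fun v => or_self_iff.1 (h v)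
  have := sum_coord x
  simp [h0] at this

/-- The total overlap of two points. -/
noncomputable def overlap (x y : Realization G) : ℝ := ∑ v, min (x.1 v) (y.1 v)

theorem overlap_comm (x y : Realization G) : overlap x y = overlap y x := by
  simp only [overlap, min_comm]

theorem min_coord_nonneg (x y : Realization G) (v : V) : 0 ≤ min (x.1 v) (y.1 v) :=
  le_min (coord_nonneg x v) (coord_nonneg y v)

theorem overlap_nonneg (x y : Realization G) : 0 ≤ overlap x y :=
  Finset.sum_nonneg fun v _ => min_coord_nonneg x y v

/-- Overlap one forces x ≤ y and y ≤ x in every coordinate. Strictness keeps the denominators of the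
deformation positive off the diagonal. -/
theorem overlap_lt_one {x y : Realization G} (h : x ≠ y) : overlap x y < 1 := by
  refine lt_of_le_of_ne ?_ fun heq => h ?_
  · rw [← sum_coord x]
    exact Finset.sum_le_sum fun v _ => min_le_left _ _
  · have h1 : ∀ x y : Realization G, overlap x y = 1 → ∀ v, x.1 v ≤ y.1 v := by
      intro x y heq v
      have := (Finset.sum_eq_sum_iff_of_le (s := Finset.univ)
        (f := fun v => min (x.1 v) (y.1 v)) (g := x.1) fun v _ => min_le_left _ _).1
        (by rw [sum_coord]; exact heq) v (Finset.mem_univ v)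
      exact min_eq_left_iff.1 this
    exact realization_ext fun v =>
      le_antisymm (h1 x y heq v) (h1 y x ((overlap_comm y x).trans heq) v)

theorem one_sub_mul_overlap_pos {x y : Realization G} (h : x ≠ y) (t : I) :
    0 < 1 - t * overlap x y := by
  have h1 := overlap_lt_one h
  have h2 := mul_le_of_le_one_left (overlap_nonneg x y) t.2.2
  linarith

theorem shrink_num_nonneg (x y : Realization G) (t : I) (v : V) :
    0 ≤ x.1 v - t * min (x.1 v) (y.1 v) := by
  have h1 := mul_le_of_le_one_left (min_coord_nonneg x y v) t.2.2
  have h2 := min_le_left (x.1 v) (y.1 v)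
  linarith

/-- Moving the point `x` away from the point `y`. -/
noncomputable def shrink (t : I) (x y : Realization G) (h : x ≠ y) : Realization G :=
  -- The subtracted mass is t times the overlap, which explains the denominator. At t = 1 the
  -- smaller coordinate at each vertex becomes zero, which is the condition defining D.
  ⟨fun v => (x.1 v - t * min (x.1 v) (y.1 v)) / (1 - t * overlap x y),
    ⟨fun v => div_nonneg (shrink_num_nonneg x y t v) (one_sub_mul_overlap_pos h t).le, by
      rw [← Finset.sum_div, Finset.sum_sub_distrib, sum_coord, ← Finset.mul_sum]
      exact div_self (one_sub_mul_overlap_pos h t).ne'⟩, by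
    have hs : (Function.support fun v =>
        (x.1 v - t * min (x.1 v) (y.1 v)) / (1 - t * overlap x y)) ⊆ Function.support x.1 := by
      intro v hv hx
      refine hv ?_
      have : min (x.1 v) (y.1 v) = 0 := by rw [hx]; exact min_eq_left (coord_nonneg y v)
      change (x.1 v - t * min (x.1 v) (y.1 v)) / _ = 0
      rw [this, hx, mul_zero, sub_zero, zero_div]
    rcases x.2.2 with ⟨v, hv⟩ | ⟨u, v, huv, h⟩
    · exact Or.inl ⟨v, hs.trans hv⟩
    · exact Or.inr ⟨u, v, huv, hs.trans h⟩⟩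

theorem shrink_apply (t : I) (x y : Realization G) (h : x ≠ y) (v : V) :
    (shrink t x y h).1 v = (x.1 v - t * min (x.1 v) (y.1 v)) / (1 - t * overlap x y) := rfl

/-- Both points lose the same amount at each vertex and are divided by the same number, so the
difference of their coordinates is only rescaled. -/
theorem shrink_ne {t : I} {x y : Realization G} (h : x ≠ y) :
    shrink t x y h ≠ shrink t y x h.symm := by
  intro heq
  refine h (realization_ext fun v => ?_)
  have h1 := congrArg (fun z : Realization G => z.1 v) heq
  simp only [shrink_apply] at h1
  rw [overlap_comm y x, min_comm (y.1 v)] at h1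
  have h2 := (div_left_inj' (one_sub_mul_overlap_pos h t).ne').1 h1
  linarith

theorem shrink_zero {x y : Realization G} (h : x ≠ y) : shrink 0 x y h = x :=
  realization_ext fun v => by simp [shrink_apply]

theorem shrink_one_mem {x y : Realization G} (h : x ≠ y) :
    (shrink 1 x y h, shrink 1 y x h.symm) ∈ discConf G := by
  rw [mem_discConf]
  intro v
  simp only [shrink_apply, Set.Icc.coe_one, one_mul]
  rcases le_total (x.1 v) (y.1 v) with hv | hv
  · left; simp [min_eq_left hv]
  · right; simp [min_eq_left hv]

theorem shrink_of_mem {t : I} {x y : Realization G} (h : x ≠ y) (hD : (x, y) ∈ discConf G) :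
    shrink t x y h = x := by
  rw [mem_discConf] at hD
  have hm : ∀ v, min (x.1 v) (y.1 v) = 0 := fun v => by
    rcases hD v with hv | hv
    · rw [hv]; exact min_eq_left (coord_nonneg y v)
    · rw [hv]; exact min_eq_right (coord_nonneg x v)
  refine realization_ext fun v => ?_
  simp [shrink_apply, overlap, hm]

theorem discConf_symm {x y : Realization G} (h : (x, y) ∈ discConf G) : (y, x) ∈ discConf G := by
  rw [mem_discConf] at h ⊢
  exact fun v => (h v).symm

/-- At a vertex charged by both points the common mass is only scaled by 1 - t, so for t < 1 both
points still charge it. -/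
theorem shrink_not_mem {t : I} (ht : t < 1) {x y : Realization G} (h : x ≠ y)
    (hD : (x, y) ∉ discConf G) : (shrink t x y h, shrink t y x h.symm) ∉ discConf G := by
  rw [mem_discConf] at hD ⊢
  push Not at hD ⊢
  obtain ⟨v, hx, hy⟩ := hD
  have hx' := lt_of_le_of_ne (coord_nonneg x v) hx.symm
  have hy' := lt_of_le_of_ne (coord_nonneg y v) hy.symm
  have ht' : (t : ℝ) < 1 := ht
  have hm : 0 < min (x.1 v) (y.1 v) := lt_min hx' hy'
  have hlt : t * min (x.1 v) (y.1 v) < min (x.1 v) (y.1 v) := by nlinarith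
  refine ⟨v, ne_of_gt ?_, ne_of_gt ?_⟩
  · refine div_pos ?_ (one_sub_mul_overlap_pos h t)
    have := min_le_left (x.1 v) (y.1 v)
    linarith
  · refine div_pos ?_ (one_sub_mul_overlap_pos h.symm t)
    have := min_le_right (x.1 v) (y.1 v)
    rw [min_comm (y.1 v)]
    linarith

/-- The deformation of the configuration space. -/
noncomputable def defo (p : I × confSpace G) : Realization G × Realization G :=
  (shrink p.1 p.2.1.1 p.2.1.2 p.2.2, shrink p.1 p.2.1.2 p.2.1.1 (Ne.symm p.2.2))

theorem continuous_shrink {Z : Type} [TopologicalSpace Z] {t : Z → I} {x y : Z → Realization G}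
    (h : ∀ z, x z ≠ y z) (ht : Continuous t) (hx : Continuous x) (hy : Continuous y) :
    Continuous fun z => shrink (t z) (x z) (y z) (h z) := by
  have hx' := fun v => (continuous_coord (G := G) v).comp hx
  have hy' := fun v => (continuous_coord (G := G) v).comp hy
  have ht' : Continuous fun z => (t z : ℝ) := continuous_subtype_val.comp ht
  refine Continuous.subtype_mk (continuous_pi fun v => ?_) _
  refine Continuous.div ?_ ?_ fun z => (one_sub_mul_overlap_pos (h z) (t z)).ne'
  · exact (hx' v).sub (ht'.mul ((hx' v).min (hy' v)))
  · exact continuous_const.sub (ht'.mul (continuous_finsetSum _ fun v _ => (hx' v).min (hy' v)))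

theorem continuous_defo : Continuous (defo (G := G)) := by
  have h2 : Continuous fun p : I × confSpace G => p.2.1 :=
    continuous_subtype_val.comp continuous_snd
  exact (continuous_shrink _ continuous_fst (continuous_fst.comp h2)
    (continuous_snd.comp h2)).prodMk (continuous_shrink _ continuous_fst (continuous_snd.comp h2)
    (continuous_fst.comp h2))

theorem defo_mem_confSpace (p : I × confSpace G) : defo p ∈ confSpace G := shrink_ne p.2.2

theorem defo_zero (p : confSpace G) : defo (0, p) = p.1 :=
  Prod.ext (shrink_zero p.2) (shrink_zero (Ne.symm p.2))

theorem defo_one_mem (p : confSpace G) : defo (1, p) ∈ discConf G := shrink_one_mem p.2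

theorem defo_of_mem (t : I) (p : confSpace G) (hp : p.1 ∈ discConf G) : defo (t, p) = p.1 :=
  Prod.ext (shrink_of_mem p.2 hp) (shrink_of_mem (Ne.symm p.2) (discConf_symm hp))

/-- For t < 1 the complement of D in F is preserved; the general case follows by continuity, since
[0, 1) is dense in the unit interval and, F being open, closures in F are traces of closures in Γ ×
Γ. -/
theorem defo_mem_nbhd (t : I) (p : confSpace G) (hp : p.1 ∈ nbhd G) : defo (t, p) ∈ nbhd G := by
  have h1 : p ∈ closure (Subtype.val ⁻¹' (discConf G)ᶜ : Set (confSpace G)) := by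
    rw [← isOpen_confSpace.isOpenMap_subtype_val.preimage_closure_eq_closure_preimage
      continuous_subtype_val]
    exact hp
  have h2 : t ∈ closure (Set.Iio (1 : I)) := by
    rw [closure_Iio' ⟨0, by simp⟩]
    exact t.2.2
  have h3 : (t, p) ∈ closure (Set.Iio (1 : I) ×ˢ
      (Subtype.val ⁻¹' (discConf G)ᶜ : Set (confSpace G))) := by
    rw [closure_prod_eq]
    exact ⟨h2, h1⟩
  exact map_mem_closure continuous_defo h3 fun q hq => shrink_not_mem hq.1 q.2.2 hq.2

/-- The retraction of the configuration space onto the discrete configuration space. -/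
noncomputable def confRetr (G : SimpleGraph V) : C(confSpace G, discConf G) where
  toFun p := ⟨defo (1, p), defo_one_mem p⟩
  continuous_toFun := (continuous_defo.comp (by fun_prop)).subtype_mk _

theorem confRetr_homotopic : (ContinuousMap.id (confSpace G)).Homotopic
    ((ContinuousMap.inclusion discConf_subset_confSpace).comp (confRetr G)) :=
  ⟨{ toFun := fun p => ⟨defo p, defo_mem_confSpace p⟩
     continuous_toFun := continuous_defo.subtype_mk _
     map_zero_left := fun p => Subtype.ext (defo_zero p)
     map_one_left := fun _ => rfl }⟩

theorem confRetr_of_mem (x) (hx : x ∈ discConf G) :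
    confRetr G ⟨x, discConf_subset_confSpace hx⟩ = ⟨x, hx⟩ :=
  Subtype.ext (defo_of_mem _ _ hx)

theorem relAcyclic_conf : RelAcyclic (confSpace G) (discConf G) :=
  relAcyclic_of_retraction discConf_subset_confSpace (confRetr G) confRetr_of_mem
    confRetr_homotopic

theorem relAcyclic_nbhd : RelAcyclic (nbhd G ∩ confSpace G) (nbhd G ∩ discConf G) := by
  have hc : Continuous fun p : I × (nbhd G ∩ confSpace G : Set _) =>
      defo (p.1, (⟨p.2.1, p.2.2.2⟩ : confSpace G)) :=
    continuous_defo.comp (continuous_fst.prodMk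
      ((continuous_subtype_val.comp continuous_snd).subtype_mk _))
  refine relAcyclic_of_retraction (Set.inter_subset_inter_right _ discConf_subset_confSpace)
    ⟨fun p => ⟨defo (1, ⟨p.1, p.2.2⟩), defo_mem_nbhd _ _ p.2.1, defo_one_mem _⟩,
      (hc.comp (by fun_prop : Continuous fun p => ((1 : I), p))).subtype_mk _⟩
    (fun x hx => Subtype.ext (defo_of_mem _ _ hx.2)) ?_
  exact ⟨{ toFun := fun p => ⟨defo (p.1, ⟨p.2.1, p.2.2.2⟩), defo_mem_nbhd _ _ p.2.2.1,
             defo_mem_confSpace _⟩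
           continuous_toFun := hc.subtype_mk _
           map_zero_left := fun p => Subtype.ext (defo_zero _)
           map_one_left := fun _ => rfl }⟩

/-- The closed set D lies in the open set F, and the open complement of D lies in N, so the
interiors of N and F cover; both relative acyclicity conditions come from the deformation. -/
theorem excisionMap_bijective (G : SimpleGraph V) : Function.Bijective (excisionMap G) := by
  refine excision_bijective (F := confSpace G) ?_ discConf_subset_confSpace ?_ relAcyclic_conf
    relAcyclic_nbhd (nbhdInclusion G) rfl 0
  · rw [Set.eq_univ_iff_forall]
    intro p
    by_cases hp : p ∈ discConf G
    · right
      rw [isOpen_confSpace.interior_eq]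
      exact discConf_subset_confSpace hp
    · left
      exact mem_interior.2 ⟨(discConf G)ᶜ, subset_closure, isClosed_discConf.isOpen_compl, hp⟩
  · ext p
    exact ⟨fun h => h.2, fun h => ⟨p.2, h⟩⟩

end Deformation

/-! ### The homology sequence of the pair -/

section HomologySequence

variable {X : Type} [TopologicalSpace X]

/-- The homomorphism on homology induced by a continuous map. -/
noncomputable def hmap {X Y : Type} [TopologicalSpace X] [TopologicalSpace Y] (f : C(X, Y))
    (n : ℕ) : singHomology n X →+ singHomology n Y :=
  ((singHomologyFunctor n).map (TopCat.ofHom f)).hom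

theorem hmap_hcls {X Y : Type} [TopologicalSpace X] [TopologicalSpace Y] (f : C(X, Y)) {n : ℕ}
    (c : cyc (singChains X) n) :
    hmap f n (hcls (singChains X) n c) =
      hcls (singChains Y) n ⟨push f c.1, push_mem_cyc f c.2⟩ :=
  homologyMap_hcls (pushHom f) c

theorem hmap_comp {X Y Z : Type} [TopologicalSpace X] [TopologicalSpace Y] [TopologicalSpace Z]
    (g : C(Y, Z)) (f : C(X, Y)) {n : ℕ} (x : singHomology n X) :
    hmap g n (hmap f n x) = hmap (g.comp f) n x := by
  have h := (singHomologyFunctor n).map_comp (TopCat.ofHom f) (TopCat.ofHom g)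
  exact (congrArg (fun k => k.hom x) h).symm

theorem hmap_id {n : ℕ} (x : singHomology n X) : hmap (ContinuousMap.id X) n x = x :=
  congrArg (fun k => k.hom x) ((singHomologyFunctor n).map_id (TopCat.of X))

theorem hmap_homotopic {X Y : Type} [TopologicalSpace X] [TopologicalSpace Y] {f g : C(X, Y)}
    (h : f.Homotopic g) (n : ℕ) : hmap f n = hmap g n := by
  obtain ⟨H⟩ := h
  exact congrArg AddCommGrpCat.Hom.hom
    (TopCat.Homotopy.congr_homologyMap_singularChainComplexFunctor
      (f := TopCat.ofHom f) (g := TopCat.ofHom g) H (AddCommGrpCat.of ℤ) n)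

/-- The isomorphism on homology defined by a homotopy equivalence. -/
noncomputable def hmapEquiv {X Y : Type} [TopologicalSpace X] [TopologicalSpace Y] (f : C(X, Y))
    (g : C(Y, X)) (hgf : (g.comp f).Homotopic (ContinuousMap.id X))
    (hfg : (f.comp g).Homotopic (ContinuousMap.id Y)) (n : ℕ) :
    singHomology n X ≃+ singHomology n Y where
  toFun := hmap f n
  invFun := hmap g n
  left_inv x := by rw [hmap_comp, hmap_homotopic hgf, hmap_id]
  right_inv x := by rw [hmap_comp, hmap_homotopic hfg, hmap_id]
  map_add' := map_add _

/-- The map `j_*` to relative homology. -/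
noncomputable def toRel (A : Set X) (n : ℕ) : singHomology n X →+ (relCh A).homology n :=
  (toRelHomology n (TopPair.ofSubset (X := TopCat.of X) A)).hom

/-- The boundary map of the homology sequence of a pair. -/
noncomputable def relBd (A : Set X) (n : ℕ) : (relCh A).homology (n + 1) →+ singHomology n A :=
  ((relSC_shortExact A).δ (n + 1) n rfl).hom

theorem exact_apply_iff {S : ShortComplex AddCommGrpCat.{0}} (hS : S.Exact) (x : S.X₂) :
    S.g.hom x = 0 ↔ ∃ y, S.f.hom y = x := by
  constructor
  · exact (ShortComplex.ab_exact_iff _).1 hS x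
  · rintro ⟨y, rfl⟩
    exact congrArg (fun g => g.hom y) S.zero

theorem toRel_eq_zero_iff {A : Set X} {n : ℕ} (x : singHomology n X) :
    toRel A n x = 0 ↔ ∃ y, hmap (incl A) n y = x :=
  exact_apply_iff ((relSC_shortExact A).homology_exact₂ n) x

theorem relBd_eq_zero_iff {A : Set X} {n : ℕ} (x : (relCh A).homology (n + 1)) :
    relBd A n x = 0 ↔ ∃ y, toRel A (n + 1) y = x :=
  exact_apply_iff ((relSC_shortExact A).homology_exact₃ (n + 1) n rfl) x

theorem hmap_incl_eq_zero_iff {A : Set X} {n : ℕ} (x : singHomology n A) :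
    hmap (incl A) n x = 0 ↔ ∃ y, relBd A n y = x :=
  exact_apply_iff ((relSC_shortExact A).homology_exact₁ (n + 1) n rfl) x

end HomologySequence

/-! ### Reduction of the theorem to injectivity and surjectivity in the homology sequence -/

section Reduction

/-- A surjection onto a free group has a section s, and a ↦ a - s (f a) projects onto the kernel. -/
theorem nonempty_addEquiv_ker_prod {A B : Type} [AddCommGroup A] [AddCommGroup B]
    [Module.Free ℤ B] (f : A →+ B) (hf : Function.Surjective f) :
    Nonempty (A ≃+ f.ker × B) := by
  obtain ⟨s, hs⟩ := Module.projective_lifting_property f.toIntLinearMap LinearMap.id hf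
  have hs' : ∀ b, f (s b) = b := fun b => congrArg (fun g => g b) hs
  refine ⟨{ toFun := fun a => (⟨a - s (f a), ?_⟩, f a)
            invFun := fun p => p.1.1 + s p.2
            left_inv := fun a => by simp
            right_inv := ?_
            map_add' := ?_ }⟩
  · rw [AddMonoidHom.mem_ker, map_sub, hs', sub_self]
  · rintro ⟨⟨k, hk⟩, b⟩
    have hk' : f k = 0 := hk
    refine Prod.ext (Subtype.ext ?_) ?_
    · simp [hk', hs']
    · simp [hk', hs']
  · intro a a'
    refine Prod.ext (Subtype.ext ?_) (map_add f a a')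
    simp only [map_add, Prod.fst_add, AddSubgroup.coe_add]
    abel

variable {V : Type} [Fintype V] (G : SimpleGraph V)

/-- The discrete configuration space has the homology of the configuration space. -/
noncomputable def confEquiv (n : ℕ) : singHomology n (confSpace G) ≃+ singHomology n (discConf G) :=
  hmapEquiv (confRetr G) (ContinuousMap.inclusion discConf_subset_confSpace)
    confRetr_homotopic.symm
    (by
      have : (confRetr G).comp (ContinuousMap.inclusion discConf_subset_confSpace) =
          ContinuousMap.id _ := ContinuousMap.ext fun x => confRetr_of_mem x.1 x.2
      rw [this]) n

theorem intersectionForm_eq_zero_iff (hexc : Function.Bijective (excisionMap G)) (x) :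
    intersectionForm G hexc x = 0 ↔
      toRel (discConf G) 2 (crossProduct (Realization G) (Realization G) x) = 0 :=
  (AddEquiv.ofBijective (excisionMap G) hexc).symm.map_eq_zero_iff

theorem excisionMap_intersectionForm (hexc : Function.Bijective (excisionMap G)) (x) :
    excisionMap G (intersectionForm G hexc x) =
      toRel (discConf G) 2 (crossProduct (Realization G) (Realization G) x) :=
  (AddEquiv.ofBijective (excisionMap G) hexc).apply_symm_apply _

/-- Injectivity in degree two makes H_2(D) the kernel of j_*, which the cross product turns into Ker
I. Surjectivity in degree one makes H_1(D) an extension of a free group by the cokernel of j_*,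
which excision turns into coker I. -/
theorem homology_conf_of_exact (hexc : Function.Bijective (excisionMap G))
    (hcross : Function.Bijective (crossProduct (Realization G) (Realization G)))
    (hinj : Function.Injective (hmap (incl (discConf G)) 2))
    (hsurj : Function.Surjective (hmap (incl (discConf G)) 1))
    (e : singHomology 1 (Realization G × Realization G) ≃+
      singHomology 1 (Realization G) × singHomology 1 (Realization G))
    [Module.Free ℤ (singHomology 1 (Realization G))] :
    Nonempty (singHomology 2 (confSpace G) ≃+ (intersectionForm G hexc).ker) ∧
    Nonempty (singHomology 1 (confSpace G) ≃+
        (nbhdHomology 2 G ⧸ (intersectionForm G hexc).range) ×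
          singHomology 1 (Realization G) × singHomology 1 (Realization G)) := by
  constructor
  · let c := AddEquiv.ofBijective _ hcross
    let i : singHomology 2 (discConf G) →+
        TensorProduct ℤ (singHomology 1 (Realization G)) (singHomology 1 (Realization G)) :=
      c.symm.toAddMonoidHom.comp (hmap (incl (discConf G)) 2)
    have hi : Function.Injective i := c.symm.injective.comp hinj
    have hr : i.range = (intersectionForm G hexc).ker := by
      ext x
      rw [AddMonoidHom.mem_ker, intersectionForm_eq_zero_iff, toRel_eq_zero_iff,
        AddMonoidHom.mem_range]
      exact exists_congr fun y => c.symm_apply_eq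
    exact ⟨(confEquiv G 2).trans ((AddMonoidHom.ofInjective hi).trans
      (AddEquiv.addSubgroupCongr hr))⟩
  · let f : singHomology 1 (discConf G) →+
        singHomology 1 (Realization G) × singHomology 1 (Realization G) :=
      e.toAddMonoidHom.comp (hmap (incl (discConf G)) 1)
    obtain ⟨s⟩ := nonempty_addEquiv_ker_prod f (e.surjective.comp hsurj)
    have hker : ∀ x, f x = 0 ↔ ∃ y, relBd (discConf G) 1 y = x := fun x => by
      rw [← hmap_incl_eq_zero_iff]
      exact e.map_eq_zero_iff
    -- The boundary map of the pair read through excision: exactness at H_1(D) makes it onto the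
    -- kernel of H_1(D) → H_1(Γ × Γ), and exactness at the relative group makes its kernel the image
    -- of I.
    let φ : nbhdHomology 2 G →+ f.ker :=
      ((relBd (discConf G) 1).comp (excisionMap G)).codRestrict f.ker
        fun x => (hker _).2 ⟨_, rfl⟩
    have hφ : Function.Surjective φ := by
      rintro ⟨x, hx⟩
      obtain ⟨y, hy⟩ := (hker x).1 hx
      obtain ⟨z, rfl⟩ := hexc.2 y
      exact ⟨z, Subtype.ext hy⟩
    have hφk : φ.ker = (intersectionForm G hexc).range := by
      ext x
      have h1 : φ x = 0 ↔ ∃ y, toRel (discConf G) 2 y = excisionMap G x :=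
        Subtype.ext_iff.trans (relBd_eq_zero_iff _)
      rw [AddMonoidHom.mem_ker, h1, AddMonoidHom.mem_range]
      constructor
      · rintro ⟨y, hy⟩
        obtain ⟨z, rfl⟩ := hcross.2 y
        refine ⟨z, hexc.1 ?_⟩
        rw [excisionMap_intersectionForm]
        exact hy
      · rintro ⟨z, rfl⟩
        exact ⟨_, (excisionMap_intersectionForm G hexc z).symm⟩
    exact ⟨(confEquiv G 1).trans (s.trans (((QuotientAddGroup.quotientAddEquivOfEq hφk.symm).trans
      (QuotientAddGroup.quotientKerEquivOfSurjective φ hφ)).symm.prodCongr (AddEquiv.refl _)))⟩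

end Reduction

/-! ### Zero-dimensional chains -/

section ZeroChains

variable {X : Type} [TopologicalSpace X]

/-- A point as a singular simplex of dimension zero. -/
noncomputable def ptS (x : X) : singSet X _⦋0⦌ := mkS (ContinuousMap.const _ x)

theorem ev_ptS (x : X) (t) : ev (ptS x) t = x := rfl

theorem eq_ptS (a : singSet X _⦋0⦌) : a = ptS (ev a (vtx 0)) :=
  ev_ext fun t => by rw [ev_ptS, Subsingleton.elim t (vtx 0)]

theorem exists_dd_ptS_sub {S : Set X} {x y : X} (h : JoinedIn S x y) :
    ∃ e ∈ chainsIn S 1, dd e = simplexChain (ptS x) - simplexChain (ptS y) := by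
  -- The boundary of a path is its end minus its start, so the path must run from y to x.
  obtain ⟨γ, hγ⟩ := h.symm
  let a : singSet X _⦋1⦌ := mkS ⟨fun t => γ (stdSimplexHomeomorphUnitInterval t), by fun_prop⟩
  have hev : ∀ t, ev a t = γ (stdSimplexHomeomorphUnitInterval t) := fun t => rfl
  have hface : ∀ i : Fin 2, (singSet X).δ i a = ptS (ev a (vtx (i.succAbove 0))) := fun i => by
    rw [eq_ptS ((singSet X).δ i a), ev_δ]
    congr 2
    exact stdSimplex.map_vertex _ _
  refine ⟨simplexChain a, simplexChain_mem fun t => hγ _, ?_⟩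
  rw [dd_simplexChain, Fin.sum_univ_two, hface, hface]
  have h0 : ev a (vtx 0) = y := by
    rw [hev, vtx, stdSimplexHomeomorphUnitInterval_zero, γ.source]
  have h1 : ev a (vtx 1) = x := by
    rw [hev, vtx, stdSimplexHomeomorphUnitInterval_one, γ.target]
  simp only [Fin.succAbove_zero, Fin.succ_zero_eq_one, h1]
  rw [show (Fin.succAbove (1 : Fin 2) 0) = 0 from rfl, h0]
  simp [sub_eq_add_neg]

theorem exists_dd_of_aug_eq_zero {S : Set X} {x₀ : X} (hS : ∀ x ∈ S, JoinedIn S x x₀)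
    {c : (singChains X).X 0} (hc : c ∈ chainsIn S 0) (haug : aug c = 0) :
    ∃ e ∈ chainsIn S 1, dd e = c := by
  have key : c - aug c • simplexChain (ptS x₀) ∈ (chainsIn S 1).map dd :=
    chainsIn_le_comap (AddMonoidHom.id _ - ((zmultiplesHom _) (simplexChain (ptS x₀))).comp aug)
      ((chainsIn S 1).map dd) (fun a ha => by
        obtain ⟨e, he, hde⟩ := exists_dd_ptS_sub (hS (ev a (vtx 0)) (ha _))
        refine ⟨e, he, ?_⟩
        simp only [AddMonoidHom.sub_apply, AddMonoidHom.id_apply, AddMonoidHom.comp_apply,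
          aug_simplexChain, zmultiplesHom_apply, one_smul]
        rw [hde, ← eq_ptS]) hc
  rw [haug, zero_smul, sub_zero] at key
  exact key

end ZeroChains

/-! ### Spaces over the complete graph -/

section Fibred

variable {V : Type} [Fintype V] {E Y : Type} [TopologicalSpace E] [TopologicalSpace Y]

/-- The realization of the complete graph on a vertex set. -/
abbrev Cpx (V : Type) [Fintype V] : Type := Realization (⊤ : SimpleGraph V)

/-- This is the one-dimensionality of the graph, used to separate open edges and half edges. -/
theorem Cpx.three (x : Cpx V) {a b c : V} (hab : a ≠ b) (hac : a ≠ c) (hbc : b ≠ c)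
    (ha : 0 < x.1 a) (hb : 0 < x.1 b) (hc : 0 < x.1 c) : False := by
  rcases x.2.2 with ⟨v, hv⟩ | ⟨u, v, -, hv⟩
  · have h1 := hv (show a ∈ Function.support x.1 from ha.ne')
    have h2 := hv (show b ∈ Function.support x.1 from hb.ne')
    exact hab (h1.trans h2.symm)
  · have h1 := hv (show a ∈ Function.support x.1 from ha.ne')
    have h2 := hv (show b ∈ Function.support x.1 from hb.ne')
    have h3 := hv (show c ∈ Function.support x.1 from hc.ne')
    simp only [Set.mem_insert_iff, Set.mem_singleton_iff] at h1 h2 h3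
    grind

theorem add_le_one {G : SimpleGraph V} (x : Realization G) {a b : V} (hab : a ≠ b) :
    x.1 a + x.1 b ≤ 1 := by
  classical
  rw [← sum_coord x, ← Finset.sum_pair hab]
  exact Finset.sum_le_sum_of_subset_of_nonneg (Finset.subset_univ _)
    fun v _ _ => coord_nonneg x v

/-- The points on a segment issued from `x`, towards a point of the support of `x`. -/
noncomputable def lerp (t : I) (x x' : Cpx V)
    (h : Function.support x'.1 ⊆ Function.support x.1) : Cpx V :=
  ⟨fun v => (1 - t) * x.1 v + t * x'.1 v,
    ⟨fun v => add_nonneg (mul_nonneg (sub_nonneg.2 t.2.2) (coord_nonneg x v))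
      (mul_nonneg t.2.1 (coord_nonneg x' v)), by
      rw [Finset.sum_add_distrib, ← Finset.mul_sum, ← Finset.mul_sum, sum_coord, sum_coord]
      ring⟩, by
    have hs : (Function.support fun v => (1 - t) * x.1 v + t * x'.1 v) ⊆
        Function.support x.1 := by
      intro v hv hx
      have hx' : x'.1 v = 0 := by
        by_contra h'
        exact h h' hx
      refine hv ?_
      change (1 - (t : ℝ)) * x.1 v + t * x'.1 v = 0
      rw [hx, hx', mul_zero, mul_zero, add_zero]
    rcases x.2.2 with ⟨v, hv⟩ | ⟨u, v, huv, h⟩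
    · exact Or.inl ⟨v, hs.trans hv⟩
    · exact Or.inr ⟨u, v, huv, hs.trans h⟩⟩

theorem lerp_apply (t : I) (x x' : Cpx V) (h) (v : V) :
    (lerp t x x' h).1 v = (1 - t) * x.1 v + t * x'.1 v := rfl

theorem support_lerp (t : I) (x x' : Cpx V) (h) :
    Function.support (lerp t x x' h).1 ⊆ Function.support x.1 := by
  intro v hv hx
  have hx' : x'.1 v = 0 := by
    by_contra h'
    exact h h' hx
  refine hv ?_
  rw [lerp_apply, hx, hx', mul_zero, mul_zero, add_zero]

/-- A space `E` over the complete graph and over `Y`, such that `E` is a subspace of the product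
which contains with a point all points with the same second component and smaller support. -/
structure Fibred (p : C(E, Cpx V)) (q : C(E, Y)) : Prop where
  inducing : Topology.IsInducing fun e => (p e, q e)
  exists_of_support : ∀ e (x' : Cpx V), Function.support x'.1 ⊆ Function.support (p e).1 →
    ∃ e', p e' = x' ∧ q e' = q e

variable {p : C(E, Cpx V)} {q : C(E, Y)}

/-- The fibre over a point of the graph, as a subset of `Y`. -/
def fibre (p : C(E, Cpx V)) (q : C(E, Y)) (x' : Cpx V) : Set Y := {y | ∃ e, p e = x' ∧ q e = y}

/-- The section over the fibre of `x'`. -/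
theorem Fibred.exists_section (h : Fibred p q) (x' : Cpx V) :
    ∃ i : C(fibre p q x', E), ∀ y, p (i y) = x' ∧ q (i y) = y := by
  choose f hf using fun y : fibre p q x' => y.2
  refine ⟨⟨f, h.inducing.continuous_iff.2 ?_⟩, hf⟩
  have : ((fun e => (p e, q e)) ∘ f) = fun y : fibre p q x' => (x', (y : Y)) :=
    funext fun y => Prod.ext (hf y).1 (hf y).2
  rw [this]
  fun_prop

/-- A subset of `E` which can be contracted onto the fibre over `x'`. -/
structure Contractible (p : C(E, Cpx V)) (S : Set E) (x' : Cpx V) : Prop where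
  support_subset : ∀ e ∈ S, Function.support x'.1 ⊆ Function.support (p e).1
  mem : ∀ e, p e = x' → e ∈ S
  lerp_mem : ∀ e ∈ S, ∀ (t : I) (h) e', p e' = lerp t (p e) x' h → e' ∈ S

theorem Fibred.mapsTo_fibre (h : Fibred p q) {S : Set E} {x' : Cpx V}
    (hS : Contractible p S x') : Set.MapsTo q S (fibre p q x') := fun e he =>
  h.exists_of_support e x' (hS.support_subset e he)

/-- Slide p(e) along the segment to x' and keep q(e) fixed. The segment stays in the closed simplex
of p(e), so its points lift to E, and continuity of the lift can be tested after the inducing map to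
the product. -/
theorem Fibred.exists_homotopy (h : Fibred p q) {S : Set E} {x' : Cpx V}
    (hS : Contractible p S x') (i : C(fibre p q x', E)) (hi : ∀ y, p (i y) = x' ∧ q (i y) = y) :
    ∃ ρ : C(S, S), (ContinuousMap.id S).Homotopic ρ ∧
      ∀ e (he : q e.1 ∈ fibre p q x'), (ρ e : E) = i ⟨q e.1, he⟩ := by
  have hex : ∀ a : I × S, ∃ e', p e' = lerp a.1 (p a.2.1) x' (hS.support_subset _ a.2.2) ∧
      q e' = q a.2.1 := fun a => h.exists_of_support _ _ (support_lerp _ _ _ _)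
  -- An inducing map need not be injective, so lifts are not unique; they are prescribed at both end
  -- times so that the homotopy really goes from the identity to the section i.
  have hex' : ∀ a : I × S, ∃ e', p e' = lerp a.1 (p a.2.1) x' (hS.support_subset _ a.2.2) ∧
      q e' = q a.2.1 ∧ (a.1 = 0 → e' = a.2.1) ∧
      (a.1 = 1 → e' = i ⟨q a.2.1, h.mapsTo_fibre hS a.2.2⟩) := by
    rintro ⟨t, e, he⟩
    by_cases h0 : t = 0
    · subst h0
      exact ⟨e, realization_ext fun v => by simp [lerp_apply], rfl, fun _ => rfl,
        fun h => absurd h zero_ne_one⟩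
    by_cases h1 : t = 1
    · subst h1
      refine ⟨i ⟨q e, h.mapsTo_fibre hS he⟩, ?_, (hi _).2, fun h => absurd h one_ne_zero,
        fun _ => rfl⟩
      rw [(hi _).1]
      exact realization_ext fun v => by simp [lerp_apply]
    · obtain ⟨e', he'⟩ := hex ⟨t, e, he⟩
      exact ⟨e', he'.1, he'.2, fun h => absurd h h0, fun h => absurd h h1⟩
  choose f hf using hex'
  have hfS : ∀ a, f a ∈ S := fun a => hS.lerp_mem _ a.2.2 _ _ _ (hf a).1
  have hfc : Continuous f := by
    rw [h.inducing.continuous_iff]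
    have hq : Continuous fun a : I × S => q a.2.1 := by fun_prop
    have hp : Continuous fun a : I × S => p (f a) := by
      simp only [fun a => (hf a).1]
      refine Continuous.subtype_mk (continuous_pi fun v => ?_) _
      have h1 : Continuous fun a : I × S => (p a.2.1).1 v :=
        (continuous_coord v).comp (by fun_prop)
      have h2 : Continuous fun a : I × S => (a.1 : ℝ) := by fun_prop
      exact ((continuous_const.sub h2).mul h1).add (h2.mul continuous_const)
    refine (hp.prodMk hq).congr fun a => ?_
    exact Prod.ext rfl (hf a).2.1.symm
  let g : C(I × S, S) := ⟨fun a => ⟨f a, hfS a⟩, hfc.subtype_mk _⟩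
  refine ⟨⟨fun e => g (1, e), by fun_prop⟩, ⟨{
    toFun := g
    continuous_toFun := g.continuous
    map_zero_left := fun e => Subtype.ext ((hf (0, e)).2.2.1 rfl)
    map_one_left := fun e => rfl }⟩, fun e he => (hf (1, e)).2.2.2 rfl⟩

/-- A cycle in a contractible subset is homologous to its projection to the fibre. -/
theorem Fibred.exists_dd_eq_sub (h : Fibred p q) {S : Set E} {x' : Cpx V}
    (hS : Contractible p S x') (i : C(fibre p q x', E)) (hi : ∀ y, p (i y) = x' ∧ q (i y) = y)
    {n : ℕ} {c : (singChains E).X n} (hc : c ∈ chainsIn S n) (hcyc : c ∈ cyc (singChains E) n) :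
    ∃ f ∈ chainsIn S (n + 1), dd f = c - push i (corestr (fibre p q x') (push q c)) := by
  obtain ⟨ρ, hρ, hρi⟩ := h.exists_homotopy hS i hi
  obtain ⟨c', rfl⟩ := mem_chainsIn_iff.1 hc
  obtain ⟨e, he⟩ := exists_dd_eq_push_sub_push hρ (mem_cyc_of_push_incl hcyc)
  refine ⟨push (incl S) e, push_incl_mem e, ?_⟩
  rw [← push_dd, he, push_id, map_sub, push_push]
  congr 1
  let q' : C(S, fibre p q x') := ⟨fun e => ⟨q e.1, h.mapsTo_fibre hS e.2⟩, by fun_prop⟩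
  have h1 : push q (push (incl S) c') = push (incl (fibre p q x')) (push q' c') := by
    rw [push_push, push_push]
    rfl
  rw [h1, corestr_push, push_push]
  exact congrArg (fun g : C(S, E) => push g c') (ContinuousMap.ext fun e => hρi e _)

/-- A cycle in a contractible subset bounds if its projection to the fibre bounds. -/
theorem Fibred.exists_dd_eq (h : Fibred p q) {S : Set E} {x' : Cpx V}
    (hS : Contractible p S x') {n : ℕ} {c : (singChains E).X n} (hc : c ∈ chainsIn S n)
    (hcyc : c ∈ cyc (singChains E) n)
    (hb : ∃ y ∈ chainsIn (fibre p q x') (n + 1), dd y = push q c) :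
    ∃ f ∈ chainsIn S (n + 1), dd f = c := by
  obtain ⟨i, hi⟩ := h.exists_section x'
  obtain ⟨f, hf, hdf⟩ := h.exists_dd_eq_sub hS i hi hc hcyc
  obtain ⟨y, hy, hdy⟩ := hb
  obtain ⟨y', rfl⟩ := mem_chainsIn_iff.1 hy
  refine ⟨f + push i y', add_mem hf (push_mem_chainsIn (A := Set.univ) i
    (fun y _ => hS.mem _ (hi y).1) (chainsIn_univ _ _)), ?_⟩
  rw [map_add, hdf, ← push_dd i, ← hdy, ← push_dd, corestr_push]
  abel

end Fibred

/-! ### The cover by stars and edges -/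

section Cover

variable {V : Type} [Fintype V] {E Y : Type} [TopologicalSpace E] [TopologicalSpace Y]

/-- The part of `E` over the open star of radius `1 / 2` of a vertex. -/
def star (p : C(E, Cpx V)) (v : V) : Set E := {e | 1 / 2 < (p e).1 v}

/-- The part of `E` over an open edge; it is empty unless `s` has two elements. -/
def edge (p : C(E, Cpx V)) (s : Finset V) : Set E := {e | s.card = 2 ∧ ∀ v ∈ s, 0 < (p e).1 v}

/-- The part of `E` over the half of the edge `{v, w}` close to `v`. -/
def half (p : C(E, Cpx V)) (d : V × V) : Set E :=
  {e | d.1 ≠ d.2 ∧ 1 / 2 < (p e).1 d.1 ∧ 0 < (p e).1 d.2}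

variable (p : C(E, Cpx V)) (q : C(E, Y))

theorem continuous_p_coord (v : V) : Continuous fun e => (p e).1 v :=
  (continuous_coord v).comp p.continuous

theorem isOpen_star (v : V) : IsOpen (star p v) :=
  isOpen_lt continuous_const (continuous_p_coord p v)

theorem isOpen_edge (s : Finset V) : IsOpen (edge p s) := by
  have : edge p s = {e | s.card = 2} ∩ ⋂ v ∈ s, {e | 0 < (p e).1 v} := by
    ext e
    simp [edge]
  rw [this]
  exact isOpen_const.inter (isOpen_biInter_finset fun v _ =>
    isOpen_lt continuous_const (continuous_p_coord p v))

theorem isOpen_half (d : V × V) : IsOpen (half p d) :=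
  isOpen_const.and ((isOpen_lt continuous_const (continuous_p_coord p _)).and
    (isOpen_lt continuous_const (continuous_p_coord p _)))

theorem star_disjoint : Pairwise fun v w => Disjoint (star p v) (star p w) := by
  intro v w hvw
  refine Set.disjoint_left.2 fun e hv hw => ?_
  have h1 := add_le_one (p e) hvw
  have hv : 1 / 2 < (p e).1 v := hv
  have hw : 1 / 2 < (p e).1 w := hw
  linarith

theorem edge_disjoint : Pairwise fun s s' => Disjoint (edge p s) (edge p s') := by
  classical
  intro s s' hss
  refine Set.disjoint_left.2 fun e hs hs' => ?_
  obtain ⟨a, b, hab, rfl⟩ := Finset.card_eq_two.1 hs.1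
  obtain ⟨c, hc, hcs⟩ : ∃ c ∈ s', c ∉ ({a, b} : Finset V) := by
    by_contra! h
    exact hss (Finset.eq_of_subset_of_card_le h (by rw [hs.1, hs'.1])).symm
  simp only [Finset.mem_insert, Finset.mem_singleton, not_or] at hcs
  exact (p e).three hab (Ne.symm hcs.1) (Ne.symm hcs.2) (hs.2 a (by simp)) (hs.2 b (by simp))
    (hs'.2 c hc)

theorem half_disjoint : Pairwise fun d d' => Disjoint (half p d) (half p d') := by
  rintro ⟨v, w⟩ ⟨v', w'⟩ hne
  refine Set.disjoint_left.2 ?_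
  rintro e ⟨h1, h2, h3⟩ ⟨h1', h2', h3'⟩
  have hv : v = v' := by
    by_contra hvv
    exact Set.disjoint_left.1 (star_disjoint p hvv) h2 h2'
  subst hv
  have hw : w ≠ w' := fun h => hne (by rw [h])
  exact (p e).three h1 h1' hw (by simp only at h2; linarith) h3 h3'

theorem half_subset_star (d : V × V) : half p d ⊆ star p d.1 := fun _ h => h.2.1

open Classical in
theorem half_subset_edge (d : V × V) : half p d ⊆ edge p {d.1, d.2} := by
  rintro e ⟨h1, h2, h3⟩
  refine ⟨Finset.card_pair h1, ?_⟩
  simp only [Finset.mem_insert, Finset.mem_singleton, forall_eq_or_imp, forall_eq]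
  exact ⟨by linarith, h3⟩

/-- A point over an open edge and in the star of v has v as an endpoint of that edge, since
otherwise three coordinates would be positive. This is the overlap in the Mayer–Vietoris argument.
-/
theorem iUnion_star_inter_iUnion_edge :
    (⋃ v, star p v) ∩ (⋃ s, edge p s) = ⋃ d, half p d := by
  classical
  ext e
  constructor
  · rintro ⟨hv, hs⟩
    obtain ⟨v, hv⟩ := Set.mem_iUnion.1 hv
    obtain ⟨s, hs⟩ := Set.mem_iUnion.1 hs
    have hv : 1 / 2 < (p e).1 v := hv
    obtain ⟨a, b, hab, rfl⟩ := Finset.card_eq_two.1 hs.1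
    have ha := hs.2 a (by simp)
    have hb := hs.2 b (by simp)
    have hvab : v = a ∨ v = b := by
      by_contra! h
      exact (p e).three h.1 h.2 hab (by linarith) ha hb
    rcases hvab with rfl | rfl
    · exact Set.mem_iUnion.2 ⟨(v, b), hab, hv, hb⟩
    · exact Set.mem_iUnion.2 ⟨(v, a), hab.symm, hv, ha⟩
  · intro h
    obtain ⟨d, hd⟩ := Set.mem_iUnion.1 h
    exact ⟨Set.mem_iUnion.2 ⟨_, half_subset_star p d hd⟩,
      Set.mem_iUnion.2 ⟨_, half_subset_edge p d hd⟩⟩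

theorem cover_star_edge :
    interior (⋃ v, star p v) ∪ interior (⋃ s, edge p s) = Set.univ := by
  classical
  rw [(isOpen_iUnion (isOpen_star p)).interior_eq, (isOpen_iUnion (isOpen_edge p)).interior_eq,
    Set.eq_univ_iff_forall]
  intro e
  have h1 := sum_coord (p e)
  rcases (p e).2.2 with ⟨v, hv⟩ | ⟨u, v, huv, hs⟩
  · left
    refine Set.mem_iUnion.2 ⟨v, ?_⟩
    rw [Finset.sum_eq_single v (fun w _ hw => by
      by_contra h
      exact hw (hv h)) (by simp)] at h1
    change 1 / 2 < (p e).1 v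
    rw [h1]
    norm_num
  · by_cases hpos : 0 < (p e).1 u ∧ 0 < (p e).1 v
    · right
      refine Set.mem_iUnion.2 ⟨{u, v}, Finset.card_pair huv, ?_⟩
      simpa using hpos
    · left
      have huv' : u ≠ v := huv
      have h2 : (p e).1 u + (p e).1 v = 1 := by
        rw [← Finset.sum_pair huv', ← h1]
        refine Finset.sum_subset (Finset.subset_univ _) fun w _ hw => ?_
        by_contra h
        exact hw (by simpa using hs h)
      have hu0 := coord_nonneg (p e) u
      have hv0 := coord_nonneg (p e) v
      rcases not_and_or.1 hpos with h | h
      · refine Set.mem_iUnion.2 ⟨v, ?_⟩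
        change 1 / 2 < (p e).1 v
        linarith
      · refine Set.mem_iUnion.2 ⟨u, ?_⟩
        change 1 / 2 < (p e).1 u
        linarith

/-- The half edges inside the star of v are those issued from v; this is what yields conservation of
flow at v. -/
theorem sum_restr_half_star {n : ℕ} {c : (singChains E).X n} (hc : c ∈ chainsIn (⋃ d, half p d) n)
    (v : V) : ∑ w, restr (half p (v, w)) c = restr (star p v) c := by
  have := eq_on_chainsIn (∑ w, restr (half p (v, w))) (restr (n := n) (star p v)) (fun a ha => by
    obtain ⟨⟨v', w'⟩, hd⟩ := exists_inSet_of_iUnion (isOpen_half p) (half_disjoint p) ha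
    have hst : InSet (star p v') a := fun t => half_subset_star p _ (hd t)
    rw [AddMonoidHom.finsetSum_apply]
    by_cases hv : v = v'
    · subst hv
      rw [Finset.sum_eq_single w', restr_of_inSet hd, restr_of_inSet hst]
      · intro w _ hw
        exact restr_of_not_inSet (not_inSet_of_disjoint
          (half_disjoint p (by simpa using hw.symm)) hd)
      · simp
    · rw [restr_of_not_inSet (not_inSet_of_disjoint (star_disjoint p (Ne.symm hv)) hst)]
      exact Finset.sum_eq_zero fun w _ => restr_of_not_inSet (not_inSet_of_disjoint
        (half_disjoint p (by simpa using fun h => absurd h.symm hv)) hd)) hc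
  rw [← this, AddMonoidHom.finsetSum_apply]

open Classical in
-- Only the two halves of an edge lie over it; this is what yields antisymmetry of the flow.
theorem add_restr_half_edge {n : ℕ} {c : (singChains E).X n} (hc : c ∈ chainsIn (⋃ d, half p d) n)
    {v w : V} (hvw : v ≠ w) :
    restr (half p (v, w)) c + restr (half p (w, v)) c = restr (edge p {v, w}) c :=
  eq_on_chainsIn (restr (half p (v, w)) + restr (half p (w, v))) (restr (n := n) (edge p {v, w}))
    (fun a ha => by
    obtain ⟨⟨v', w'⟩, hd⟩ := exists_inSet_of_iUnion (isOpen_half p) (half_disjoint p) ha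
    have hst : InSet (edge p {v', w'}) a := fun t => half_subset_edge p _ (hd t)
    rw [AddMonoidHom.add_apply]
    by_cases h1 : (v', w') = (v, w)
    · obtain ⟨rfl, rfl⟩ := Prod.mk.inj h1
      rw [restr_of_inSet hd, restr_of_inSet hst, restr_of_not_inSet, add_zero]
      exact not_inSet_of_disjoint (half_disjoint p fun h => hvw (Prod.mk.inj h).1) hd
    by_cases h2 : (v', w') = (w, v)
    · obtain ⟨rfl, rfl⟩ := Prod.mk.inj h2
      rw [Finset.pair_comm] at hst
      rw [restr_of_inSet hd, restr_of_inSet hst, restr_of_not_inSet, zero_add]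
      exact not_inSet_of_disjoint (half_disjoint p h1) hd
    rw [restr_of_not_inSet (not_inSet_of_disjoint (half_disjoint p h1) hd),
      restr_of_not_inSet (not_inSet_of_disjoint (half_disjoint p h2) hd), add_zero,
      restr_of_not_inSet]
    refine not_inSet_of_disjoint (edge_disjoint p fun h => ?_) hst
    have hv : v' ∈ ({v, w} : Finset V) := by rw [← h]; simp
    have hw : w' ∈ ({v, w} : Finset V) := by rw [← h]; simp
    have hne : v' ≠ w' := (hd (Classical.arbitrary _)).1
    simp only [Finset.mem_insert, Finset.mem_singleton] at hv hw
    grind) hc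

end Cover

/-! ### Flows -/

section Flow

/-- The homology class of a singular cycle. -/
noncomputable def scls {X : Type} [TopologicalSpace X] {n : ℕ} :
    cyc (singChains X) n →+ singHomology n X :=
  hcls (singChains X) n

theorem scls_surjective {X : Type} [TopologicalSpace X] {n : ℕ} :
    Function.Surjective (scls (X := X) (n := n)) :=
  hcls_surjective n

theorem scls_eq_zero_iff {X : Type} [TopologicalSpace X] {n : ℕ} (c : cyc (singChains X) n) :
    scls c = 0 ↔ ∃ e, dd e = c.1 :=
  hcls_eq_zero_iff c

theorem scls_eq_iff {X : Type} [TopologicalSpace X] {n : ℕ} (c c' : cyc (singChains X) n) :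
    scls c = scls c' ↔ ∃ e, dd e = c.1 - c'.1 :=
  hcls_eq_iff c c'

theorem scls_congr {X : Type} [TopologicalSpace X] {n : ℕ} {c c' : cyc (singChains X) n}
    (h : c.1 = c'.1) : scls c = scls c' := congrArg _ (Subtype.ext h)

theorem hmap_scls {X Y : Type} [TopologicalSpace X] [TopologicalSpace Y] (f : C(X, Y)) {n : ℕ}
    (c : cyc (singChains X) n) :
    hmap f n (scls c) = scls ⟨push f c.1, push_mem_cyc f c.2⟩ :=
  hmap_hcls f c

theorem restr_push {X Y : Type} [TopologicalSpace X] [TopologicalSpace Y] (f : C(X, Y))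
    (B : Set Y) {n : ℕ} (c : (singChains X).X n) :
    restr B (push f c) = push f (restr (f ⁻¹' B) c) := by
  have : (restr B).comp (push (n := n) f) = (push f).comp (restr (f ⁻¹' B)) :=
    chain_hom_ext fun a => by
      rw [AddMonoidHom.comp_apply, AddMonoidHom.comp_apply, push_simplexChain]
      by_cases h : InSet (f ⁻¹' B) a
      · rw [restr_of_inSet h, restr_of_inSet (A := B) (a := mapS f a) (fun t => h t), push_simplexChain]
      · rw [restr_of_not_inSet h, restr_of_not_inSet (A := B) (a := mapS f a) fun h' => h fun t => h' t,
          map_zero]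
  exact DFunLike.congr_fun this c

variable {V : Type} [Fintype V] {E Y : Type} [TopologicalSpace E] [TopologicalSpace Y]

/-- A decomposition of a chain, up to a boundary, subordinate to the cover by stars and edges. -/
structure Decomp (p : C(E, Cpx V)) {n : ℕ} (z a b : (singChains E).X (n + 1)) : Prop where
  left_mem : a ∈ chainsIn (⋃ v, star p v) (n + 1)
  right_mem : b ∈ chainsIn (⋃ s, edge p s) (n + 1)
  exists_eq : ∃ e, z = a + b + dd e

variable {p : C(E, Cpx V)} {q : C(E, Y)} {n : ℕ}

theorem exists_small_cover (c : (singChains E).X (n + 1))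
    (hc : dd c ∈ chainsIn (⋃ v, star p v) n ⊔ chainsIn (⋃ s, edge p s) n) :
    ∃ a b, Decomp p c a b := by
  obtain ⟨a, ha, b, hb, h⟩ := exists_small (A := ⋃ v, star p v) (B := ⋃ s, edge p s) (cover_star_edge p) c hc
  exact ⟨a, b, ha, hb, h⟩

theorem exists_decomp {z : (singChains E).X (n + 1)} (hz : z ∈ cyc (singChains E) (n + 1)) :
    ∃ a b, Decomp p z a b :=
  exists_small_cover z (by rw [show dd z = 0 from hz]; exact zero_mem _)

theorem mem_chainsIn_half {c : (singChains E).X n} (ha : c ∈ chainsIn (⋃ v, star p v) n)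
    (hb : c ∈ chainsIn (⋃ s, edge p s) n) : c ∈ chainsIn (⋃ d, half p d) n := by
  rw [← iUnion_star_inter_iUnion_edge]
  exact mem_chainsIn_inter ha hb

theorem Decomp.dd_add {z a b : (singChains E).X (n + 1)} (h : Decomp p z a b)
    (hz : z ∈ cyc (singChains E) (n + 1)) : dd a = - dd b := by
  obtain ⟨e, rfl⟩ := h.exists_eq
  have h1 : dd (a + b + dd e) = 0 := hz
  rw [map_add, map_add, dd_dd, add_zero] at h1
  exact eq_neg_of_add_eq_zero_left h1

theorem Decomp.dd_mem {z a b : (singChains E).X (n + 1)} (h : Decomp p z a b)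
    (hz : z ∈ cyc (singChains E) (n + 1)) : dd a ∈ chainsIn (⋃ d, half p d) n :=
  mem_chainsIn_half (dd_mem_chainsIn h.left_mem) (by
    rw [h.dd_add hz]
    exact neg_mem (dd_mem_chainsIn h.right_mem))

theorem restr_mem_cyc {c : (singChains E).X n} (hc : c ∈ chainsIn (⋃ d, half p d) n)
    (hcyc : c ∈ cyc (singChains E) n) (d : V × V) :
    restr (half p d) c ∈ cyc (singChains E) n := by
  cases n with
  | zero => exact mem_cyc_zero _
  | succ n =>
    have h0 : dd c = 0 := hcyc
    change dd (restr (half p d) c) = 0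
    rw [dd_restr (isOpen_half p) (half_disjoint p) hc, h0, map_zero]

theorem Decomp.restr_mem_cyc {z a b : (singChains E).X (n + 1)} (h : Decomp p z a b)
    (hz : z ∈ cyc (singChains E) (n + 1)) (d : V × V) :
    restr (half p d) (dd a) ∈ cyc (singChains E) n :=
  GraphConf.restr_mem_cyc (h.dd_mem hz) (d_mem_cyc _ _) d

/-- If `a + b` bounds then the intersection of its halves bounds. -/
theorem Decomp.exists_of_zero {z a b : (singChains E).X (n + 1)} (h : Decomp p z a b)
    (hz : ∃ e, dd e = z) : ∃ c ∈ chainsIn (⋃ d, half p d) (n + 1), dd c = dd a := by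
  obtain ⟨e', rfl⟩ := hz
  obtain ⟨e, he⟩ := h.exists_eq
  have h1 : dd (e' - e) = a + b := by rw [map_sub, he]; abel
  -- Splitting e' - e, whose boundary is a + b, gives a + b = ∂a' + ∂b'. So a - ∂a' = ∂b' - b lies
  -- over both the stars and the edges, that is over the half edges.
  obtain ⟨a', b', h'⟩ := exists_small_cover (p := p) (e' - e) (by
    rw [h1]
    exact add_mem (AddSubgroup.mem_sup_left h.left_mem) (AddSubgroup.mem_sup_right h.right_mem))
  obtain ⟨e'', he''⟩ := h'.exists_eq
  rw [he'', map_add, map_add, dd_dd, add_zero] at h1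
  refine ⟨a - dd a', mem_chainsIn_half (sub_mem h.left_mem (dd_mem_chainsIn h'.left_mem)) ?_, ?_⟩
  · rw [show a - dd a' = dd b' - b by rw [sub_eq_sub_iff_add_eq_add, ← h1]; abel]
    exact sub_mem (dd_mem_chainsIn h'.right_mem) h.right_mem
  · rw [map_sub, dd_dd, sub_zero]

variable (q) in
/-- The homology class of the flow of a decomposed cycle through a half edge. -/
noncomputable def Decomp.flow {z a b : (singChains E).X (n + 1)} (h : Decomp p z a b)
    (hz : z ∈ cyc (singChains E) (n + 1)) (d : V × V) : singHomology n Y :=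
  scls ⟨push q (restr (half p d) (dd a)), push_mem_cyc q (h.restr_mem_cyc hz d)⟩

theorem Decomp.sub {z a b z' a' b' : (singChains E).X (n + 1)} (h : Decomp p z a b)
    (h' : Decomp p z' a' b') : Decomp p (z - z') (a - a') (b - b') := by
  obtain ⟨e, rfl⟩ := h.exists_eq
  obtain ⟨e', rfl⟩ := h'.exists_eq
  exact ⟨sub_mem h.left_mem h'.left_mem, sub_mem h.right_mem h'.right_mem, e - e', by
    rw [map_sub]; abel⟩

theorem Decomp.add {z a b z' a' b' : (singChains E).X (n + 1)} (h : Decomp p z a b)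
    (h' : Decomp p z' a' b') : Decomp p (z + z') (a + a') (b + b') := by
  obtain ⟨e, rfl⟩ := h.exists_eq
  obtain ⟨e', rfl⟩ := h'.exists_eq
  exact ⟨add_mem h.left_mem h'.left_mem, add_mem h.right_mem h'.right_mem, e + e', by
    rw [map_add]; abel⟩

/-- Well-definedness of the Mayer–Vietoris boundary: the difference of two decompositions of
homologous cycles decomposes a boundary, so its ∂a bounds inside the half edges. -/
theorem Decomp.flow_eq {z a b z' a' b' : (singChains E).X (n + 1)} (h : Decomp p z a b)
    (h' : Decomp p z' a' b') (hz : z ∈ cyc (singChains E) (n + 1))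
    (hz' : z' ∈ cyc (singChains E) (n + 1)) (hb : ∃ e, dd e = z - z') (d : V × V) :
    h.flow q hz d = h'.flow q hz' d := by
  obtain ⟨c, hc, hdc⟩ := (h.sub h').exists_of_zero hb
  rw [Decomp.flow, Decomp.flow, scls_eq_iff]
  refine ⟨push q (restr (half p d) c), ?_⟩
  rw [← push_dd, dd_restr (isOpen_half p) (half_disjoint p) hc, hdc, map_sub, map_sub, map_sub]

theorem exists_decomp_scls (p : C(E, Cpx V)) (x : singHomology (n + 1) E) :
    ∃ z : cyc (singChains E) (n + 1), ∃ a b, Decomp p z.1 a b ∧ scls z = x := by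
  obtain ⟨z, hz⟩ := scls_surjective x
  obtain ⟨a, b, h⟩ := exists_decomp (p := p) z.2
  exact ⟨z, a, b, h, hz⟩

variable (p q) in
/-- The flow of a homology class through a half edge, as a function. -/
noncomputable def flowFun (d : V × V) (x : singHomology (n + 1) E) : singHomology n Y :=
  (exists_decomp_scls p x).choose_spec.choose_spec.choose_spec.1.flow q
    (exists_decomp_scls p x).choose.2 d

theorem flowFun_eq (d : V × V) (z : cyc (singChains E) (n + 1)) {a b} (h : Decomp p z.1 a b) :
    flowFun p q d (scls z) = h.flow q z.2 d :=
  Decomp.flow_eq _ _ _ _ ((scls_eq_iff _ _).1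
    (exists_decomp_scls p (scls z)).choose_spec.choose_spec.choose_spec.2) _

variable (p q) in
/-- The flow of a homology class through a half edge. -/
noncomputable def flow (d : V × V) : singHomology (n + 1) E →+ singHomology n Y :=
  AddMonoidHom.mk' (flowFun p q d) fun x y => by
    obtain ⟨z, a, b, h, rfl⟩ := exists_decomp_scls p x
    obtain ⟨z', a', b', h', rfl⟩ := exists_decomp_scls p y
    have h1 := flowFun_eq (q := q) d z h
    have h2 := flowFun_eq (q := q) d z' h'
    have h3 := flowFun_eq (q := q) d (z + z') (h.add h')
    rw [map_add] at h3
    refine h3.trans ((?_ : _ = h.flow q z.2 d + h'.flow q z'.2 d).trans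
      (congrArg₂ (· + ·) h1.symm h2.symm))
    rw [Decomp.flow, Decomp.flow, Decomp.flow, ← map_add]
    refine congrArg _ (Subtype.ext ?_)
    change push q (restr (half p d) (dd (a + a'))) = push q (restr (half p d) (dd a)) + push q (restr (half p d) (dd a'))
    rw [map_add, map_add, map_add]

theorem flow_scls (d : V × V) (z : cyc (singChains E) (n + 1)) {a b} (h : Decomp p z.1 a b) :
    flow p q d (scls z) = h.flow q z.2 d :=
  flowFun_eq d z h

theorem Decomp.push {E' : Type} [TopologicalSpace E'] {f : C(E', E)}
    {z a b : (singChains E').X (n + 1)} (h : Decomp (p.comp f) z a b) :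
    Decomp p (push f z) (push f a) (push f b) := by
  obtain ⟨e, rfl⟩ := h.exists_eq
  refine ⟨push_mem_chainsIn (A := ⋃ v, star (p.comp f) v) f ?_ h.left_mem,
    push_mem_chainsIn (A := ⋃ s, edge (p.comp f) s) f ?_ h.right_mem, GraphConf.push f e, by
      rw [map_add, map_add, push_dd]⟩
  · intro x hx
    obtain ⟨v, hv⟩ := Set.mem_iUnion.1 hx
    exact Set.mem_iUnion.2 ⟨v, hv⟩
  · intro x hx
    obtain ⟨v, hv⟩ := Set.mem_iUnion.1 hx
    exact Set.mem_iUnion.2 ⟨v, hv⟩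

/-- Naturality of the Mayer–Vietoris boundary: a decomposition over p ∘ f pushes forward to one over
p, with half edges corresponding. -/
theorem flow_hmap {E' Y' : Type} [TopologicalSpace E'] [TopologicalSpace Y'] (f : C(E', E))
    (p' : C(E', Cpx V)) (q' : C(E', Y')) (g : C(Y', Y)) (hp : p' = p.comp f)
    (hq : q.comp f = g.comp q') (d : V × V) (x : singHomology (n + 1) E') :
    flow p q d (hmap f (n + 1) x) = hmap g n (flow p' q' d x) := by
  subst hp
  obtain ⟨z, a, b, h, rfl⟩ := exists_decomp_scls (p.comp f) x
  have h1 := flow_scls (p := p) (q := q) d ⟨push f z.1, push_mem_cyc f z.2⟩ h.push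
  have h2 := flow_scls (q := q') d z h
  refine (congrArg (flow p q d) (hmap_scls f z)).trans (h1.trans
    (Eq.trans ?_ (congrArg (hmap g n) h2).symm))
  rw [Decomp.flow, Decomp.flow, hmap_scls]
  refine scls_congr ?_
  change GraphConf.push q (restr (half p d) (dd (GraphConf.push f a))) =
    GraphConf.push g (GraphConf.push q' (restr (half (p.comp f) d) (dd a)))
  rw [← push_dd, restr_push, push_push, push_push, hq]
  rfl

theorem flow_eq_zero_of_half_empty {d : V × V} (hd : half p d = ∅) (x : singHomology (n + 1) E) :
    flow p q d x = 0 := by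
  obtain ⟨z, a, b, h, rfl⟩ := exists_decomp_scls p x
  refine (flow_scls d z h).trans ((scls_eq_zero_iff _).2 ⟨0, ?_⟩)
  have h0 : restr (half p d) (dd a) = 0 := chainsIn_empty n (by
    have := restr_mem (A := half p d) (dd a)
    rwa [hd] at this ⊢)
  change _ = push q (restr (half p d) (dd a))
  rw [h0, map_zero, map_zero]

theorem flow_self (v : V) (x : singHomology (n + 1) E) : flow p q (v, v) x = 0 :=
  flow_eq_zero_of_half_empty (Set.eq_empty_of_forall_notMem fun _ h => h.1 rfl) x

/-- Conservation law: the part of ∂a over the star of v is the boundary of the part of a over it. -/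
theorem sum_flow (v : V) (x : singHomology (n + 1) E) : ∑ w, flow p q (v, w) x = 0 := by
  obtain ⟨z, a, b, h, rfl⟩ := exists_decomp_scls p x
  have h1 : ∀ w, flow p q (v, w) (scls z) = _ := fun w => flow_scls (q := q) (v, w) z h
  simp only [h1, Decomp.flow]
  rw [← map_sum]
  refine (scls_eq_zero_iff _).2 ⟨push q (restr (star p v) a), ?_⟩
  rw [← push_dd, dd_restr (isOpen_star p) (star_disjoint p) h.left_mem,
    ← sum_restr_half_star p (h.dd_mem z.2), map_sum, AddSubgroup.val_finsetSum]

/-- The two halves together carry the part of ∂a = -∂b over the whole edge, which is bounded by the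
part of -b over it. -/
theorem flow_add_swap (v w : V) (x : singHomology (n + 1) E) :
    flow p q (v, w) x + flow p q (w, v) x = 0 := by
  classical
  by_cases hvw : v = w
  · subst hvw
    rw [flow_self, add_zero]
  obtain ⟨z, a, b, h, rfl⟩ := exists_decomp_scls p x
  have h1 : ∀ d, flow p q d (scls z) = _ := fun d => flow_scls (q := q) d z h
  simp only [h1, Decomp.flow]
  rw [← map_add]
  refine (scls_eq_zero_iff _).2 ⟨- push q (restr (edge p {v, w}) b), ?_⟩
  change dd _ = push q _ + push q _
  rw [← map_add, add_restr_half_edge p (h.dd_mem z.2) hvw, map_neg, ← push_dd,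
    dd_restr (isOpen_edge p) (edge_disjoint p) h.right_mem, h.dd_add z.2, map_neg, map_neg]

/-- A cycle without flow is homologous to a sum of cycles in stars and edges. -/
theorem exists_eq_sum_of_flow_eq_zero
    (H : ∀ d, ∀ c ∈ chainsIn (half p d) n, c ∈ cyc (singChains E) n →
      (∃ y, dd y = push q c) → ∃ f ∈ chainsIn (half p d) (n + 1), dd f = c)
    (z : cyc (singChains E) (n + 1)) (hz : ∀ d, flow p q d (scls z) = 0) :
    ∃ (α : V → (singChains E).X (n + 1)) (β : Finset V → (singChains E).X (n + 1)) (e : _),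
      (∀ v, α v ∈ chainsIn (star p v) (n + 1) ∧ α v ∈ cyc (singChains E) (n + 1)) ∧
      (∀ s, β s ∈ chainsIn (edge p s) (n + 1) ∧ β s ∈ cyc (singChains E) (n + 1)) ∧
      z.1 = ∑ v, α v + ∑ s, β s + dd e := by
  classical
  obtain ⟨a, b, h⟩ := exists_decomp (p := p) z.2
  have hf : ∀ d, ∃ f ∈ chainsIn (half p d) (n + 1), dd f = restr (half p d) (dd a) := fun d =>
    H d _ (restr_mem _) (h.restr_mem_cyc z.2 d)
      ((scls_eq_zero_iff _).1 ((flow_scls d z h).symm.trans (hz d)))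
  choose f hf hdf using hf
  -- Without flow, ∂a is filled inside the half edges by the sum of the f d. Moving this filling
  -- from a to b makes both parts cycles, which then split along the disjoint pieces.
  have hF : dd (∑ d, f d) = dd a := by
    rw [map_sum, Finset.sum_congr rfl fun d _ => hdf d]
    exact sum_restr (isOpen_half p) (half_disjoint p) (h.dd_mem z.2)
  have hFm : ∑ d, f d ∈ chainsIn (⋃ d, half p d) (n + 1) :=
    sum_mem fun d _ => chainsIn_mono (Set.subset_iUnion _ d) _ (hf d)
  rw [← iUnion_star_inter_iUnion_edge] at hFm
  have hA : a - ∑ d, f d ∈ chainsIn (⋃ v, star p v) (n + 1) :=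
    sub_mem h.left_mem (chainsIn_mono Set.inter_subset_left _ hFm)
  have hB : b + ∑ d, f d ∈ chainsIn (⋃ s, edge p s) (n + 1) :=
    add_mem h.right_mem (chainsIn_mono Set.inter_subset_right _ hFm)
  obtain ⟨e, he⟩ := h.exists_eq
  refine ⟨fun v => restr (star p v) (a - ∑ d, f d), fun s => restr (edge p s) (b + ∑ d, f d), e,
    fun v => ⟨restr_mem _, ?_⟩, fun s => ⟨restr_mem _, ?_⟩, ?_⟩
  · change dd _ = 0
    rw [dd_restr (isOpen_star p) (star_disjoint p) hA, map_sub, hF, sub_self, map_zero]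
  · change dd _ = 0
    rw [dd_restr (isOpen_edge p) (edge_disjoint p) hB, map_add, hF, h.dd_add z.2,
      add_neg_cancel, map_zero]
  · rw [sum_restr (isOpen_star p) (star_disjoint p) hA,
      sum_restr (isOpen_edge p) (edge_disjoint p) hB, he]
    abel

end Flow

/-! ### Contractible parts of the cover -/

section Contractible

variable {V : Type} [Fintype V] {E Y : Type} [TopologicalSpace E] [TopologicalSpace Y]

open Classical in
/-- The point on the edge `{v, w}` at distance `1 / 4` from `v`. -/
noncomputable def edgePt {G : SimpleGraph V} {v w : V} (h : G.Adj v w) : Realization G :=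
  -- The coordinate at v exceeds 1 / 2, so the point lies in the half of the edge near v and serves
  -- as centre of contraction both for that half and for the edge.
  ⟨fun u => if u = v then 3 / 4 else if u = w then 1 / 4 else 0, ⟨fun u => by
      dsimp only
      split_ifs <;> norm_num, by
      have : ∀ u, (if u = v then (3 / 4 : ℝ) else if u = w then 1 / 4 else 0) =
          (if u = v then (3 / 4 : ℝ) else 0) + if u = w then 1 / 4 else 0 := fun u => by
        split_ifs with h1 h2
        · exact absurd (h1.symm.trans h2) h.ne
        all_goals norm_num
      simp only [this, Finset.sum_add_distrib, Finset.sum_ite_eq', Finset.mem_univ, if_true]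
      norm_num⟩,
    Or.inr ⟨v, w, h, fun u hu => by
      by_contra hne
      simp only [Set.mem_insert_iff, Set.mem_singleton_iff, not_or] at hne
      exact hu (by simp [hne.1, hne.2])⟩⟩

open Classical in
theorem edgePt_apply {G : SimpleGraph V} {v w : V} (h : G.Adj v w) (u : V) :
    (edgePt h).1 u = if u = v then 3 / 4 else if u = w then 1 / 4 else 0 := rfl

theorem edgePt_left {G : SimpleGraph V} {v w : V} (h : G.Adj v w) : (edgePt h).1 v = 3 / 4 := by
  rw [edgePt_apply, if_pos rfl]

theorem edgePt_right {G : SimpleGraph V} {v w : V} (h : G.Adj v w) : (edgePt h).1 w = 1 / 4 := by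
  rw [edgePt_apply, if_neg h.ne', if_pos rfl]

theorem edgePt_of_ne {G : SimpleGraph V} {v w : V} (h : G.Adj v w) {u : V} (hv : u ≠ v)
    (hw : u ≠ w) : (edgePt h).1 u = 0 := by
  rw [edgePt_apply, if_neg hv, if_neg hw]

theorem vertexPt_self (G : SimpleGraph V) (v : V) : (vertexPt G v).1 v = 1 := by
  rw [vertexPt_apply, if_pos rfl]

theorem vertexPt_of_ne (G : SimpleGraph V) {v w : V} (h : w ≠ v) : (vertexPt G v).1 w = 0 := by
  rw [vertexPt_apply, if_neg h]

variable {p : C(E, Cpx V)}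

theorem lt_lerp {t : I} {x y k : ℝ} (hx : k < x) (hy : k < y) : k < (1 - t) * x + t * y := by
  rcases eq_or_lt_of_le t.2.1 with h | h
  · simpa [← h] using hx
  · have := sub_nonneg.2 t.2.2
    nlinarith [mul_nonneg this (sub_pos.2 hx).le, mul_pos h (sub_pos.2 hy)]

/-- Stars, half edges and edges are cut out by strict lower bounds on coordinates. Such bounds
persist along a segment towards a point satisfying them. -/
theorem contractible_star (p : C(E, Cpx V)) (v : V) :
    Contractible p (star p v) (vertexPt ⊤ v) where
  support_subset e he w hw := by
    by_cases h : w = v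
    · subst h
      have he : 1 / 2 < (p e).1 w := he
      exact (by linarith : 0 < (p e).1 w).ne'
    · exact absurd (vertexPt_of_ne _ h) hw
  mem e he := by
    change 1 / 2 < (p e).1 v
    rw [he, vertexPt_self]
    norm_num
  lerp_mem e he t h e' he' := by
    change 1 / 2 < (p e').1 v
    rw [he', lerp_apply, vertexPt_self]
    exact lt_lerp he (by norm_num)

theorem support_edgePt_subset {v w : V} (hvw : v ≠ w) {x : Cpx V} (hv : 0 < x.1 v)
    (hw : 0 < x.1 w) :
    Function.support (edgePt (G := ⊤) ((SimpleGraph.top_adj v w).2 hvw)).1 ⊆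
      Function.support x.1 := by
  intro u hu
  by_cases h : u = v
  · subst h; exact hv.ne'
  by_cases h' : u = w
  · subst h'; exact hw.ne'
  · exact absurd (edgePt_of_ne _ h h') hu

theorem contractible_half (p : C(E, Cpx V)) {v w : V} (hvw : v ≠ w) :
    Contractible p (half p (v, w)) (edgePt ((SimpleGraph.top_adj v w).2 hvw)) where
  support_subset e he := support_edgePt_subset hvw
    (by have : 1 / 2 < (p e).1 v := he.2.1; linarith) he.2.2
  mem e he := by
    refine ⟨hvw, ?_, ?_⟩
    · rw [he, edgePt_left]; norm_num
    · rw [he, edgePt_right]; norm_num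
  lerp_mem e he t h e' he' := by
    refine ⟨hvw, ?_, ?_⟩
    · rw [he', lerp_apply, edgePt_left]
      exact lt_lerp he.2.1 (by norm_num)
    · rw [he', lerp_apply, edgePt_right]
      exact lt_lerp he.2.2 (by norm_num)

open Classical in
theorem contractible_edge (p : C(E, Cpx V)) {v w : V} (hvw : v ≠ w) :
    Contractible p (edge p {v, w}) (edgePt ((SimpleGraph.top_adj v w).2 hvw)) where
  support_subset e he := support_edgePt_subset hvw (he.2 v (by simp)) (he.2 w (by simp))
  mem e he := by
    refine ⟨Finset.card_pair hvw, ?_⟩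
    simp only [Finset.mem_insert, Finset.mem_singleton, forall_eq_or_imp, forall_eq]
    rw [he, edgePt_left, edgePt_right]
    norm_num
  lerp_mem e he t h e' he' := by
    refine ⟨Finset.card_pair hvw, ?_⟩
    simp only [Finset.mem_insert, Finset.mem_singleton, forall_eq_or_imp, forall_eq]
    rw [he', lerp_apply, lerp_apply, edgePt_left, edgePt_right]
    exact ⟨lt_lerp (he.2 v (by simp)) (by norm_num), lt_lerp (he.2 w (by simp)) (by norm_num)⟩

/-- In a subset, all cycles of dimension `n` bound. -/
def CyclesBound (S : Set Y) (n : ℕ) : Prop :=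
  ∀ c ∈ chainsIn S n, c ∈ cyc (singChains Y) n → ∃ y ∈ chainsIn S (n + 1), dd y = c

/-- In a subset, all cycles of dimension `n` that bound in the ambient space bound. -/
def CyclesBoundRel (S : Set Y) (n : ℕ) : Prop :=
  ∀ c ∈ chainsIn S n, c ∈ cyc (singChains Y) n → (∃ y, dd y = c) →
    ∃ y ∈ chainsIn S (n + 1), dd y = c

variable {q : C(E, Y)} {n : ℕ}

theorem Fibred.cyclesBound (h : Fibred p q) {S : Set E} {x' : Cpx V}
    (hS : Contractible p S x') (hb : CyclesBound (fibre p q x') n) : CyclesBound S n :=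
  fun _ hc hcyc => h.exists_dd_eq hS hc hcyc
    (hb _ (push_mem_chainsIn (A := S) q (h.mapsTo_fibre hS) hc) (push_mem_cyc q hcyc))

theorem Fibred.half_rel (h : Fibred p q)
    (hb : ∀ v w (hvw : v ≠ w), CyclesBoundRel (fibre p q
      (edgePt ((SimpleGraph.top_adj v w).2 hvw))) n) (d : V × V) :
    ∀ c ∈ chainsIn (half p d) n, c ∈ cyc (singChains E) n →
      (∃ y, dd y = push q c) → ∃ f ∈ chainsIn (half p d) (n + 1), dd f = c := by
  obtain ⟨v, w⟩ := d
  by_cases hvw : v = w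
  · intro c hc _ _
    rw [show half p (v, w) = ∅ from Set.eq_empty_of_forall_notMem fun _ h => h.1 hvw] at hc ⊢
    exact ⟨0, zero_mem _, by rw [chainsIn_empty n hc, map_zero]⟩
  · intro c hc hcyc hy
    exact h.exists_dd_eq (contractible_half p hvw) hc hcyc (hb v w hvw _
      (push_mem_chainsIn (A := half p (v, w)) q (h.mapsTo_fibre (contractible_half p hvw)) hc)
      (push_mem_cyc q hcyc) hy)

theorem edge_eq_empty {s : Finset V} (hs : s.card ≠ 2) : edge p s = ∅ :=
  Set.eq_empty_of_forall_notMem fun _ h => hs h.1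

/-- If the homology of the fibres vanishes, classes without flow vanish. -/
theorem Fibred.eq_zero_of_flow (h : Fibred p q)
    (hb : ∀ v w (hvw : v ≠ w), CyclesBoundRel (fibre p q
      (edgePt ((SimpleGraph.top_adj v w).2 hvw))) n)
    (hv : ∀ v, CyclesBound (fibre p q (vertexPt ⊤ v)) (n + 1))
    (he : ∀ v w (hvw : v ≠ w), CyclesBound (fibre p q
      (edgePt ((SimpleGraph.top_adj v w).2 hvw))) (n + 1))
    (x : singHomology (n + 1) E) (hx : ∀ d, flow p q d x = 0) : x = 0 := by
  classical
  obtain ⟨z, rfl⟩ := scls_surjective x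
  obtain ⟨α, β, e, hα, hβ, hz⟩ := exists_eq_sum_of_flow_eq_zero (h.half_rel hb) z hx
  have h1 : ∀ v, ∃ y, dd y = α v := fun v => by
    obtain ⟨y, -, hy⟩ := h.cyclesBound (contractible_star p v) (hv v) _ (hα v).1 (hα v).2
    exact ⟨y, hy⟩
  have h2 : ∀ s, ∃ y, dd y = β s := fun s => by
    by_cases hs : s.card = 2
    · obtain ⟨a, b, hab, rfl⟩ := Finset.card_eq_two.1 hs
      obtain ⟨y, -, hy⟩ := h.cyclesBound (contractible_edge p hab) (he a b hab) _
        (hβ _).1 (hβ _).2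
      exact ⟨y, hy⟩
    · have := (hβ s).1
      rw [edge_eq_empty hs] at this
      exact ⟨0, by rw [chainsIn_empty _ this, map_zero]⟩
  choose y hy using h1
  choose y' hy' using h2
  refine (scls_eq_zero_iff _).2 ⟨∑ v, y v + ∑ s, y' s + e, ?_⟩
  rw [hz, map_add, map_add, map_sum, map_sum]
  simp only [hy, hy']

end Contractible

/-! ### The homology of subcomplexes of the complete graph -/

section Augmentation

variable {X Y : Type} [TopologicalSpace X] [TopologicalSpace Y]

theorem scls_aug {c c' : cyc (singChains X) 0} (h : scls c = scls c') : aug c.1 = aug c'.1 := by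
  obtain ⟨e, he⟩ := (scls_eq_iff _ _).1 h
  rw [← sub_eq_zero, ← map_sub, ← he, aug_dd]

/-- The augmentation of the homology in dimension zero. -/
noncomputable def augH : singHomology 0 X →+ ℤ :=
  AddMonoidHom.mk' (fun x => aug (scls_surjective x).choose.1) fun x y => by
    have hx := (scls_surjective x).choose_spec
    have hy := (scls_surjective y).choose_spec
    have hxy := (scls_surjective (x + y)).choose_spec
    rw [← map_add]
    refine scls_aug (c' := _ + _) (hxy.trans ?_)
    rw [map_add, hx, hy]

theorem augH_scls (c : cyc (singChains X) 0) : augH (scls c) = aug c.1 :=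
  scls_aug (scls_surjective (scls c)).choose_spec

theorem augH_hmap (f : C(X, Y)) (x : singHomology 0 X) : augH (hmap f 0 x) = augH x := by
  obtain ⟨c, rfl⟩ := scls_surjective x
  rw [hmap_scls, augH_scls, augH_scls, aug_push]

theorem augH_injective [PathConnectedSpace X] : Function.Injective (augH (X := X)) := by
  rw [injective_iff_map_eq_zero]
  intro x hx
  obtain ⟨c, rfl⟩ := scls_surjective x
  rw [augH_scls] at hx
  obtain ⟨x₀⟩ := PathConnectedSpace.nonempty (X := X)
  obtain ⟨e, -, he⟩ := exists_dd_of_aug_eq_zero (S := Set.univ) (x₀ := x₀)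
    (fun x _ => (joinedIn_univ).2 (PathConnectedSpace.joined x x₀)) (chainsIn_univ 0 c.1) hx
  exact (scls_eq_zero_iff _).2 ⟨e, he⟩

end Augmentation

/-! ### Criteria for cycles of a subset to bound -/

section Criteria

variable {Y : Type} [TopologicalSpace Y] {S : Set Y} {n : ℕ}

theorem cyclesBound_of_homology (h : ∀ x : singHomology n S, x = 0) : CyclesBound S n := by
  intro c hc hcyc
  obtain ⟨c', rfl⟩ := mem_chainsIn_iff.1 hc
  obtain ⟨e, he⟩ := (scls_eq_zero_iff ⟨c', mem_cyc_of_push_incl hcyc⟩).1 (h _)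
  exact ⟨push (incl S) e, push_incl_mem e, by rw [← push_dd, he]⟩

theorem cyclesBoundRel_of_injective (h : Function.Injective (hmap (incl S) n)) :
    CyclesBoundRel S n := by
  rintro c hc hcyc hb
  obtain ⟨c', rfl⟩ := mem_chainsIn_iff.1 hc
  have h0 : scls ⟨c', mem_cyc_of_push_incl hcyc⟩ = 0 := h (by
    rw [map_zero, hmap_scls]
    exact (scls_eq_zero_iff _).2 hb)
  obtain ⟨e, he⟩ := (scls_eq_zero_iff _).1 h0
  exact ⟨push (incl S) e, push_incl_mem e, by rw [← push_dd, he]⟩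

theorem cyclesBound_empty : CyclesBound (∅ : Set Y) n := fun c hc _ =>
  ⟨0, zero_mem _, by rw [chainsIn_empty n hc, map_zero]⟩

theorem cyclesBoundRel_empty : CyclesBoundRel (∅ : Set Y) n := fun c hc _ _ =>
  ⟨0, zero_mem _, by rw [chainsIn_empty n hc, map_zero]⟩

theorem cyclesBoundRel_univ : CyclesBoundRel (Set.univ : Set Y) n := fun _ _ _ ⟨y, hy⟩ =>
  ⟨y, chainsIn_univ _ _, hy⟩

theorem cyclesBound_univ (h : ∀ x : singHomology n Y, x = 0) : CyclesBound (Set.univ : Set Y) n :=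
  fun c _ hcyc => by
    obtain ⟨y, hy⟩ := (scls_eq_zero_iff ⟨c, hcyc⟩).1 (h _)
    exact ⟨y, chainsIn_univ _ _, hy⟩

theorem homology_eq_zero_of_totallyDisconnected {X : Type} [TopologicalSpace X]
    [TotallyDisconnectedSpace X] (x : singHomology (n + 1) X) : x = 0 := by
  have h := AlgebraicTopology.isZero_singularHomologyFunctor_of_totallyDisconnectedSpace
    AddCommGrpCat.{0} (n + 1) (AddCommGrpCat.of ℤ) (TopCat.of X) (Nat.succ_ne_zero n)
  have := AddCommGrpCat.subsingleton_of_isZero h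
  exact Subsingleton.elim _ _

end Criteria

/-! ### Integral flows and the homology of subcomplexes -/

section Subcomplex

variable {V : Type} [Fintype V] {E E' : Type} [TopologicalSpace E] [TopologicalSpace E']

/-- A subspace of the complete graph which contains with a point all points with smaller
support. -/
structure IsSubcomplex (p : C(E, Cpx V)) : Prop where
  inducing : Topology.IsInducing p
  exists_of_support : ∀ e (x' : Cpx V), Function.support x'.1 ⊆ Function.support (p e).1 →
    ∃ e', p e' = x'

variable {p : C(E, Cpx V)} {n : ℕ}

/-- With a one-point second factor every fibre is empty or a point, and the flows take values in the
homology of a point. -/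
theorem IsSubcomplex.fibred (h : IsSubcomplex p) : Fibred p (ContinuousMap.const E ()) where
  inducing := Topology.IsInducing.of_comp (g := Prod.fst) (by fun_prop) continuous_fst h.inducing
  exists_of_support e x' hx' := by
    obtain ⟨e', he'⟩ := h.exists_of_support e x' hx'
    exact ⟨e', he', rfl⟩

theorem cyclesBound_unit (S : Set Unit) : CyclesBound S (n + 1) :=
  cyclesBound_of_homology fun x => homology_eq_zero_of_totallyDisconnected x

theorem cyclesBoundRel_unit (S : Set Unit) : CyclesBoundRel S n := by
  rcases S.eq_empty_or_nonempty with rfl | hS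
  · exact cyclesBoundRel_empty
  · rw [Set.Nonempty.eq_univ hS]
    exact cyclesBoundRel_univ

/-- In these degrees the flows live in positive-degree homology of a point, so they all vanish. -/
theorem IsSubcomplex.homology_eq_zero (h : IsSubcomplex p) (x : singHomology (n + 2) E) : x = 0 :=
  h.fibred.eq_zero_of_flow (fun _ _ _ => cyclesBoundRel_unit _) (fun _ => cyclesBound_unit _)
    (fun _ _ _ => cyclesBound_unit _) x fun _ => homology_eq_zero_of_totallyDisconnected _

variable (p) in
/-- The integral flow of a homology class of dimension one through a half edge. -/
noncomputable def flowZ (d : V × V) : singHomology 1 E →+ ℤ :=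
  augH.comp (flow p (ContinuousMap.const E ()) d)

theorem flowZ_scls (d : V × V) (z : cyc (singChains E) 1) {a b} (h : Decomp p z.1 a b) :
    flowZ p d (scls z) = aug (restr (half p d) (dd a)) := by
  rw [flowZ, AddMonoidHom.comp_apply, flow_scls d z h, Decomp.flow, augH_scls, aug_push]

theorem flowZ_hmap (f : C(E', E)) (d : V × V) (x : singHomology 1 E') :
    flowZ p d (hmap f 1 x) = flowZ (p.comp f) d x := by
  rw [flowZ, AddMonoidHom.comp_apply, flow_hmap f (p.comp f) (ContinuousMap.const E' ())
    (ContinuousMap.id Unit) rfl rfl, hmap_id]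
  rfl

theorem flowZ_eq_zero_of_half_empty {d : V × V} (hd : half p d = ∅) (x : singHomology 1 E) :
    flowZ p d x = 0 := by
  rw [flowZ, AddMonoidHom.comp_apply, flow_eq_zero_of_half_empty hd, map_zero]

theorem sum_flowZ (v : V) (x : singHomology 1 E) : ∑ w, flowZ p (v, w) x = 0 := by
  simp only [flowZ, AddMonoidHom.comp_apply]
  rw [← map_sum, sum_flow, map_zero]

theorem flowZ_swap (v w : V) (x : singHomology 1 E) : flowZ p (w, v) x = - flowZ p (v, w) x := by
  refine eq_neg_of_add_eq_zero_right ?_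
  simp only [flowZ, AddMonoidHom.comp_apply]
  rw [← map_add, flow_add_swap, map_zero]

theorem IsSubcomplex.eq_zero_of_flowZ (h : IsSubcomplex p) {x : singHomology 1 E}
    (hx : ∀ d, flowZ p d x = 0) : x = 0 :=
  h.fibred.eq_zero_of_flow (fun _ _ _ => cyclesBoundRel_unit _) (fun _ => cyclesBound_unit _)
    (fun _ _ _ => cyclesBound_unit _) x fun d => augH_injective ((hx d).trans (map_zero _).symm)

/-- Integral flows of a class are those of its image, and they detect the source; nothing is
required of the target beyond its map to the complete graph. -/
theorem IsSubcomplex.hmap_injective (f : C(E', E)) (h : IsSubcomplex (p.comp f)) :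
    Function.Injective (hmap f 1) := by
  rw [injective_iff_map_eq_zero]
  intro x hx
  exact h.eq_zero_of_flowZ fun d => by rw [← flowZ_hmap, hx, map_zero]

variable (p) in
/-- All flows of a homology class. -/
noncomputable def flowsZ : singHomology 1 E →ₗ[ℤ] (V × V → ℤ) :=
  LinearMap.pi fun d => (flowZ p d).toIntLinearMap

theorem flowsZ_apply (x : singHomology 1 E) (d : V × V) : flowsZ p x d = flowZ p d x := rfl

theorem IsSubcomplex.flowsZ_injective (h : IsSubcomplex p) : Function.Injective (flowsZ p) := by
  rw [injective_iff_map_eq_zero]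
  exact fun x hx => h.eq_zero_of_flowZ fun d => congrFun hx d

/-- The flows embed H_1 in the finitely generated free group of integer functions on V × V. -/
theorem IsSubcomplex.free (h : IsSubcomplex p) : Module.Free ℤ (singHomology 1 E) := by
  have : Module.Finite ℤ (singHomology 1 E) := Module.Finite.of_injective _ h.flowsZ_injective
  have : Module.IsTorsionFree ℤ (singHomology 1 E) :=
    h.flowsZ_injective.moduleIsTorsionFree _ (map_smul _)
  exact Module.free_of_finite_type_torsion_free'

theorem IsSubcomplex.exists_dd_of_aug_eq_zero (h : IsSubcomplex p) {S : Set E} {x' : Cpx V}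
    (hS : Contractible p S x') {c : (singChains E).X 0} (hc : c ∈ chainsIn S 0)
    (haug : aug c = 0) : ∃ e ∈ chainsIn S 1, dd e = c := by
  rcases S.eq_empty_or_nonempty with rfl | ⟨e₀, he₀⟩
  · exact ⟨0, zero_mem _, by rw [chainsIn_empty 0 hc, map_zero]⟩
  obtain ⟨i, hi⟩ := h.fibred.exists_section x'
  obtain ⟨ρ, ⟨H⟩, hρ⟩ := h.fibred.exists_homotopy hS i hi
  have hu : () ∈ fibre p (ContinuousMap.const E ()) x' := h.fibred.mapsTo_fibre hS he₀
  refine GraphConf.exists_dd_of_aug_eq_zero (x₀ := i ⟨(), hu⟩) (fun e he => ?_) hc haug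
  refine ⟨((H.evalAt ⟨e, he⟩).map continuous_subtype_val).cast rfl (hρ ⟨e, he⟩ hu).symm, ?_⟩
  intro t
  exact (H.evalAt ⟨e, he⟩ t).2

end Subcomplex

/-! ### The homology of a graph -/

section Graph

variable {V : Type} [Fintype V]

/-- The inclusion of the realization of a graph into the realization of a larger one. -/
def ofLE {G G' : SimpleGraph V} (h : G ≤ G') : C(Realization G, Realization G') where
  toFun x := ⟨x.1, x.2.1, x.2.2.imp id fun ⟨u, v, huv, hx⟩ => ⟨u, v, h huv, hx⟩⟩
  continuous_toFun := continuous_subtype_val.subtype_mk _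

/-- The inclusion of the realization of a graph into that of the complete graph. -/
def toCpx (G : SimpleGraph V) : C(Realization G, Cpx V) := ofLE le_top

theorem ofLE_apply {G G' : SimpleGraph V} (h : G ≤ G') (x : Realization G) (v : V) :
    (ofLE h x).1 v = x.1 v := rfl

theorem toCpx_apply (G : SimpleGraph V) (x : Realization G) (v : V) :
    (toCpx G x).1 v = x.1 v := rfl

theorem toCpx_inducing (G : SimpleGraph V) : Topology.IsInducing (toCpx G) :=
  (Topology.IsInducing.subtypeVal.of_comp_iff).1 Topology.IsInducing.subtypeVal

/-- The point with the given coordinates, provided that its support is small. -/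
theorem exists_toCpx_eq {G : SimpleGraph V} (x : Realization G) (x' : Cpx V)
    (h : Function.support x'.1 ⊆ Function.support x.1) : ∃ y : Realization G, toCpx G y = x' :=
  ⟨⟨x'.1, x'.2.1, x.2.2.imp (fun ⟨v, hv⟩ => ⟨v, h.trans hv⟩)
    fun ⟨u, v, huv, hx⟩ => ⟨u, v, huv, h.trans hx⟩⟩, rfl⟩

theorem isSubcomplex_toCpx (G : SimpleGraph V) : IsSubcomplex (toCpx G) :=
  ⟨toCpx_inducing G, exists_toCpx_eq⟩

theorem adj_of_pos {G : SimpleGraph V} {x : Realization G} {v w : V} (hvw : v ≠ w)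
    (hv : 0 < x.1 v) (hw : 0 < x.1 w) : G.Adj v w := by
  rcases x.2.2 with ⟨u, hu⟩ | ⟨a, b, hab, hs⟩
  · exact absurd ((hu hv.ne').trans (hu hw.ne').symm) hvw
  · have h1 := hs hv.ne'
    have h2 := hs hw.ne'
    simp only [Set.mem_insert_iff, Set.mem_singleton_iff] at h1 h2
    rcases h1 with rfl | rfl <;> rcases h2 with rfl | rfl
    · exact absurd rfl hvw
    · exact hab
    · exact hab.symm
    · exact absurd rfl hvw

theorem half_toCpx_eq_empty {G : SimpleGraph V} {v w : V} (h : ¬ G.Adj v w) :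
    half (toCpx G) (v, w) = ∅ :=
  Set.eq_empty_of_forall_notMem fun x hx => h (adj_of_pos hx.1
    (lt_trans (by norm_num) hx.2.1) hx.2.2)

theorem flowZ_of_not_adj {G : SimpleGraph V} {v w : V} (h : ¬ G.Adj v w)
    (x : singHomology 1 (Realization G)) : flowZ (toCpx G) (v, w) x = 0 :=
  flowZ_eq_zero_of_half_empty (half_toCpx_eq_empty h) x

theorem edgePt_mem_half {G : SimpleGraph V} {v w : V} (h : G.Adj v w) :
    edgePt h ∈ half (toCpx G) (v, w) := by
  refine ⟨h.ne, ?_, ?_⟩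
  · rw [toCpx_apply, edgePt_left]; norm_num
  · rw [toCpx_apply, edgePt_right]; norm_num

/-- Every integral flow on a graph is the flow of a homology class. -/
theorem exists_flowZ_eq (G : SimpleGraph V) (f : V × V → ℤ)
    (hadj : ∀ v w, ¬ G.Adj v w → f (v, w) = 0) (hswap : ∀ v w, f (w, v) = - f (v, w))
    (hsum : ∀ v, ∑ w, f (v, w) = 0) :
    ∃ x : singHomology 1 (Realization G), ∀ d, flowZ (toCpx G) d x = f d := by
  classical
  have hG := isSubcomplex_toCpx G
  -- The vertex is a default value for non-adjacent pairs, where f vanishes. The chain c below, with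
  -- weight f d at a point of the half edge d, is the prescribed boundary of the star part.
  let pt : V × V → Realization G := fun d =>
    if h : G.Adj d.1 d.2 then edgePt h else vertexPt G d.1
  let t : V × V → (singChains (Realization G)).X 0 := fun d => f d • simplexChain (ptS (pt d))
  have ht : ∀ d, t d ∈ chainsIn (half (toCpx G) d) 0 := by
    rintro ⟨v, w⟩
    by_cases h : G.Adj v w
    · refine zsmul_mem (simplexChain_mem fun _ => ?_) _
      rw [ev_ptS]
      simp only [pt, dif_pos h]
      exact edgePt_mem_half h
    · simp only [t, hadj v w h, zero_smul]
      exact zero_mem _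
  let c := ∑ d, t d
  have hc : c ∈ chainsIn (⋃ d, half (toCpx G) d) 0 :=
    sum_mem fun d _ => chainsIn_mono (Set.subset_iUnion _ d) _ (ht d)
  have hrestr : ∀ d, restr (half (toCpx G) d) c = t d := fun d => by
    rw [map_sum, Finset.sum_eq_single d, restr_eq_self (ht d)]
    · exact fun d' _ hd' => restr_eq_zero_of_disjoint (half_disjoint _ hd') (ht d')
    · simp
  have haugt : ∀ d, aug (t d) = f d := fun d => by
    simp only [t, map_zsmul, aug_simplexChain, smul_eq_mul, mul_one]
  -- Conservation gives c total weight zero on each star, and antisymmetry does so on each edge.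
  -- Hence c bounds a chain over the stars and one over the edges, whose difference is the required
  -- cycle.
  have ha : ∀ v, ∃ a ∈ chainsIn (star (toCpx G) v) 1, dd a = restr (star (toCpx G) v) c :=
    fun v => hG.exists_dd_of_aug_eq_zero (contractible_star _ v) (restr_mem _) (by
      rw [← sum_restr_half_star _ hc, map_sum, ← hsum v]
      exact Finset.sum_congr rfl fun w _ => by rw [hrestr, haugt])
  have hb : ∀ s, ∃ b ∈ chainsIn (edge (toCpx G) s) 1, dd b = restr (edge (toCpx G) s) c := by
    intro s
    by_cases hs : s.card = 2
    · obtain ⟨v, w, hvw, rfl⟩ := Finset.card_eq_two.1 hs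
      refine hG.exists_dd_of_aug_eq_zero (contractible_edge _ hvw) (restr_mem _) ?_
      rw [← add_restr_half_edge _ hc hvw, map_add, hrestr, hrestr, haugt, haugt, hswap v w,
        add_neg_cancel]
    · refine ⟨0, zero_mem _, ?_⟩
      have := restr_mem (A := edge (toCpx G) s) c
      rw [edge_eq_empty hs] at this
      rw [map_zero, edge_eq_empty hs, chainsIn_empty _ this]
  choose a ha hda using ha
  choose b hb hdb using hb
  have hcA : c ∈ chainsIn ((⋃ v, star (toCpx G) v) ∩ ⋃ s, edge (toCpx G) s) 0 := by
    rwa [iUnion_star_inter_iUnion_edge]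
  have hA : dd (∑ v, a v) = c := by
    rw [map_sum, Finset.sum_congr rfl fun v _ => hda v]
    exact sum_restr (isOpen_star _) (star_disjoint _) (chainsIn_mono Set.inter_subset_left _ hcA)
  have hB : dd (∑ s, b s) = c := by
    rw [map_sum, Finset.sum_congr rfl fun v _ => hdb v]
    exact sum_restr (isOpen_edge _) (edge_disjoint _) (chainsIn_mono Set.inter_subset_right _ hcA)
  have hz : ∑ v, a v + -∑ s, b s ∈ cyc (singChains (Realization G)) 1 := by
    change dd _ = 0
    rw [map_add, map_neg, hA, hB, add_neg_cancel]
  have hdec : Decomp (toCpx G) (∑ v, a v + -∑ s, b s) (∑ v, a v) (-∑ s, b s) :=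
    ⟨sum_mem fun v _ => chainsIn_mono (Set.subset_iUnion _ v) _ (ha v),
      neg_mem (sum_mem fun s _ => chainsIn_mono (Set.subset_iUnion _ s) _ (hb s)), 0, by
        rw [map_zero, add_zero]⟩
  refine ⟨scls ⟨_, hz⟩, fun d => ?_⟩
  rw [flowZ_scls d ⟨_, hz⟩ hdec, hA, hrestr, haugt]

end Graph

/-! ### Flows of cross products -/

section CrossFlow

variable {X Y : Type} [TopologicalSpace X] [TopologicalSpace Y]

theorem cross11_mem {A : Set X} {a : (singChains X).X 1} (ha : a ∈ chainsIn A 1)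
    (w : (singChains Y).X 1) :
    cross11 a w ∈ chainsIn ((ContinuousMap.fst : C(X × Y, X)) ⁻¹' A) 2 := by
  refine chainsIn_le_comap (cross11.flip w) _ (fun s hs => ?_) ha
  refine chainsIn_le_comap (A := Set.univ) (cross11 (simplexChain s)) _ (fun t _ => ?_)
    (chainsIn_univ 1 w)
  rw [cross11, liftChain₂_simplexChain]
  exact sub_mem (simplexChain_mem fun _ => hs _) (simplexChain_mem fun _ => hs _)

theorem restr_cross01 (A : Set X) (c : (singChains X).X 0) (w : (singChains Y).X 1) :
    restr ((ContinuousMap.fst : C(X × Y, X)) ⁻¹' A) (cross01 c w) = cross01 (restr A c) w := by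
  have : (AddMonoidHom.compHom (restr ((ContinuousMap.fst : C(X × Y, X)) ⁻¹' A))).comp cross01 =
      cross01.comp (restr A) := chain_hom_ext fun s => chain_hom_ext fun t => by
    change restr _ (cross01 (simplexChain s) (simplexChain t)) =
      cross01 (restr A (simplexChain s)) (simplexChain t)
    by_cases h : InSet A s
    · rw [restr_of_inSet h, cross01, liftChain₂_simplexChain]
      exact restr_of_inSet fun _ => h _
    · rw [restr_of_not_inSet h, map_zero, AddMonoidHom.zero_apply, cross01,
        liftChain₂_simplexChain]
      refine restr_of_not_inSet fun h' => h fun u => ?_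
      -- The degeneracy of a 0-simplex is constant: one point of the product simplex in A already
      -- puts the whole 0-simplex in A.
      rw [Subsingleton.elim u (stdSimplex.map (Fin.predAbove 0) (vtx 0))]
      exact h' (vtx 0)
  exact DFunLike.congr_fun (DFunLike.congr_fun this c) w

theorem push_snd_cross01 (c : (singChains X).X 0) (w : (singChains Y).X 1) :
    push (ContinuousMap.snd : C(X × Y, Y)) (cross01 c w) = aug c • w := by
  have : (AddMonoidHom.compHom (push (ContinuousMap.snd : C(X × Y, Y)))).comp cross01 =
      (zmultiplesHom ((singChains Y).X 1 →+ (singChains Y).X 1) (AddMonoidHom.id _)).comp aug :=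
    chain_hom_ext fun s => chain_hom_ext fun t => by
      change push _ (cross01 (simplexChain s) (simplexChain t)) =
        (aug (simplexChain s) • (AddMonoidHom.id _ : (singChains Y).X 1 →+ _)) (simplexChain t)
      rw [cross01, liftChain₂_simplexChain, push_simplexChain, aug_simplexChain, one_smul]
      exact congrArg simplexChain (ev_ext fun _ => rfl)
  exact DFunLike.congr_fun (DFunLike.congr_fun this c) w

theorem dd_cross11 (x : (singChains X).X 1) {w : (singChains Y).X 1} (hw : dd w = 0) :
    dd (cross11 x w) = cross01 (dd x) w := by
  refine (d_cross11 x w).trans ?_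
  change cross01 (dd x) w - cross10 x (dd w) = _
  rw [hw, map_zero, sub_zero]

theorem dd_cross21 (x : (singChains X).X 2) {w : (singChains Y).X 1} (hw : dd w = 0) :
    dd (cross21 x w) = cross11 (dd x) w := by
  refine (d_cross21 x w).trans ?_
  change cross11 (dd x) w + cross20 x (dd w) = _
  rw [hw, map_zero, add_zero]

theorem cross11_mem_cyc {z : (singChains X).X 1} {w : (singChains Y).X 1}
    (hz : z ∈ cyc (singChains X) 1) (hw : w ∈ cyc (singChains Y) 1) :
    cross11 z w ∈ cyc (singChains (X × Y)) 2 := by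
  change dd _ = 0
  rw [dd_cross11 z hw, show dd z = 0 from hz, map_zero, AddMonoidHom.zero_apply]

theorem crossProduct_scls (z : cyc (singChains X) 1) (w : cyc (singChains Y) 1) :
    crossProduct X Y (scls z ⊗ₜ[ℤ] scls w) = scls ⟨cross11 z.1 w.1, cross11_mem_cyc z.2 w.2⟩ :=
  crossProduct_tmul ((toCycles _ 1).hom z) ((toCycles _ 1).hom w) ((toCycles _ 2).hom _) (by
    rw [iCycles_toCycles, iCycles_toCycles, iCycles_toCycles])

variable {V : Type} [Fintype V]

/-- Crossing with a cycle w acts only on the second factor, so the pieces stay over the same stars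
and edges, and the boundary ∂e becomes the boundary of e × w. -/
theorem Decomp.cross {p : C(X, Cpx V)} {z a b : (singChains X).X 1} (h : Decomp p z a b)
    {w : (singChains Y).X 1} (hw : dd w = 0) :
    Decomp (p.comp (ContinuousMap.fst : C(X × Y, X))) (cross11 z w) (cross11 a w)
      (cross11 b w) := by
  obtain ⟨e, rfl⟩ := h.exists_eq
  refine ⟨chainsIn_mono ?_ _ (cross11_mem h.left_mem w),
    chainsIn_mono ?_ _ (cross11_mem h.right_mem w), cross21 e w, ?_⟩
  · rw [Set.preimage_iUnion]
    exact subset_rfl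
  · rw [Set.preimage_iUnion]
    exact subset_rfl
  · rw [dd_cross21 e hw, map_add, map_add]
    rfl

/-- If z is split with star part a, then ∂(a × w) = ∂a × w. Over a half edge this is a 0-chain times
w, and its projection to Y is the total weight of the 0-chain times w. -/
theorem flow_crossProduct (p : C(X, Cpx V)) (d : V × V) (x : singHomology 1 X)
    (y : singHomology 1 Y) :
    flow (p.comp (ContinuousMap.fst : C(X × Y, X))) (ContinuousMap.snd : C(X × Y, Y)) d
      (crossProduct X Y (x ⊗ₜ[ℤ] y)) = flowZ p d x • y := by
  obtain ⟨w, rfl⟩ := scls_surjective y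
  obtain ⟨z, a, b, h, rfl⟩ := exists_decomp_scls p x
  have hw : dd w.1 = 0 := w.2
  rw [crossProduct_scls, flow_scls d ⟨_, cross11_mem_cyc z.2 w.2⟩ (h.cross hw), flowZ_scls d z h,
    ← map_zsmul, Decomp.flow]
  refine scls_congr ?_
  change push _ (restr (ContinuousMap.fst ⁻¹' half p d) (dd (cross11 a w.1))) = _ • w.1
  rw [dd_cross11 a hw, restr_cross01, push_snd_cross01]

end CrossFlow

/-! ### The homology of the product and of the discrete configuration space -/

section ProductGraph

variable {V : Type} [Fintype V] (G : SimpleGraph V)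

/-- The square of a graph, as a space over the complete graph. -/
abbrev sqFst : C(Realization G × Realization G, Cpx V) := (toCpx G).comp ContinuousMap.fst

/-- The second projection of the square of a graph. -/
abbrev sqSnd : C(Realization G × Realization G, Realization G) := ContinuousMap.snd

theorem sq_inducing : Topology.IsInducing fun e => (sqFst G e, sqSnd G e) :=
  (toCpx_inducing G).prodMap Topology.IsInducing.id

theorem sq_fibred : Fibred (sqFst G) (sqSnd G) where
  inducing := sq_inducing G
  exists_of_support := by
    rintro ⟨x, y⟩ x' hx'
    obtain ⟨z, hz⟩ := exists_toCpx_eq x x' hx'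
    exact ⟨(z, y), hz, rfl⟩

theorem sq_fibre (x' : Cpx V) : fibre (sqFst G) (sqSnd G) x' = ∅ ∨
    fibre (sqFst G) (sqSnd G) x' = Set.univ := by
  by_cases h : ∃ x, toCpx G x = x'
  · obtain ⟨x, hx⟩ := h
    exact Or.inr (Set.eq_univ_of_forall fun y => ⟨(x, y), hx, rfl⟩)
  · exact Or.inl (Set.eq_empty_of_forall_notMem fun y ⟨e, he, _⟩ => h ⟨e.1, he⟩)

theorem homology_two_eq_zero (n : ℕ) (x : singHomology (n + 2) (Realization G)) : x = 0 :=
  (isSubcomplex_toCpx G).homology_eq_zero x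

theorem sq_fibre_rel (x' : Cpx V) (n : ℕ) : CyclesBoundRel (fibre (sqFst G) (sqSnd G) x') n := by
  rcases sq_fibre G x' with h | h <;> rw [h]
  · exact cyclesBoundRel_empty
  · exact cyclesBoundRel_univ

/-- Each fibre of the first projection is empty or all of Γ, and H_2(Γ) = 0. -/
theorem sq_eq_zero_of_flow (x : singHomology 2 (Realization G × Realization G))
    (hx : ∀ d, flow (sqFst G) (sqSnd G) d x = 0) : x = 0 := by
  have h : ∀ x', CyclesBound (fibre (sqFst G) (sqSnd G) x') 2 := fun x' => by
    rcases sq_fibre G x' with h | h <;> rw [h]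
    · exact cyclesBound_empty
    · exact cyclesBound_univ (homology_two_eq_zero G 0)
  exact (sq_fibred G).eq_zero_of_flow (fun _ _ _ => sq_fibre_rel G _ 1) (fun _ => h _)
    (fun _ _ _ => h _) x hx

theorem sq_flow_of_not_adj {v w : V} (h : ¬ G.Adj v w) {n : ℕ}
    (x : singHomology (n + 1) (Realization G × Realization G)) :
    flow (sqFst G) (sqSnd G) (v, w) x = 0 :=
  flow_eq_zero_of_half_empty (Set.eq_empty_of_forall_notMem fun e he =>
    (Set.eq_empty_iff_forall_notMem.1 (half_toCpx_eq_empty h)) e.1 he) x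

instance : Module.Free ℤ (singHomology 1 (Realization G)) := (isSubcomplex_toCpx G).free

instance : Module.Finite ℤ (singHomology 1 (Realization G)) :=
  Module.Finite.of_injective _ (isSubcomplex_toCpx G).flowsZ_injective

/-- Expanding the flows of a class of Γ × Γ, which are elements of H_1(Γ), in a basis of H_1(Γ)
gives one integral flow for each basis element, that is one element of H_1(Γ): these are the
coefficients of a unique tensor. -/
theorem crossProduct_bijective :
    Function.Bijective (crossProduct (Realization G) (Realization G)) := by
  let B := Module.Free.chooseBasis ℤ (singHomology 1 (Realization G))
  constructor
  · rw [injective_iff_map_eq_zero]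
    intro t ht
    -- Write t as a sum of b i ⊗ B i. Its flow through d is the combination of the basis with
    -- coefficients the flows of the b i, so these all vanish.
    obtain ⟨b, rfl⟩ := TensorProduct.eq_repr_basis_right B t
    have hb : ∀ d, ∑ i, flowZ (toCpx G) d (b i) • B i = 0 := fun d => by
      have h := congrArg (flow (sqFst G) (sqSnd G) d) ht
      rw [map_zero, Finsupp.sum_fintype b _ fun i => TensorProduct.zero_tmul _ (B i), map_sum,
        map_sum] at h
      rw [← h]
      exact Finset.sum_congr rfl fun i _ => (flow_crossProduct _ _ _ _).symm
    have hb0 : b = 0 := Finsupp.ext fun i => (isSubcomplex_toCpx G).eq_zero_of_flowZ fun d =>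
      Fintype.linearIndependent_iff.1 B.linearIndependent _ (hb d) i
    rw [hb0, Finsupp.sum_zero_index]
  · intro u
    -- The i-th coordinates of the flows of u are again antisymmetric and conserved and vanish off
    -- the edges, so they are realised by a class.
    have hx : ∀ i, ∃ x : singHomology 1 (Realization G), ∀ d, flowZ (toCpx G) d x =
        B.repr (flow (sqFst G) (sqSnd G) d u) i := fun i => by
      refine exists_flowZ_eq G (fun d => B.repr (flow (sqFst G) (sqSnd G) d u) i)
        (fun v w h => ?_) (fun v w => ?_) fun v => ?_
      · rw [sq_flow_of_not_adj G h, map_zero, Finsupp.zero_apply]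
      · rw [eq_neg_of_add_eq_zero_right (flow_add_swap v w u), map_neg, Finsupp.neg_apply]
      · rw [← Finsupp.finsetSum_apply, ← map_sum, sum_flow, map_zero, Finsupp.zero_apply]
    choose x hx using hx
    refine ⟨∑ i, x i ⊗ₜ B i, ?_⟩
    rw [← sub_eq_zero]
    refine sq_eq_zero_of_flow G _ fun d => ?_
    rw [map_sub, map_sum, map_sum, sub_eq_zero]
    refine Eq.trans (Finset.sum_congr rfl fun i _ => flow_crossProduct (toCpx G) d (x i) (B i)) ?_
    simp only [hx]
    exact B.sum_repr _

theorem discConf_of_support {x x' y y' : Realization G} (h : (x, y) ∈ discConf G)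
    (hx : Function.support x'.1 ⊆ Function.support x.1)
    (hy : Function.support y'.1 ⊆ Function.support y.1) : (x', y') ∈ discConf G := by
  rw [mem_discConf] at h ⊢
  refine fun v => (h v).imp (fun hv => ?_) fun hv => ?_
  · by_contra h'
    exact hx h' hv
  · by_contra h'
    exact hy h' hv

theorem disc_fibred : Fibred ((sqFst G).comp (incl (discConf G)))
    ((sqSnd G).comp (incl (discConf G))) where
  inducing := (sq_inducing G).comp Topology.IsInducing.subtypeVal
  exists_of_support := by
    rintro ⟨⟨x, y⟩, h⟩ x' hx'
    obtain ⟨z, rfl⟩ := exists_toCpx_eq x x' hx'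
    exact ⟨⟨(z, y), discConf_of_support G h hx' subset_rfl⟩, rfl, rfl⟩

theorem disc_fibre (x' : Cpx V) : IsSubcomplex ((toCpx G).comp
    (incl (fibre ((sqFst G).comp (incl (discConf G))) ((sqSnd G).comp (incl (discConf G))) x'))) where
  inducing := (toCpx_inducing G).comp Topology.IsInducing.subtypeVal
  exists_of_support := by
    rintro ⟨_, ⟨⟨⟨x, y⟩, h⟩, rfl, rfl⟩⟩ y' hy'
    obtain ⟨z, rfl⟩ := exists_toCpx_eq y y' hy'
    exact ⟨⟨z, ⟨⟨(x, z), discConf_of_support G h subset_rfl hy'⟩, rfl, rfl⟩⟩, rfl⟩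

/-- The fibres of D are subcomplexes of Γ: their H_1 injects into H_1(Γ) and their H_2 vanishes, so
flows valued in H_1(Γ) detect H_2(D). By naturality these flows depend only on the image in H_2(Γ ×
Γ). -/
theorem hmap_incl_discConf_injective : Function.Injective (hmap (incl (discConf G)) 2) := by
  rw [injective_iff_map_eq_zero]
  intro x hx
  refine (disc_fibred G).eq_zero_of_flow
    (fun v w hvw => cyclesBoundRel_of_injective (disc_fibre G _).hmap_injective)
    (fun v => cyclesBound_of_homology (disc_fibre G _).homology_eq_zero)
    (fun v w hvw => cyclesBound_of_homology (disc_fibre G _).homology_eq_zero) x fun d => ?_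
  have h := flow_hmap (p := sqFst G) (q := sqSnd G) (incl (discConf G)) _
    ((sqSnd G).comp (incl (discConf G))) (ContinuousMap.id _) rfl rfl d x
  rw [hx, map_zero, hmap_id] at h
  exact h.symm

end ProductGraph

/-! ### Homology of the square in dimension one -/

section Connected

variable {V : Type} [Fintype V] {E : Type} [TopologicalSpace E]

theorem IsSubcomplex.joined {p : C(E, Cpx V)} (h : IsSubcomplex p) {S : Set E} {x' : Cpx V}
    (hS : Contractible p S x') {a b : E} (ha : a ∈ S) (hb : b ∈ S) : Joined a b := by
  obtain ⟨i, hi⟩ := h.fibred.exists_section x'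
  obtain ⟨ρ, ⟨H⟩, hρ⟩ := h.fibred.exists_homotopy hS i hi
  have hu : () ∈ fibre p (ContinuousMap.const E ()) x' := h.fibred.mapsTo_fibre hS ha
  have hj : ∀ e ∈ S, Joined e (i ⟨(), hu⟩) := fun e he =>
    ⟨((H.evalAt ⟨e, he⟩).map continuous_subtype_val).cast rfl (hρ ⟨e, he⟩ hu).symm⟩
  exact (hj a ha).trans (hj b hb).symm

theorem vertexPt_mem_star (G : SimpleGraph V) (v : V) : vertexPt G v ∈ star (toCpx G) v := by
  change 1 / 2 < (vertexPt G v).1 v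
  rw [vertexPt_self]
  norm_num

theorem joined_vertexPt_edgePt {G : SimpleGraph V} {v w : V} (h : G.Adj v w) :
    Joined (vertexPt G v) (edgePt h) :=
  (isSubcomplex_toCpx G).joined (contractible_star _ v) (vertexPt_mem_star G v)
    (half_subset_star _ _ (edgePt_mem_half h))

theorem joined_vertexPt_of_adj {G : SimpleGraph V} {v w : V} (h : G.Adj v w) :
    Joined (vertexPt G v) (vertexPt G w) := by
  classical
  refine (joined_vertexPt_edgePt h).trans (Joined.trans ?_ (joined_vertexPt_edgePt h.symm).symm)
  refine (isSubcomplex_toCpx G).joined (contractible_edge _ h.ne)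
    (half_subset_edge _ _ (edgePt_mem_half h)) ?_
  rw [Finset.pair_comm]
  exact half_subset_edge _ _ (edgePt_mem_half h.symm)

theorem exists_joined_vertexPt {G : SimpleGraph V} (x : Realization G) :
    ∃ v, Joined x (vertexPt G v) := by
  classical
  have hx : x ∈ (⋃ v, star (toCpx G) v) ∪ ⋃ s, edge (toCpx G) s := by
    have h := cover_star_edge (toCpx G)
    rw [(isOpen_iUnion (isOpen_star (toCpx G))).interior_eq,
      (isOpen_iUnion (isOpen_edge (toCpx G))).interior_eq] at h
    rw [h]
    trivial
  rcases hx with hx | hx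
  · obtain ⟨v, hv⟩ := Set.mem_iUnion.1 hx
    exact ⟨v, (isSubcomplex_toCpx G).joined (contractible_star _ v) hv (vertexPt_mem_star G v)⟩
  · obtain ⟨s, hs⟩ := Set.mem_iUnion.1 hx
    obtain ⟨v, w, hvw, rfl⟩ := Finset.card_eq_two.1 hs.1
    have hadj : G.Adj v w := adj_of_pos hvw (hs.2 v (by simp)) (hs.2 w (by simp))
    exact ⟨v, ((isSubcomplex_toCpx G).joined (contractible_edge _ hvw) hs
      (half_subset_edge _ _ (edgePt_mem_half hadj))).trans (joined_vertexPt_edgePt hadj).symm⟩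

theorem pathConnectedSpace_realization {G : SimpleGraph V} (hG : G.Connected) :
    PathConnectedSpace (Realization G) where
  nonempty := ⟨vertexPt G hG.nonempty.some⟩
  joined x y := by
    obtain ⟨v, hv⟩ := exists_joined_vertexPt x
    obtain ⟨w, hw⟩ := exists_joined_vertexPt y
    refine hv.trans (Joined.trans ?_ hw.symm)
    clear hv hw
    obtain ⟨p⟩ := hG.preconnected v w
    induction p with
    | nil => exact Joined.refl _
    | cons h p ih => exact (joined_vertexPt_of_adj h).trans ih

end Connected

/-! ### First homology of the square through its two projections -/

section Square

variable {X Y : Type} [TopologicalSpace X] [TopologicalSpace Y]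

/-- The inclusion of a fibre of the first projection. -/
def inFst (Y : Type) [TopologicalSpace Y] (x : X) : C(Y, X × Y) :=
  (ContinuousMap.const Y x).prodMk (ContinuousMap.id Y)

/-- The inclusion of a fibre of the second projection. -/
def inSnd (X : Type) [TopologicalSpace X] (y : Y) : C(X, X × Y) :=
  (ContinuousMap.id X).prodMk (ContinuousMap.const X y)

theorem inFst_homotopic {x x' : X} (h : Joined x x') :
    (inFst Y x).Homotopic (inFst Y x') := by
  obtain ⟨γ⟩ := h
  exact ⟨{ toFun := fun t => (γ t.1, t.2)
           continuous_toFun := by fun_prop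
           map_zero_left := fun y => Prod.ext γ.source rfl
           map_one_left := fun y => Prod.ext γ.target rfl }⟩

theorem hmap_const (y : Y) {n : ℕ} (x : singHomology (n + 1) X) :
    hmap (ContinuousMap.const X y) (n + 1) x = 0 := by
  have h := hmap_comp (ContinuousMap.const Unit y) (ContinuousMap.const X ()) x
  rw [homology_eq_zero_of_totallyDisconnected (hmap (ContinuousMap.const X ()) (n + 1) x),
    map_zero] at h
  exact h.symm

variable {V : Type} [Fintype V] {G : SimpleGraph V}

/-- A cycle over a contractible piece slides into a single fibre {x₁} × Γ, and a path from x₁ to x₀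
carries that fibre to the reference one. -/
theorem sq_eq_inFst_of_contractible (hG : G.Connected) {S : Set (Realization G × Realization G)}
    {x' : Cpx V} (hS : Contractible (sqFst G) S x') {n : ℕ}
    (c : cyc (singChains (Realization G × Realization G)) n) (hc : c.1 ∈ chainsIn S n)
    (x₀ : Realization G) :
    scls c = hmap (inFst _ x₀) n (hmap (sqSnd G) n (scls c)) := by
  have := pathConnectedSpace_realization hG
  rcases S.eq_empty_or_nonempty with rfl | ⟨e, he⟩
  · have h0 : c = 0 := Subtype.ext (chainsIn_empty n hc)
    rw [h0, map_zero, map_zero, map_zero]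
  obtain ⟨⟨x₁, y⟩, rfl, -⟩ := (sq_fibred G).mapsTo_fibre hS he
  let F := fibre (sqFst G) (sqSnd G) (sqFst G (x₁, y))
  let i : C(F, Realization G × Realization G) := (inFst _ x₁).comp (incl F)
  obtain ⟨f, -, hf⟩ := (sq_fibred G).exists_dd_eq_sub hS i (fun y => ⟨rfl, rfl⟩) hc c.2
  rw [← hmap_homotopic (inFst_homotopic (PathConnectedSpace.joined x₁ x₀)), hmap_scls, hmap_scls,
    scls_eq_iff]
  refine ⟨f, hf.trans (congrArg (c.1 - ·) ?_)⟩
  change push i (corestr F (push (sqSnd G) c.1)) = push (inFst _ x₁) (push (sqSnd G) c.1)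
  have hq : push (sqSnd G) c.1 ∈ chainsIn F n :=
    push_mem_chainsIn (A := S) (sqSnd G) ((sq_fibred G).mapsTo_fibre hS) hc
  conv_rhs => rw [← push_corestr hq, push_push]

theorem sq_eq_inFst_of_flow (hG : G.Connected) {n : ℕ}
    (x : singHomology (n + 1) (Realization G × Realization G))
    (hx : ∀ d, flow (sqFst G) (sqSnd G) d x = 0) (x₀ : Realization G) :
    x = hmap (inFst _ x₀) (n + 1) (hmap (sqSnd G) (n + 1) x) := by
  classical
  obtain ⟨z, rfl⟩ := scls_surjective x
  obtain ⟨α, β, e, hα, hβ, hz⟩ := exists_eq_sum_of_flow_eq_zero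
    ((sq_fibred G).half_rel fun _ _ _ => sq_fibre_rel G _ n) z hx
  have hz' : scls z = ∑ v, scls ⟨α v, (hα v).2⟩ + ∑ s, scls ⟨β s, (hβ s).2⟩ := by
    rw [← map_sum, ← map_sum, ← map_add, scls_eq_iff]
    refine ⟨e, ?_⟩
    rw [hz, AddSubgroup.coe_add, AddSubgroup.val_finsetSum, AddSubgroup.val_finsetSum]
    abel
  have hβ' : ∀ s, scls ⟨β s, (hβ s).2⟩ =
      hmap (inFst _ x₀) (n + 1) (hmap (sqSnd G) (n + 1) (scls ⟨β s, (hβ s).2⟩)) := fun s => by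
    by_cases hs : s.card = 2
    · obtain ⟨a, b, hab, rfl⟩ := Finset.card_eq_two.1 hs
      exact sq_eq_inFst_of_contractible hG (contractible_edge _ hab) _ (hβ _).1 x₀
    · have h0 := (hβ s).1
      rw [edge_eq_empty hs] at h0
      have h1 : (⟨β s, (hβ s).2⟩ : cyc _ _) = 0 := Subtype.ext (chainsIn_empty _ h0)
      rw [h1, map_zero, map_zero, map_zero]
  rw [hz', map_add, map_add, map_sum, map_sum, map_sum, map_sum]
  exact congrArg₂ (· + ·) (Finset.sum_congr rfl fun v _ =>
    sq_eq_inFst_of_contractible hG (contractible_star _ v) _ (hα v).1 x₀)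
    (Finset.sum_congr rfl fun s _ => hβ' s)

/-- The map on homology in dimension one induced by the two projections. -/
noncomputable def sqProj (G : SimpleGraph V) :
    singHomology 1 (Realization G × Realization G) →+
      singHomology 1 (Realization G) × singHomology 1 (Realization G) :=
  (hmap ContinuousMap.fst 1).prod (hmap ContinuousMap.snd 1)

theorem sqProj_inFst (x₀ : Realization G) (a : singHomology 1 (Realization G)) :
    sqProj G (hmap (inFst _ x₀) 1 a) = (0, a) := by
  refine Prod.ext ?_ ?_
  · exact (hmap_comp _ _ _).trans (hmap_const x₀ a)
  · exact (hmap_comp _ _ _).trans (hmap_id a)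

theorem sqProj_inSnd (x₀ : Realization G) (a : singHomology 1 (Realization G)) :
    sqProj G (hmap (inSnd _ x₀) 1 a) = (a, 0) := by
  refine Prod.ext ?_ ?_
  · exact (hmap_comp _ _ _).trans (hmap_id a)
  · exact (hmap_comp _ _ _).trans (hmap_const x₀ a)

theorem sqProj_bijective (hG : G.Connected) : Function.Bijective (sqProj G) := by
  have := pathConnectedSpace_realization hG
  obtain ⟨x₀⟩ := PathConnectedSpace.nonempty (X := Realization G)
  constructor
  · rw [injective_iff_map_eq_zero]
    intro x hx
    have h1 : hmap ContinuousMap.fst 1 x = 0 := congrArg Prod.fst hx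
    have h2 : hmap (sqSnd G) 1 x = 0 := congrArg Prod.snd hx
    -- The flows of x lie in H_0(Γ), which the augmentation embeds in ℤ as Γ is path connected.
    -- Their augmentations are the integral flows of the first projection of x, which is zero.
    rw [sq_eq_inFst_of_flow hG x (fun d => augH_injective ?_) x₀, h2, map_zero]
    have h3 := flow_hmap (p := sqFst G) (q := ContinuousMap.const _ ()) (ContinuousMap.id _)
      (sqFst G) (sqSnd G) (ContinuousMap.const _ ()) rfl rfl d x
    rw [hmap_id] at h3
    have h4 : flowZ (sqFst G) d x = 0 := by
      rw [← flowZ_hmap, h1, map_zero]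
    rw [map_zero, ← h4, flowZ, AddMonoidHom.comp_apply, h3, augH_hmap]
  · rintro ⟨a, b⟩
    refine ⟨hmap (inSnd _ x₀) 1 a + hmap (inFst _ x₀) 1 b, ?_⟩
    rw [map_add, sqProj_inFst, sqProj_inSnd, Prod.mk_add_mk, add_zero, zero_add]

end Square

/-! ### Cycle graphs are circles -/

section CircleGraph

variable {n : ℕ}

/-- The tent function on a circle of length `n` at the integral point `k`. -/
noncomputable def tent (t : AddCircle (n : ℝ)) (k : ZMod n) : ℝ :=
  max 0 (1 - ‖t - ((k.val : ℝ) : AddCircle (n : ℝ))‖)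

theorem continuous_tent (k : ZMod n) : Continuous fun t : AddCircle (n : ℝ) => tent t k :=
  continuous_const.max (continuous_const.sub (continuous_id.sub continuous_const).norm)

theorem coe_int_add_eq {a b : ℤ} (h : (a : ZMod n) = b) (s : ℝ) :
    ((a + s : ℝ) : AddCircle (n : ℝ)) = ((b + s : ℝ) : AddCircle (n : ℝ)) := by
  obtain ⟨r, hr⟩ := (ZMod.intCast_eq_intCast_iff_dvd_sub a b n).1 h
  refine (QuotientAddGroup.eq (s := AddSubgroup.zmultiples (n : ℝ))).2
    (AddSubgroup.mem_zmultiples_iff.2 ⟨r, ?_⟩)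
  have hr' : (b : ℝ) - a = n * r := by exact_mod_cast hr
  rw [zsmul_eq_mul]
  linarith

theorem tent_eq (hn : 3 ≤ n) (m : ℤ) {s : ℝ} (hs : 0 ≤ s) (hs1 : s < 1) (k : ZMod n) :
    tent ((m + s : ℝ) : AddCircle (n : ℝ)) k =
      if k = m then 1 - s else if k = m + 1 then s else 0 := by
  have hn0 : NeZero n := ⟨by omega⟩
  have hnR : (3 : ℝ) ≤ n := by exact_mod_cast hn
  have hn' : (n : ℝ) ≠ 0 := by positivity
  have hk : ((k.val : ℤ) : ZMod n) = k := by rw [Int.cast_natCast, ZMod.natCast_zmod_val]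
  have h1 : ((m + s : ℝ) : AddCircle (n : ℝ)) - ((k.val : ℝ) : AddCircle (n : ℝ)) =
      (((m - k.val : ℤ) + s : ℝ) : AddCircle (n : ℝ)) := by
    rw [← AddCircle.coe_sub]
    congr 1
    push_cast
    ring
  rw [tent, h1]
  split_ifs with h h'
  · rw [coe_int_add_eq (b := 0) (by push_cast; rw [ZMod.natCast_zmod_val, h, sub_self]) s,
      Int.cast_zero, zero_add, (AddCircle.norm_coe_eq_abs_iff _ hn').2, abs_of_nonneg hs]
    · exact max_eq_right (by linarith)
    · rw [abs_of_nonneg hs, abs_of_nonneg (by linarith)]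
      linarith
  · rw [coe_int_add_eq (b := -1) (by push_cast; rw [ZMod.natCast_zmod_val, h']; ring) s,
      (AddCircle.norm_coe_eq_abs_iff _ hn').2]
    · push_cast
      rw [abs_of_nonpos (by linarith)]
      rw [max_eq_right (by linarith)]
      ring
    · push_cast
      rw [abs_of_nonpos (by linarith), abs_of_nonneg (by linarith)]
      linarith
  -- After subtracting the nearest multiple of n, the difference is an integer plus s. The integer
  -- is neither 0 nor -1 because k is neither m nor m + 1, so the distance is at least 1.
  · refine max_eq_left (sub_nonpos.2 ?_)
    rw [AddCircle.norm_eq]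
    set r := round ((n : ℝ)⁻¹ * ((m - k.val : ℤ) + s))
    have h2 : (((m - k.val : ℤ) : ℝ) + s - r * n) = ((m - k.val - r * n : ℤ) : ℝ) + s := by
      push_cast
      ring
    rw [h2]
    have h3 : ((m - k.val - r * n : ℤ) : ZMod n) = m - k := by
      push_cast
      rw [ZMod.natCast_zmod_val, ZMod.natCast_self, mul_zero, sub_zero]
    have h4 : m - k.val - r * n ≠ 0 := fun h0 => h (by
      rw [h0, Int.cast_zero] at h3
      exact (sub_eq_zero.1 h3.symm).symm)
    have h5 : m - k.val - r * n ≠ -1 := fun h0 => h' (by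
      rw [h0, Int.cast_neg, Int.cast_one] at h3
      rw [← sub_eq_iff_eq_add', ← neg_sub, ← h3, neg_neg])
    rcases lt_or_ge (m - k.val - r * n) 0 with h6 | h6
    · have h7 : m - k.val - r * n ≤ -2 := by omega
      have h8 : ((m - k.val - r * n : ℤ) : ℝ) ≤ -2 := by exact_mod_cast h7
      exact le_abs.2 (Or.inr (by linarith))
    · have h7 : 1 ≤ m - k.val - r * n := by omega
      have h8 : 1 ≤ ((m - k.val - r * n : ℤ) : ℝ) := by exact_mod_cast h7
      exact le_abs.2 (Or.inl (by linarith))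

theorem exists_eq_int_add (t : AddCircle (n : ℝ)) :
    ∃ (m : ℤ) (s : ℝ), 0 ≤ s ∧ s < 1 ∧ t = ((m + s : ℝ) : AddCircle (n : ℝ)) := by
  obtain ⟨x, rfl⟩ := QuotientAddGroup.mk_surjective t
  exact ⟨⌊x⌋, Int.fract x, Int.fract_nonneg x, Int.fract_lt_one x,
    congrArg _ (Int.floor_add_fract x).symm⟩

theorem ZMod_add_one_ne (hn : 3 ≤ n) (k : ZMod n) : k + 1 ≠ k := by
  have : Fact (1 < n) := ⟨by omega⟩
  exact fun h => one_ne_zero (add_eq_left.1 h)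

/-- The coordinate at m is 1 - s > 0, so different starting points m and m' must each be the
successor of the other. Then 2 = 0 modulo n, which n ≥ 3 excludes. -/
theorem tent_injective (hn : 3 ≤ n) {t t' : AddCircle (n : ℝ)} (h : ∀ k, tent t k = tent t' k) :
    t = t' := by
  obtain ⟨m, s, hs, hs1, rfl⟩ := exists_eq_int_add t
  obtain ⟨m', s', hs', hs1', rfl⟩ := exists_eq_int_add t'
  simp only [tent_eq hn _ hs hs1, tent_eq hn _ hs' hs1'] at h
  have h1 := h m
  have h2 := h m'
  rw [if_pos rfl] at h1 h2
  by_cases hm : (m : ZMod n) = m'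
  · rw [if_pos hm] at h1
    rw [coe_int_add_eq hm, show s = s' by linarith]
  · exfalso
    rw [if_neg hm] at h1
    rw [if_neg (Ne.symm hm)] at h2
    have h3 : (m : ZMod n) = m' + 1 := by
      by_contra h0
      rw [if_neg h0] at h1
      linarith
    have h4 : (m' : ZMod n) = m + 1 := by
      by_contra h0
      rw [if_neg h0] at h2
      linarith
    rw [h4, add_assoc] at h3
    have h5 : ((2 : ℕ) : ZMod n) = 0 := by
      push_cast
      rw [← one_add_one_eq_two]
      exact add_eq_left.1 h3.symm
    have := Nat.le_of_dvd (by norm_num) ((ZMod.natCast_eq_zero_iff 2 n).1 h5)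
    omega

variable {V : Type} [Fintype V] {G : SimpleGraph V}

/-- The realization of a graph isomorphic to a cycle graph is a circle. -/
theorem nonempty_homeomorph_circle (hn : 3 ≤ n) (e : V ≃ ZMod n)
    (he : ∀ v w, G.Adj v w ↔ e w = e v + 1 ∨ e v = e w + 1) :
    Nonempty (Realization G ≃ₜ Circle) := by
  classical
  have hnR : (0 : ℝ) < n := by
    have : 0 < n := by omega
    exact_mod_cast this
  have : Fact ((0 : ℝ) < n) := ⟨hnR⟩
  have hmem : ∀ t : AddCircle (n : ℝ), (fun v => tent t (e v)) ∈ stdSimplex ℝ V ∧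
      ((∃ v, Function.support (fun v => tent t (e v)) ⊆ {v}) ∨
        ∃ u v, G.Adj u v ∧ Function.support (fun v => tent t (e v)) ⊆ {u, v}) := by
    intro t
    obtain ⟨m, s, hs, hs1, rfl⟩ := exists_eq_int_add t
    simp only [tent_eq hn m hs hs1]
    have hne : e.symm m ≠ e.symm (m + 1) := fun h =>
      ZMod_add_one_ne hn m (e.symm.injective h).symm
    refine ⟨⟨fun v => ?_, ?_⟩, Or.inr ⟨e.symm m, e.symm (m + 1), (he _ _).2 (Or.inl ?_),
      fun v hv => ?_⟩⟩
    · dsimp only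
      split_ifs <;> linarith
    · rw [← Finset.sum_subset (Finset.subset_univ {e.symm m, e.symm (m + 1)}), Finset.sum_pair hne]
      · simp [ZMod_add_one_ne hn]
      · intro v _ hv
        simp only [Finset.mem_insert, Finset.mem_singleton, not_or] at hv
        rw [if_neg fun h => hv.1 (e.eq_symm_apply.2 h), if_neg fun h => hv.2 (e.eq_symm_apply.2 h)]
    · simp
    · simp only [Set.mem_insert_iff, Set.mem_singleton_iff, e.eq_symm_apply]
      by_contra! h
      exact hv (by simp [h.1, h.2])
  let φ : AddCircle (n : ℝ) → Realization G := fun t => ⟨_, hmem t⟩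
  have hφ : Continuous φ := Continuous.subtype_mk
    (continuous_pi fun v => continuous_tent (e v)) _
  have hinj : Function.Injective φ := fun t t' h => tent_injective hn fun k => by
    have := congrFun (congrArg Subtype.val h) (e.symm k)
    simpa [φ] using this
  -- The parameter is the position of v plus the coordinate at w. The case of coordinate 1, where
  -- the fractional part would be 1, is a vertex and is treated through its outgoing edge in `key1`.
  have key : ∀ (x : Realization G) (v w : V), e w = e v + 1 → Function.support x.1 ⊆ {v, w} →
      x.1 w < 1 → ∃ t, φ t = x := by
    intro x v w hvw hx hlt
    have : NeZero n := ⟨by omega⟩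
    have hne : v ≠ w := fun h => ZMod_add_one_ne hn (e v) (by rw [← hvw, h])
    have hsum : x.1 v + x.1 w = 1 := by
      rw [← Finset.sum_pair hne, ← sum_coord x]
      refine Finset.sum_subset (Finset.subset_univ _) fun u _ hu => ?_
      by_contra h
      exact hu (by simpa using hx h)
    refine ⟨(((e v).val : ℤ) + x.1 w : ℝ), realization_ext fun u => ?_⟩
    change tent _ (e u) = _
    rw [tent_eq hn _ (coord_nonneg x w) hlt, Int.cast_natCast, ZMod.natCast_zmod_val]
    split_ifs with h1 h2
    · rw [e.injective h1]
      linarith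
    · rw [← hvw] at h2
      rw [e.injective h2]
    · by_contra h
      rcases hx (Ne.symm h) with h | h
      · exact h1 (by rw [h])
      · exact h2 (by rw [h, hvw])
  have key1 : ∀ (x : Realization G) (v : V), Function.support x.1 ⊆ {v} → ∃ t, φ t = x := by
    intro x v hx
    have hne : v ≠ e.symm (e v + 1) := fun h => ZMod_add_one_ne hn (e v) (by
      rw [← e.eq_symm_apply.1 h])
    refine key x v (e.symm (e v + 1)) (by simp) (hx.trans (by simp)) ?_
    have h0 : x.1 (e.symm (e v + 1)) = 0 := by
      by_contra h
      exact hne (hx h).symm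
    rw [h0]
    exact one_pos
  have key2 : ∀ (x : Realization G) (v w : V), e w = e v + 1 → Function.support x.1 ⊆ {v, w} →
      ∃ t, φ t = x := by
    intro x v w hvw hx
    rcases lt_or_eq_of_le (coord_le_one x w) with h | h
    · exact key x v w hvw hx h
    · refine key1 x w fun u hu => ?_
      by_contra hne
      have h1 := add_le_one x hne
      have h2 : 0 < x.1 u := lt_of_le_of_ne (coord_nonneg x u) (Ne.symm hu)
      linarith
  have hsurj : Function.Surjective φ := by
    intro x
    rcases x.2.2 with ⟨v, hv⟩ | ⟨v, w, hadj, hs⟩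
    · exact key1 x v hv
    · rcases (he v w).1 hadj with h | h
      · exact key2 x v w h hs
      · exact key2 x w v h (by rwa [Set.pair_comm])
  exact ⟨(Continuous.homeoOfEquivCompactToT2 (f := Equiv.ofBijective φ ⟨hinj, hsurj⟩) hφ).symm.trans
    (AddCircle.homeomorphCircle hnR.ne')⟩

end CircleGraph

/-! ### Flows on graphs and cycles -/

section Combinatorics

variable {V : Type} {G : SimpleGraph V}

open Classical in
/-- The integral flow carried by a walk. -/
noncomputable def walkFlow {u v : V} (p : G.Walk u v) (d : V × V) : ℤ :=
  (p.darts.map fun e =>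
    (if d = (e.fst, e.snd) then 1 else 0) - (if d = (e.snd, e.fst) then 1 else 0)).sum

theorem walkFlow_nil (u : V) (d : V × V) : walkFlow (SimpleGraph.Walk.nil : G.Walk u u) d = 0 :=
  rfl

open Classical in
theorem walkFlow_cons {u v w : V} (h : G.Adj u v) (p : G.Walk v w) (d : V × V) :
    walkFlow (SimpleGraph.Walk.cons h p) d =
      (if d = (u, v) then 1 else 0) - (if d = (v, u) then 1 else 0) + walkFlow p d := by
  simp [walkFlow]

theorem walkFlow_swap {u v : V} (p : G.Walk u v) (a b : V) :
    walkFlow p (b, a) = - walkFlow p (a, b) := by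
  induction p with
  | nil => simp [walkFlow_nil]
  | cons h p ih =>
    rw [walkFlow_cons, walkFlow_cons, ih]
    split_ifs <;> grind

theorem walkFlow_of_notMem {u v : V} (p : G.Walk u v) {a b : V} (h : s(a, b) ∉ p.edges) :
    walkFlow p (a, b) = 0 := by
  induction p with
  | nil => rfl
  | cons h' p ih =>
    rw [SimpleGraph.Walk.edges_cons, List.mem_cons, not_or] at h
    rw [walkFlow_cons, ih h.2, if_neg, if_neg]
    · ring
    · intro h0
      obtain ⟨rfl, rfl⟩ := Prod.mk.inj h0
      exact h.1 Sym2.eq_swap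
    · intro h0
      obtain ⟨rfl, rfl⟩ := Prod.mk.inj h0
      exact h.1 rfl

open Classical in
-- The contributions of successive darts telescope, leaving source minus sink; hence closed walks
-- carry conserved flows.
theorem sum_walkFlow [Fintype V] {u v : V} (p : G.Walk u v) (a : V) :
    ∑ b, walkFlow p (a, b) = (if a = u then 1 else 0) - (if a = v then 1 else 0) := by
  induction p with
  | nil => simp [walkFlow_nil]
  | @cons u v w h p ih =>
    simp only [walkFlow_cons, Finset.sum_add_distrib, Finset.sum_sub_distrib, ih, Prod.mk.injEq]
    have h1 : ∀ x y : V, ∑ b, (if a = x ∧ b = y then (1 : ℤ) else 0) = if a = x then 1 else 0 := by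
      intro x y
      by_cases hx : a = x <;> simp [hx]
    rw [h1, h1]
    ring

/-- An edge with nonzero flow is not a bridge. -/
theorem exists_walk_of_flow_ne_zero [Fintype V] (f : V × V → ℤ)
    (hadj : ∀ v w, ¬ G.Adj v w → f (v, w) = 0) (hswap : ∀ v w, f (w, v) = - f (v, w))
    (hsum : ∀ v, ∑ w, f (v, w) = 0) {u v : V} (hf : f (u, v) ≠ 0) :
    ∃ p : G.Walk u v, s(u, v) ∉ p.edges := by
  classical
  rw [← SimpleGraph.reachable_deleteEdges_iff_exists_walk]
  by_contra hv
  -- If uv were a bridge, take S to be the side of u. The flow out of S is zero by antisymmetry and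
  -- conservation, yet the only edge leaving S is uv.
  let S : Finset V := Finset.univ.filter fun a => (G.deleteEdges {s(u, v)}).Reachable u a
  have hu : u ∈ S := by simp [S]
  have hvS : v ∈ Sᶜ := by simp [S, hv]
  have h1 : ∑ a ∈ S, ∑ b ∈ S, f (a, b) = 0 := by
    have h2 : ∑ a ∈ S, ∑ b ∈ S, f (a, b) = - ∑ a ∈ S, ∑ b ∈ S, f (a, b) := by
      rw [← Finset.sum_neg_distrib, Finset.sum_comm]
      refine Finset.sum_congr rfl fun a _ => ?_
      rw [← Finset.sum_neg_distrib]
      exact Finset.sum_congr rfl fun b _ => hswap _ _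
    omega
  have h3 : ∑ a ∈ S, ∑ b ∈ Sᶜ, f (a, b) = 0 := by
    have h4 : ∑ a ∈ S, (∑ b ∈ S, f (a, b) + ∑ b ∈ Sᶜ, f (a, b)) = 0 :=
      Finset.sum_eq_zero fun a _ => by rw [Finset.sum_add_sum_compl, hsum]
    rw [Finset.sum_add_distrib, h1, zero_add] at h4
    exact h4
  have h5 : ∀ a ∈ S, ∀ b ∈ Sᶜ, (a, b) ≠ (u, v) → f (a, b) = 0 := by
    intro a ha b hb hne
    refine hadj a b fun h => ?_
    simp only [S, Finset.mem_filter, Finset.mem_univ, true_and, Finset.mem_compl] at ha hb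
    by_cases he : s(a, b) = s(u, v)
    · rcases Sym2.eq_iff.1 he with ⟨rfl, rfl⟩ | ⟨rfl, rfl⟩
      · exact hne rfl
      · exact hb (SimpleGraph.Reachable.refl _)
    · exact hb (ha.trans (SimpleGraph.Adj.reachable (by
        rw [SimpleGraph.deleteEdges_adj]
        exact ⟨h, he⟩)))
  rw [Finset.sum_eq_single_of_mem u hu, Finset.sum_eq_single_of_mem v hvS] at h3
  · exact hf h3
  · intro b hb hne
    exact h5 u hu b hb fun h => hne (Prod.mk.inj h).2
  · intro a ha hne
    exact Finset.sum_eq_zero fun b hb => h5 a ha b hb fun h => hne (Prod.mk.inj h).1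

/-- The realization of a connected graph with a cycle through all edges is a circle. -/
theorem nonempty_homeomorph_circle_of_isCycle [Fintype V] (hG : G.Connected) {u : V}
    {p : G.Walk u u} (hp : p.IsCycle) (hall : ∀ a b, G.Adj a b → s(a, b) ∈ p.edges) :
    Nonempty (Realization G ≃ₜ Circle) := by
  have hn := hp.three_le_length
  have hn0 : NeZero p.length := ⟨by omega⟩
  have hfact : Fact (1 < p.length) := ⟨by omega⟩
  -- Indices may be taken modulo the length because the closed walk ends where it starts.
  let f : ZMod p.length → V := fun k => p.getVert k.val
  have hf : ∀ k, f (k + 1) = p.getVert (k.val + 1) := fun k => by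
    have hk := k.val_lt
    by_cases h : k.val + 1 < p.length
    · change p.getVert (k + 1).val = _
      rw [ZMod.val_add_of_lt (by rwa [ZMod.val_one]), ZMod.val_one]
    · have h1 : k.val + 1 = p.length := by omega
      have h2 : k + 1 = 0 := by
        rw [← ZMod.natCast_zmod_val k, ← Nat.cast_one, ← Nat.cast_add, h1, ZMod.natCast_self]
      change p.getVert (k + 1).val = _
      rw [h2, ZMod.val_zero, h1, SimpleGraph.Walk.getVert_zero, SimpleGraph.Walk.getVert_length]
  have hf' : ∀ i < p.length, f i = p.getVert i := fun i hi => by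
    change p.getVert (i : ZMod p.length).val = _
    rw [ZMod.val_natCast_of_lt hi]
  have hinj : Function.Injective f := fun k k' h => ZMod.val_injective _ (hp.getVert_injOn'
    (show k.val ≤ p.length - 1 by have := k.val_lt; omega)
    (show k'.val ≤ p.length - 1 by have := k'.val_lt; omega) h)
  have hsurj : Function.Surjective f := by
    intro v
    -- By connectedness a vertex other than u has an edge, and every edge belongs to the cycle.
    have hmem : v ∈ p.support := by
      by_cases hv : v = u
      · rw [hv]
        exact p.start_mem_support
      · obtain ⟨w⟩ := hG.preconnected v u
        cases w with
        | nil => exact absurd rfl hv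
        | cons h w => exact p.fst_mem_support_of_mem_edges (hall _ _ h)
    obtain ⟨i, hi, hle⟩ := SimpleGraph.Walk.mem_support_iff_exists_getVert.1 hmem
    rcases lt_or_eq_of_le hle with h | h
    · exact ⟨i, (hf' i h).trans hi⟩
    · refine ⟨0, ?_⟩
      change p.getVert (0 : ZMod p.length).val = v
      rw [ZMod.val_zero, SimpleGraph.Walk.getVert_zero, ← hi, h, SimpleGraph.Walk.getVert_length]
  let e := (Equiv.ofBijective f ⟨hinj, hsurj⟩).symm
  have hfe : ∀ v, f (e v) = v := fun v => (Equiv.ofBijective f ⟨hinj, hsurj⟩).apply_symm_apply v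
  have hadj : ∀ k, G.Adj (f k) (f (k + 1)) := fun k => by
    rw [hf]
    exact p.adj_getVert_succ k.val_lt
  refine nonempty_homeomorph_circle hn e fun v w => ⟨fun h => ?_, ?_⟩
  · obtain ⟨i, hi, hs⟩ := (p.mk_mem_edges_iff_exists).1 (hall v w h)
    have h2 : p.getVert (i + 1) = f ((i : ZMod p.length) + 1) := by
      rw [hf, ZMod.val_natCast_of_lt hi]
    rw [← hf' i hi, h2] at hs
    have hef : ∀ k, e (f k) = k := (Equiv.ofBijective f ⟨hinj, hsurj⟩).symm_apply_apply
    rcases Sym2.eq_iff.1 hs with ⟨rfl, rfl⟩ | ⟨rfl, rfl⟩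
    · left; rw [hef, hef]
    · right; rw [hef, hef]
  · rintro (h | h)
    · rw [← hfe v, ← hfe w, h]
      exact hadj _
    · rw [← hfe v, ← hfe w, h]
      exact (hadj _).symm

/-- The homology of a graph other than a circle is generated by the classes missing an edge. -/
theorem mem_of_flowZ_eq_zero_mem [Fintype V] (hG : G.Connected)
    (hcircle : ¬ Nonempty (Realization G ≃ₜ Circle))
    (M : AddSubgroup (singHomology 1 (Realization G)))
    (hM : ∀ u v, G.Adj u v → ∀ x, flowZ (toCpx G) (u, v) x = 0 → x ∈ M)
    (x : singHomology 1 (Realization G)) : x ∈ M := by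
  classical
  by_cases h0 : ∀ d, flowZ (toCpx G) d x = 0
  · rw [(isSubcomplex_toCpx G).eq_zero_of_flowZ h0]
    exact zero_mem M
  push Not at h0
  obtain ⟨⟨u, v⟩, huv⟩ := h0
  have hadj : G.Adj u v := by
    by_contra h
    exact huv (flowZ_of_not_adj h x)
  obtain ⟨p, hp⟩ := exists_walk_of_flow_ne_zero (fun d => flowZ (toCpx G) d x)
    (fun v w h => flowZ_of_not_adj h x) (fun v w => flowZ_swap v w x) (fun v => sum_flowZ v x) huv
  have hp' : s(v, u) ∉ (p.toPath : G.Walk u v).edges := fun h =>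
    hp (by rw [Sym2.eq_swap]; exact p.edges_toPath_subset_edges h)
  let c : G.Walk v v := SimpleGraph.Walk.cons hadj.symm (p.toPath : G.Walk u v)
  have hc : c.IsCycle := SimpleGraph.Path.cons_isCycle p.toPath hadj.symm hp'
  -- This is where the graph not being a circle is used: a cycle through all edges would make it
  -- one.
  obtain ⟨a, b, hab, hnot⟩ : ∃ a b, G.Adj a b ∧ s(a, b) ∉ c.edges := by
    by_contra! h
    exact hcircle (nonempty_homeomorph_circle_of_isCycle hG hc h)
  obtain ⟨y, hy⟩ := exists_flowZ_eq G (walkFlow c)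
    (fun v w h => walkFlow_of_notMem c fun h' => h (c.adj_of_mem_edges h'))
    (fun v w => walkFlow_swap c v w) fun v => by rw [sum_walkFlow, sub_self]
  have hyM : y ∈ M := hM a b hab y (by rw [hy, walkFlow_of_notMem c hnot])
  have hyv : flowZ (toCpx G) (v, u) y = 1 := by
    rw [hy, walkFlow_cons, if_pos rfl, if_neg fun h => hadj.ne (Prod.mk.inj h).2,
      walkFlow_of_notMem _ hp', sub_zero, add_zero]
  -- The cycle c crosses (v, u) exactly once, so subtracting this multiple of y removes the flow of
  -- x there; y itself misses the edge ab. Both pieces therefore lie in M.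
  have hx : x - flowZ (toCpx G) (v, u) x • y ∈ M := hM v u hadj.symm _ (by
    rw [map_sub, map_zsmul, hyv, smul_eq_mul, mul_one, sub_self])
  rw [← sub_add_cancel x (flowZ (toCpx G) (v, u) x • y)]
  exact add_mem hx (zsmul_mem hyM _)

end Combinatorics

/-! ### Surjectivity onto the first homology of the square -/

section Surjectivity

variable {V : Type} [Fintype V] {G : SimpleGraph V}

/-- A class without flow through an edge comes from the complement of this edge. -/
theorem exists_hmap_ofLE_eq {u v : V} {x : singHomology 1 (Realization G)}
    (hx : flowZ (toCpx G) (u, v) x = 0) :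
    ∃ y, hmap (ofLE (G.deleteEdges_le {s(u, v)})) 1 y = x := by
  obtain ⟨y, hy⟩ := exists_flowZ_eq (G.deleteEdges {s(u, v)}) (fun d => flowZ (toCpx G) d x)
    (fun a b h => by
      by_cases hab : G.Adj a b
      · have he : s(a, b) = s(u, v) := by
          by_contra h'
          exact h (by
            rw [SimpleGraph.deleteEdges_adj]
            exact ⟨hab, h'⟩)
        rcases Sym2.eq_iff.1 he with ⟨rfl, rfl⟩ | ⟨rfl, rfl⟩
        · exact hx
        · rw [flowZ_swap, hx, neg_zero]
      · exact flowZ_of_not_adj hab x)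
    (fun v w => flowZ_swap v w x) (fun v => sum_flowZ v x)
  refine ⟨y, (isSubcomplex_toCpx G).flowsZ_injective (funext fun d => ?_)⟩
  rw [flowsZ_apply, flowsZ_apply, flowZ_hmap]
  exact hy d

theorem ofLE_ne_edgePt {u v : V} (h : G.Adj u v)
    (y : Realization (G.deleteEdges {s(u, v)})) :
    ofLE (G.deleteEdges_le {s(u, v)}) y ≠ edgePt h := by
  intro heq
  have hc : ∀ w, y.1 w = (edgePt h).1 w := fun w => by rw [← heq, ofLE_apply]
  have h1 := adj_of_pos h.ne (x := y) (by rw [hc, edgePt_left]; norm_num)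
    (by rw [hc, edgePt_right]; norm_num)
  rw [SimpleGraph.deleteEdges_adj] at h1
  exact h1.2 rfl

/-- A class without flow through uv lives on the graph with that edge removed. Keeping the other
point at an interior point of uv lifts it to F, in either coordinate, and such classes generate both
summands. -/
theorem hmap_incl_confSpace_surjective (hG : G.Connected)
    (hcircle : ¬ Nonempty (Realization G ≃ₜ Circle)) :
    Function.Surjective (hmap (incl (confSpace G)) 1) := by
  let R := ((sqProj G).comp (hmap (incl (confSpace G)) 1)).range
  have hR1 : ∀ a, (a, 0) ∈ R := mem_of_flowZ_eq_zero_mem hG hcircle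
    (R.comap (AddMonoidHom.inl (singHomology 1 (Realization G)) (singHomology 1 (Realization G)))) fun u v h x hx => by
      obtain ⟨y, rfl⟩ := exists_hmap_ofLE_eq hx
      let k : C(Realization (G.deleteEdges {s(u, v)}), confSpace G) :=
        ⟨fun y => ⟨(ofLE (G.deleteEdges_le {s(u, v)}) y, edgePt h), ofLE_ne_edgePt h y⟩, by fun_prop⟩
      refine ⟨hmap k 1 y, ?_⟩
      refine Eq.trans ?_ (sqProj_inSnd (edgePt h) _)
      rw [AddMonoidHom.comp_apply, hmap_comp, hmap_comp]
      rfl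
  have hR2 : ∀ a, (0, a) ∈ R := mem_of_flowZ_eq_zero_mem hG hcircle
    (R.comap (AddMonoidHom.inr (singHomology 1 (Realization G)) (singHomology 1 (Realization G)))) fun u v h x hx => by
      obtain ⟨y, rfl⟩ := exists_hmap_ofLE_eq hx
      let k : C(Realization (G.deleteEdges {s(u, v)}), confSpace G) :=
        ⟨fun y => ⟨(edgePt h, ofLE (G.deleteEdges_le {s(u, v)}) y),
          (ofLE_ne_edgePt h y).symm⟩, by fun_prop⟩
      refine ⟨hmap k 1 y, ?_⟩
      refine Eq.trans ?_ (sqProj_inFst (edgePt h) _)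
      rw [AddMonoidHom.comp_apply, hmap_comp, hmap_comp]
      rfl
  intro x
  have hx : sqProj G x ∈ R := by
    have h := add_mem (hR1 (sqProj G x).1) (hR2 (sqProj G x).2)
    rwa [Prod.mk_add_mk, add_zero, zero_add] at h
  obtain ⟨y, hy⟩ := hx
  exact ⟨y, (sqProj_bijective hG).1 hy⟩

theorem hmap_incl_discConf_surjective (hG : G.Connected)
    (hcircle : ¬ Nonempty (Realization G ≃ₜ Circle)) :
    Function.Surjective (hmap (incl (discConf G)) 1) := by
  intro x
  obtain ⟨y, rfl⟩ := hmap_incl_confSpace_surjective hG hcircle x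
  refine ⟨confEquiv G 1 y, ?_⟩
  have h : hmap (ContinuousMap.inclusion discConf_subset_confSpace) 1 (confEquiv G 1 y) = y :=
    (confEquiv G 1).symm_apply_apply y
  conv_rhs => rw [← h, hmap_comp]
  rfl

end Surjectivity

end GraphConf

theorem proposition3p4 {V : Type} [Fintype V] (G : SimpleGraph V) (hconn : G.Connected)
    (hcircle : ¬ Nonempty (GraphConf.Realization G ≃ₜ Circle)) :
    -- the two identifications entering the intersection form are isomorphisms
    Function.Bijective
      (GraphConf.crossProduct (GraphConf.Realization G) (GraphConf.Realization G)) ∧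
    ∃ hexc : Function.Bijective (GraphConf.excisionMap G),
      -- H₂(F(Γ, 2)) ≅ Ker I
      Nonempty (GraphConf.singHomology 2 (GraphConf.confSpace G) ≃+
        (GraphConf.intersectionForm G hexc).ker) ∧
      -- H₁(F(Γ, 2)) ≅ coker I ⊕ H₁(Γ) ⊕ H₁(Γ)
      Nonempty (GraphConf.singHomology 1 (GraphConf.confSpace G) ≃+
        (GraphConf.nbhdHomology 2 G ⧸ (GraphConf.intersectionForm G hexc).range) ×
          GraphConf.singHomology 1 (GraphConf.Realization G) ×
          GraphConf.singHomology 1 (GraphConf.Realization G)) :=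
  ⟨GraphConf.crossProduct_bijective G, GraphConf.excisionMap_bijective G,
    GraphConf.homology_conf_of_exact G _ (GraphConf.crossProduct_bijective G)
      (GraphConf.hmap_incl_discConf_injective G)
      (GraphConf.hmap_incl_discConf_surjective hconn hcircle)
      (AddEquiv.ofBijective (GraphConf.sqProj G) (GraphConf.sqProj_bijective hconn))⟩
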